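/- Let $n\ge 0$, let $A$ be a complete complex algebraic variety (reduced, not necessarily irreducible or projective), and let $\overline V\subseteq \mathbb P^n\times A$ be a Zariski closed irreducible subvariety of dimension $n$ whose projection to $\mathbb P^n$ is surjective of degree $d$, i.e. its fibre over every point of some non-empty Zariski open subset of $\mathbb P^n$ has exactly $d$ points. Embed $\mathbb C^n$ in $\mathbb P^n$ by $(z_1,\dots,z_n)\mapsto[1:z_1:\dots:z_n]$, let $H=\mathbb P^n\setminus\mathbb C^n$ be the hyperplane at infinity, and let $U_\ell=\{x_\ell\neq 0\}\subseteq\mathbb P^n$. For $1\le \ell\le n$, a point $c=[0:c_1:\dots:c_n]\in H\cap U_\ell$ normalised by $c_\ell=1$, and $\varepsilon>0$, the polydisc of radius $\varepsilon$ at $c$ in the chart $U_\ell$ is $$D^*=\{[x_0:\dots:x_n] : x_\ell=1,\ |x_0|<\varepsilon,\ |x_i-c_i|<\varepsilon \text{ for } i=1,\dots,n\}.$$ Let $$D=D^*\cap\mathbb C^n=\{z\in\mathbb C^n : |z_\ell|>\varepsilon^{-1},\ |z_i/z_\ell-c_i|<\varepsilon\text{ for } i=1,\dots,n\}.$$ For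 $\theta<\eta\le\theta+2\pi$ let $D_{(\theta,\eta)}$ be the set of $z\in D$ such that $\theta<\arg(z_\ell)<\eta$ for some choice of the argument, and let $D^*_{(\theta,\eta)}=D_{(\theta,\eta)}\cup(D^*\setminus D)$. Then there is a Zariski open dense subset $C$ of $H$ with the following property. For all $\ell\ge1$ and all $c\in C\cap U_\ell$ there is $\varepsilon_0>0$ such that for every $0<\varepsilon\le\varepsilon_0$ and all $\theta\in\mathbb R$, $\eta\in(\theta,\theta+2\pi]$ there are $d$ distinct maps $\alpha_1,\dots,\alpha_d:D^*_{(\theta,\eta)}\to A$, continuous for the complex topologies, such that: 1. for all $z\in D^*_{(\theta,\eta)}$ and all $i$ we have $(z,\alpha_i(z))\in\overline V$; 2. for all $(z,w)\in\overline V$ with $z\in D^*_{(\theta,\eta)}$ there is a $k$ such that $\alpha_k(z)=w$; 3. each restriction $\alpha_i|_{D_{(\theta,\eta)}}$ is complex analytic. -/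

import Mathlib

open CategoryTheory AlgebraicGeometry Limits

noncomputable section

attribute [local instance] MvPolynomial.gradedAlgebra

namespace AlgMap

/-! ### Complex points of a scheme over `ℂ`, and their complex topology -/

/-- The set `X(ℂ)` of complex points of a scheme `s : X ⟶ Spec ℂ` over `ℂ`. -/
def CPoints {X : Scheme.{0}} (s : X ⟶ Spec (.of ℂ)) : Type :=
  {p : Spec (.of ℂ) ⟶ X // p ≫ s = 𝟙 _}

namespace CPoints

variable {X : Scheme.{0}} {s : X ⟶ Spec (.of ℂ)}

/-- The (closed) point of the underlying Zariski space of `X` given by a complex point. -/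
def pt (x : CPoints s) : X := x.1 (IsLocalRing.closedPoint ℂ)

lemma top_le_preimage (x : CPoints s) {U : X.Opens} (h : x.pt ∈ U) : ⊤ ≤ x.1 ⁻¹ᵁ U := by
  intro q _
  rw [Subsingleton.elim q (IsLocalRing.closedPoint ℂ)]
  exact h

/-- The value `f(x) ∈ ℂ` of a regular function `f ∈ 𝒪_X(U)` at a complex point `x` of `U`. -/
def value (x : CPoints s) {U : X.Opens} (h : x.pt ∈ U) (f : Γ(X, U)) : ℂ :=
  (Scheme.ΓSpecIso (.of ℂ)).hom (x.1.appLE U ⊤ (x.top_le_preimage h) f)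

/-- The complex (analytic) topology on `X(ℂ)`: the coarsest topology in which every Zariski
open `U` is open and every regular function on such a `U` is continuous. -/
instance complexTopology : TopologicalSpace (CPoints s) :=
  TopologicalSpace.generateFrom
    {T | ∃ (U : X.Opens) (f : Γ(X, U)) (W : Set ℂ), IsOpen W ∧
      T = {x : CPoints s | ∃ h : x.pt ∈ U, x.value h f ∈ W}}

end CPoints

/-- A map `φ` from an open set `S ⊆ ℂⁿ` to the complex points of a scheme `X` of finite type
over `ℂ` is complex analytic: near each `z₀ ∈ S`, whenever `φ z₀` lies in a Zariski open `U`
and `f` is a regular function on `U`, the map `φ` takes values in `U` and `f ∘ φ` agrees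
with a holomorphic function. -/
def IsComplexAnalytic {X : Scheme.{0}} {s : X ⟶ Spec (.of ℂ)} {n : ℕ} {S : Set (Fin n → ℂ)}
    (φ : S → CPoints s) : Prop :=
  ∀ (U : X.Opens) (f : Γ(X, U)) (z₀ : S), (φ z₀).pt ∈ U →
    ∃ g : (Fin n → ℂ) → ℂ, AnalyticAt ℂ g z₀ ∧
      ∀ᶠ z : S in nhds z₀, ∃ h : (φ z).pt ∈ U, (φ z).value h f = g z

/-! ### Projective space -/

/-- The homogeneous coordinate ring of `ℙⁿ`, graded by degree. -/
abbrev grading (n : ℕ) : ℕ → Submodule ℂ (MvPolynomial (Fin (n + 1)) ℂ) :=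
  MvPolynomial.homogeneousSubmodule (Fin (n + 1)) ℂ

/-- Complex projective space `ℙⁿ = Proj ℂ[X₀, …, Xₙ]`. -/
abbrev P (n : ℕ) : Scheme.{0} := Proj (grading n)

/-- The structure morphism `ℙⁿ ⟶ Spec ℂ`. -/
def projStr (n : ℕ) : P n ⟶ Spec (.of ℂ) :=
  Proj.toSpecZero (grading n) ≫ Spec.map (CommRingCat.ofHom (algebraMap ℂ (grading n 0)))

/-- Evaluation of polynomials at `x ∈ ℂⁿ⁺¹`, as a ring map to the functions on `Spec ℂ`. -/
def evalSections {n : ℕ} (x : Fin (n + 1) → ℂ) :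
    MvPolynomial (Fin (n + 1)) ℂ →+* Γ(Spec (.of ℂ), ⊤) :=
  (Scheme.ΓSpecIso (.of ℂ)).inv.hom.comp (MvPolynomial.eval x)

lemma irrelevant_map_evalSections {n : ℕ} {x : Fin (n + 1) → ℂ} (hx : x ≠ 0) :
    (HomogeneousIdeal.irrelevant (grading n)).toIdeal.map (evalSections x) = ⊤ := by
  obtain ⟨i, hi⟩ := Function.ne_iff.mp hx
  refine Ideal.eq_top_of_isUnit_mem _
    (Ideal.mem_map_of_mem (evalSections x) (x := MvPolynomial.X i) ?_) ?_
  · exact HomogeneousIdeal.mem_irrelevant_of_mem _ Nat.one_pos (MvPolynomial.isHomogeneous_X ℂ i)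
  · have : IsUnit (MvPolynomial.eval x (MvPolynomial.X i)) := by simpa using hi
    exact this.map (Scheme.ΓSpecIso (.of ℂ)).inv.hom

/-- The complex point `[x₀ : ⋯ : xₙ]` of `ℙⁿ`. -/
def homogPt {n : ℕ} (x : Fin (n + 1) → ℂ) (hx : x ≠ 0) : CPoints (projStr n) :=
  ⟨Proj.fromOfGlobalSections (grading n) (evalSections x) (irrelevant_map_evalSections hx), by
    have h : ((evalSections x).comp (algebraMap (grading n 0)
        (MvPolynomial (Fin (n + 1)) ℂ))).comp (algebraMap ℂ (grading n 0)) =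
        (Scheme.ΓSpecIso (.of ℂ)).inv.hom := by
      refine RingHom.ext fun t => ?_
      change (Scheme.ΓSpecIso (.of ℂ)).inv.hom (MvPolynomial.eval x (MvPolynomial.C t)) = _
      rw [MvPolynomial.eval_C]
    rw [projStr, Proj.fromOfGlobalSections_toSpecZero_assoc, ← Spec.map_comp,
      ← CommRingCat.ofHom_comp, h]
    exact toSpecΓ_SpecMap_ΓSpecIso_inv _⟩

/-- The hyperplane at infinity `H = ℙⁿ ∖ ℂⁿ = {X₀ = 0}`, with its Zariski topology. -/
def hyperplaneAtInfinity (n : ℕ) : Set (P n) :=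
  {p | p ∉ Proj.basicOpen (grading n) (MvPolynomial.X 0)}

lemma cons_ne_zero_of_eq_one {n : ℕ} (a : ℂ) {x : Fin n → ℂ} {l : Fin n} (h : x l = 1) :
    (Fin.cons a x : Fin (n + 1) → ℂ) ≠ 0 := fun h0 => by
  have := congrFun h0 l.succ
  simp [h] at this

lemma cons_one_ne_zero {n : ℕ} (z : Fin n → ℂ) : (Fin.cons 1 z : Fin (n + 1) → ℂ) ≠ 0 :=
  fun h0 => by simpa using congrFun h0 0

/-- The embedding `ℂⁿ → ℙⁿ`, `(z₁, …, zₙ) ↦ [1 : z₁ : ⋯ : zₙ]`. -/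
def affinePt {n : ℕ} (z : Fin n → ℂ) : CPoints (projStr n) :=
  homogPt (Fin.cons 1 z) (cons_one_ne_zero z)

/-! ### Polydiscs and sector domains

The homogeneous coordinates are `x₀` and `x₁, …, xₙ`; the latter, and the charts `U_ℓ` with
`ℓ ≥ 1`, are indexed by `Fin n`. The centre is `[0 : c₁ : ⋯ : cₙ]`, normalised by `c_ℓ = 1`. -/

section Sector

variable {n : ℕ} (l : Fin n) (c : Fin n → ℂ) (ε θ η : ℝ)

/-- The polydisc `D*` of radius `ε` centred at `[0 : c₁ : ⋯ : cₙ]` in the chart `U_ℓ`. -/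
def polydisc : Set (CPoints (projStr n)) :=
  {p | ∃ (x₀ : ℂ) (x : Fin n → ℂ) (h : x l = 1), ‖x₀‖ < ε ∧ (∀ i, ‖x i - c i‖ < ε) ∧
    p = homogPt (Fin.cons x₀ x) (cons_ne_zero_of_eq_one x₀ h)}

/-- The finite part `D = D* ∩ ℂⁿ` of the polydisc, in affine coordinates. -/
def finitePart : Set (Fin n → ℂ) :=
  {z | ε⁻¹ < ‖z l‖ ∧ ∀ i, ‖z i / z l - c i‖ < ε}

/-- The sector domain `D_(θ,η)`: the points of `D` such that `θ < arg z_ℓ < η` for some choice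
of the argument of `z_ℓ`. -/
def sectorDomain : Set (Fin n → ℂ) :=
  {z | z ∈ finitePart l c ε ∧
    ∃ t : ℝ, θ < t ∧ t < η ∧ z l = ‖z l‖ * Complex.exp (t * Complex.I)}

/-- The sector domain `D*_(θ,η) = D_(θ,η) ∪ (D* ∖ D)`, a subset of `ℙⁿ(ℂ)`. -/
def sectorDomainStar : Set (CPoints (projStr n)) :=
  affinePt '' sectorDomain l c ε θ η ∪ (polydisc l c ε \ affinePt '' finitePart l c ε)

/-- The inclusion `D_(θ,η) → D*_(θ,η)`. -/
def sectorIncl (z : sectorDomain l c ε θ η) : sectorDomainStar l c ε θ η :=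
  ⟨affinePt z, Or.inl (Set.mem_image_of_mem _ z.2)⟩

end Sector

/-! ### Products with projective space -/

/-- The point `(z, w)` of (the Zariski space of) `ℙⁿ × A`, for complex points `z` of `ℙⁿ`
and `w` of `A`. -/
def prodPt {n : ℕ} {A : Scheme.{0}} {a : A ⟶ Spec (.of ℂ)}
    (z : CPoints (projStr n)) (w : CPoints a) : ↥(pullback (projStr n) a) :=
  pullback.lift z.1 w.1 (z.2.trans w.2.symm) (IsLocalRing.closedPoint ℂ)

/-- The projection to `ℙⁿ` of a subvariety `V` of `ℙⁿ × A` has degree `d`: the generic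
fibre has (finite) cardinality `d`, that is, there is a non-empty Zariski open subset of `ℙⁿ`
over each complex point of which `V` has exactly `d` complex points. -/
def HasDegree {n : ℕ} {A : Scheme.{0}} {a : A ⟶ Spec (.of ℂ)}
    (V : Set ↥(pullback (projStr n) a)) (d : ℕ) : Prop :=
  ∃ U : (P n).Opens, (U : Set (P n)).Nonempty ∧
    ∀ z : CPoints (projStr n), z.pt ∈ U → {w : CPoints a | prodPt z w ∈ V}.encard = d

end AlgMap

end

/-! Give `V` its reduced structure, so that it becomes an integral scheme `X` with a proper
surjective morphism `f : X ⟶ ℙⁿ`. Some complex point has a finite fibre, and a proper morphism is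
finite near a point with finite fibre; so `f` is generically finite and functions on `X` are
algebraic over functions on `ℙⁿ`. Over the generic point of `H`, where `t = X₀/X_l` generates a
prime ideal, an algebraic equation divided by its highest power of `t` stays nonzero modulo `t`;
hence this fibre is finite too (`finite_primesOver_span_singleton`). Thus `f` is finite over some `F
≠ 0` with `X₀ ∤ F` (`exists_finite_basicOpen`).

Let `R` be the ring of degree zero fractions over `F`, which is integrally closed, and `B` the ring
of functions on the preimage, finite over `R`. A primitive element `b` and a denominator `D`
describe `B` away from `D = 0`: the points of `B` above a point of `R` are the roots of the
separable polynomial `minpoly R b` (`exists_generic_generator`, `encard_ringHom_extensions`), whose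
degree must therefore be `d`. Write the numerator of `D` as `X₀ ^ j * Q` with `X₀ ∤ Q`. Near a point
of `H` where `F * Q ≠ 0`, ramification can occur only along `H`, and `C` is the set of these points.

In the chart `U_ℓ` the coordinate `u_ℓ = 1/z_ℓ` turns a sector at infinity into a sector at `u_ℓ =
0`, whose logarithm is a convex set. Covering theory gives `d` continuous roots there, and the
implicit function theorem makes them analytic. On each branch an element of `B` is a root of a monic
polynomial with coefficients continuous up to `u_ℓ = 0`: it is bounded, has finitely many cluster
points, and small sectors are connected, so it converges. The limits are ring homomorphisms, that
is, points of `X`, and a prime avoidance argument shows that no point over `H` is missed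
(`exists_branches`). Branches may meet on `H`; distinctness of the maps is seen inside the sector.
-/

noncomputable section

attribute [local instance] MvPolynomial.gradedAlgebra

namespace AlgMap

section

/-! ### Analytic families of separable polynomials -/

section Roots

open Polynomial Filter Topology

variable {E : Type*} [NormedAddCommGroup E] [NormedSpace ℂ E]

/-- A family of monic separable complex polynomials of degree `m` over `S`, whose coefficients
are analytic functions. -/
structure IsAnalyticFamily (P : E → ℂ[X]) (m : ℕ) (S : Set E) : Prop where
  isOpen : IsOpen S
  monic : ∀ u ∈ S, (P u).Monic
  natDegree : ∀ u ∈ S, (P u).natDegree = m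
  separable : ∀ u ∈ S, (P u).Separable
  analyticAt : ∀ i, ∀ u ∈ S, AnalyticAt ℂ (fun u => (P u).coeff i) u

namespace IsAnalyticFamily

variable {P : E → ℂ[X]} {m : ℕ} {S : Set E} (h : IsAnalyticFamily P m S)

include h

lemma eval_eq_sum {u : E} (hu : u ∈ S) (t : ℂ) :
    (P u).eval t = ∑ i ∈ Finset.range (m + 1), (P u).coeff i * t ^ i := by
  rw [eval_eq_sum_range, h.natDegree u hu]

theorem card_roots {u : E} (hu : u ∈ S) : (P u).roots.toFinset.card = m := by
  rw [Multiset.toFinset_card_of_nodup (nodup_roots (h.separable u hu)),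
    ← h.natDegree u hu]
  exact (IsAlgClosed.splits (P u)).natDegree_eq_card_roots.symm

lemma mem_roots {u : E} (hu : u ∈ S) {t : ℂ} :
    t ∈ (P u).roots.toFinset ↔ (P u).eval t = 0 := by
  simp [(h.monic u hu).ne_zero]

variable [CompleteSpace E]

/-- The implicit function theorem applies because separability makes the derivative in the root
variable nonzero. The equivalence says that near `(u₀, t₀)` the graph of `r` is the whole zero set,
which gives local uniqueness of roots. -/
theorem exists_analytic_root {u₀ : E} (hu₀ : u₀ ∈ S) {t₀ : ℂ} (ht₀ : (P u₀).eval t₀ = 0) :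
    ∃ r : E → ℂ, AnalyticAt ℂ r u₀ ∧ r u₀ = t₀ ∧
      ∀ᶠ v in 𝓝 (u₀, t₀), ((P v.1).eval v.2 = 0 ↔ r v.1 = v.2) := by
  let F : E × ℂ → ℂ := fun v => ∑ i ∈ Finset.range (m + 1), (P v.1).coeff i * v.2 ^ i
  have hFe : ∀ u ∈ S, ∀ t, F (u, t) = (P u).eval t := fun u hu t => (h.eval_eq_sum hu t).symm
  have hF : AnalyticAt ℂ F (u₀, t₀) := by
    refine Finset.analyticAt_fun_sum _ fun i _ => AnalyticAt.mul ?_ (analyticAt_snd.pow i)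
    exact AnalyticAt.fun_comp (g := fun u => (P u).coeff i) (f := Prod.fst) (h.analyticAt i u₀ hu₀) analyticAt_fst
  have hFu : F (u₀, t₀) = 0 := by rw [hFe _ hu₀, ht₀]
  have hder : (fderiv ℂ F (u₀, t₀) ∘L .inr ℂ E ℂ) =
      ContinuousLinearMap.toSpanSingleton ℂ ((P u₀).derivative.eval t₀) := by
    have h1 : HasFDerivAt (fun t : ℂ => F (u₀, t)) (fderiv ℂ F (u₀, t₀) ∘L .inr ℂ E ℂ) t₀ :=
      HasFDerivAt.comp t₀ hF.differentiableAt.hasFDerivAt (hasFDerivAt_prodMk_right u₀ t₀)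
    have h2 : HasDerivAt (fun t : ℂ => F (u₀, t)) ((P u₀).derivative.eval t₀) t₀ := by
      simpa only [hFe u₀ hu₀] using (P u₀).hasDerivAt t₀
    exact h1.unique h2.hasFDerivAt
  have hne : (P u₀).derivative.eval t₀ ≠ 0 := by
    have := (h.separable u₀ hu₀).eval₂_derivative_ne_zero (RingHom.id ℂ) (x := t₀)
      (by simpa [eval₂_id] using ht₀)
    simpa [eval₂_id] using this
  have hinv : (fderiv ℂ F (u₀, t₀) ∘L .inr ℂ E ℂ).IsInvertible := by
    rw [hder]
    refine ⟨ContinuousLinearEquiv.unitsEquivAut ℂ (.mk0 _ hne), ?_⟩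
    ext
    simp
  have hc : ContDiffAt ℂ ⊤ F (u₀, t₀) := hF.contDiffAt
  refine ⟨hc.implicitFunction (by simp) hinv,
    (hc.contDiffAt_implicitFunction (by simp) hinv).analyticAt,
    hc.implicitFunction_apply_self (by simp) hinv, ?_⟩
  have hS : ∀ᶠ v in 𝓝 (u₀, t₀), v.1 ∈ S :=
    continuous_fst.continuousAt.eventually (h.isOpen.mem_nhds hu₀)
  filter_upwards [hc.eventually_apply_eq_iff_implicitFunction (by simp) hinv, hS] with v hv hvS
  rw [← hFe v.1 hvS, ← hv, hFu]

/-- A continuous choice of a root is analytic. -/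
theorem analyticAt_of_continuousAt {u₀ : E} (hu₀ : u₀ ∈ S) {ρ : E → ℂ} (hρ : ContinuousAt ρ u₀)
    (hroot : ∀ᶠ u in 𝓝 u₀, (P u).eval (ρ u) = 0) : AnalyticAt ℂ ρ u₀ := by
  obtain ⟨r, hr, hr₀, hiff⟩ := h.exists_analytic_root hu₀ hroot.self_of_nhds
  have hc : Tendsto (fun u => (u, ρ u)) (𝓝 u₀) (𝓝 (u₀, ρ u₀)) := continuousAt_id.prodMk hρ
  refine hr.congr ?_
  filter_upwards [hc.eventually hiff, hroot] with u h1 h2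
  exact h1.1 h2

/-- The space of roots of the family is a covering of `S`. -/
theorem isCoveringMapOn :
    IsCoveringMapOn (fun x : {x : E × ℂ // x.1 ∈ S ∧ (P x.1).eval x.2 = 0} => x.1.1) S := by
  intro u₀ hu₀
  let I := {t // t ∈ (P u₀).roots.toFinset}
  have hI : Fintype.card I = m := by rw [Fintype.card_coe]; exact h.card_roots hu₀
  choose r hr hr₀ hiff using fun i : I => h.exists_analytic_root hu₀ ((h.mem_roots hu₀).1 i.2)
  have hroot : ∀ i, ∀ᶠ u in 𝓝 u₀, (P u).eval (r i u) = 0 := by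
    intro i
    have hc : Tendsto (fun u => (u, r i u)) (𝓝 u₀) (𝓝 (u₀, i.1)) := by
      have := continuousAt_id.prodMk (hr i).continuousAt
      rwa [ContinuousAt, hr₀] at this
    filter_upwards [hc.eventually (hiff i)] with u hu using hu.2 rfl
  have hdist : ∀ i j : I, i ≠ j → ∀ᶠ u in 𝓝 u₀, r i u ≠ r j u := by
    intro i j hij
    refine ((hr i).continuousAt.ne_iff_eventually_ne (hr j).continuousAt).1 ?_
    rw [hr₀, hr₀]
    exact fun e => hij (Subtype.ext e)
  have hcont : ∀ i, ∀ᶠ u in 𝓝 u₀, ContinuousAt (r i) u := fun i =>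
    (hr i).eventually_analyticAt.mono fun u hu => hu.continuousAt
  have hall : ∀ᶠ u in 𝓝 u₀, u ∈ S ∧ (∀ i, (P u).eval (r i u) = 0) ∧
      (∀ i j : I, i ≠ j → r i u ≠ r j u) ∧ ∀ i, ContinuousAt (r i) u := by
    refine Eventually.and (h.isOpen.mem_nhds hu₀) ((eventually_all.2 hroot).and
      (Eventually.and ?_ (eventually_all.2 hcont)))
    refine eventually_all.2 fun i => eventually_all.2 fun j => ?_
    by_cases hij : i = j
    · exact .of_forall fun u hu => absurd hij hu
    · exact (hdist i j hij).mono fun u hu _ => hu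
  obtain ⟨N, hN, hNo, hu₀N⟩ := eventually_nhds_iff.1 hall
  -- Over `N` the `r i` take `m` distinct values among the `m` roots, so they exhaust them; the
  -- index of the root is then the sheet number of the trivialisation.
  have hex : ∀ u ∈ N, ∀ t, (P u).eval t = 0 → ∃ i, r i u = t := by
    intro u hu t ht
    obtain ⟨huS, h1, h2, -⟩ := hN u hu
    have hinj : Function.Injective fun i => r i u := fun i j hij => by
      by_contra hne
      exact h2 i j hne hij
    have himg : Finset.univ.image (fun i => r i u) = (P u).roots.toFinset := by
      refine Finset.eq_of_subset_of_card_le ?_ ?_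
      · intro t ht
        obtain ⟨i, -, rfl⟩ := Finset.mem_image.1 ht
        exact (h.mem_roots huS).2 (h1 i)
      · rw [h.card_roots huS, Finset.card_image_of_injective _ hinj, Finset.card_univ, hI]
    have := (h.mem_roots huS).2 ht
    rw [← himg] at this
    obtain ⟨i, -, hi⟩ := Finset.mem_image.1 this
    exact ⟨i, hi⟩
  let T := {x : E × ℂ // x.1 ∈ S ∧ (P x.1).eval x.2 = 0}
  let f : T → E := fun x => x.1.1
  let t : T → ℂ := fun x => x.1.2
  have hf : Continuous f := by fun_prop
  have ht : Continuous t := by fun_prop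
  have hex' : ∀ x : f ⁻¹' N, ∃ i, r i (f x) = t x := fun x => hex _ x.2 _ x.1.2.2
  choose idx hidx using hex'
  have hidx' : ∀ (x : f ⁻¹' N) i, r i (f x) = t x → idx x = i := by
    intro x i hi
    by_contra hne
    exact (hN _ x.2).2.2.1 _ _ hne ((hidx x).trans hi.symm)
  have hrc : ∀ i, Continuous fun u : N => r i u := fun i =>
    continuous_iff_continuousAt.2 fun u =>
      ((hN u u.2).2.2.2 i).comp continuous_subtype_val.continuousAt
  let _ : TopologicalSpace I := ⊥
  have : DiscreteTopology I := ⟨rfl⟩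
  -- The preimage of any set of indices is a finite union of loci where two continuous functions
  -- agree, hence closed.
  have hidxc : Continuous idx := by
    refine continuous_iff_isClosed.2 fun s _ => ?_
    have : idx ⁻¹' s = ⋃ i ∈ s, {x : f ⁻¹' N | r i (f x) = t x} := by
      ext x
      simp only [Set.mem_preimage, Set.mem_iUnion, Set.mem_ofPred_eq, exists_prop]
      exact ⟨fun hx => ⟨_, hx, hidx x⟩, fun ⟨i, hi, hx⟩ => hidx' x i hx ▸ hi⟩
    rw [this]
    refine s.toFinite.isClosed_biUnion fun i _ => isClosed_eq ?_ (by fun_prop)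
    exact (hrc i).comp (f := fun x : f ⁻¹' N => (⟨f x.1, x.2⟩ : N))
      (by fun_prop)
  refine IsEvenlyCovered.to_isEvenlyCovered_preimage (I := I) ⟨this, N, hu₀N, hNo, hNo.preimage hf,
    { toFun x := (⟨f x.1, x.2⟩, idx x)
      invFun y := ⟨⟨(y.1, r y.2 y.1), (hN _ y.1.2).1, (hN _ y.1.2).2.1 _⟩, y.1.2⟩
      left_inv x := Subtype.ext (Subtype.ext (Prod.ext rfl (hidx x)))
      right_inv y := Prod.ext rfl (hidx' _ _ rfl)
      continuous_toFun := by fun_prop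
      continuous_invFun := ?_ }, fun x => rfl⟩
  refine Continuous.subtype_mk (Continuous.subtype_mk (Continuous.prodMk (by fun_prop) ?_) _) _
  rw [continuous_prod_of_discrete_right]
  exact fun i => hrc i

/-- Over a simply connected space, an analytic family of separable polynomials has `m` continuous
root functions, which are everywhere distinct. -/
theorem exists_continuous_roots {A : Type*} [TopologicalSpace A] [SimplyConnectedSpace A]
    [LocallyPathConnectedSpace A] (f : C(A, E)) (hf : ∀ a, f a ∈ S) :
    ∃ ρ : Fin m → C(A, ℂ), (∀ i a, (P (f a)).eval (ρ i a) = 0) ∧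
      ∀ a, Function.Injective fun i => ρ i a := by
  obtain ⟨a₀⟩ : Nonempty A := inferInstance
  let e : Fin m ≃ {t // t ∈ (P (f a₀)).roots.toFinset} :=
    (Fintype.equivFinOfCardEq (by rw [Fintype.card_coe]; exact h.card_roots (hf a₀))).symm
  have he (i) : (P (f a₀)).eval (e i).1 = 0 := (h.mem_roots (hf a₀)).1 (e i).2
  have cov := h.isCoveringMapOn
  choose F hF using fun i => (cov.existsUnique_continuousMap_lifts f (a₀ := a₀)
    (e₀ := ⟨(f a₀, (e i).1), hf a₀, he i⟩) rfl hf).exists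
  have hF1 (i a) : (F i a).1.1 = f a := congrFun (hF i).2 a
  refine ⟨fun i => ⟨fun a => (F i a).1.2, by fun_prop⟩, fun i a => ?_, fun a i j hij => ?_⟩
  · have := (F i a).2.2
    rwa [hF1] at this
  -- Lifts through a covering that agree at `a` agree everywhere, whereas the lifts start at
  -- different roots over `a₀`.
  · have hij' : F j a = F i a :=
      Subtype.ext (Prod.ext ((hF1 j a).trans (hF1 i a).symm) hij.symm)
    have := (cov.existsUnique_continuousMap_lifts f (a₀ := a) (e₀ := F i a) (hF1 i a)
      hf).unique ⟨rfl, (hF i).2⟩ ⟨hij', (hF j).2⟩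
    have h0 : (F i a₀).1.2 = (F j a₀).1.2 := by rw [this]
    rw [(hF i).1, (hF j).1] at h0
    exact e.injective (Subtype.ext h0)

end IsAnalyticFamily

end Roots

end

section

/-! ### Complex points of finite extensions of integrally closed domains -/

section FiniteExtension

open Polynomial

/-- Extension of complex points along integral ring homomorphisms. -/
theorem exists_ringHom_comp_eq_of_isIntegral {A B : Type*} [CommRing A] [CommRing B] {g : A →+* B}
    (hg : g.IsIntegral) (ψ : A →+* ℂ) (hψ : RingHom.ker g ≤ RingHom.ker ψ) :
    ∃ φ : B →+* ℂ, φ.comp g = ψ := by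
  algebraize [g]
  have : (RingHom.ker ψ).IsPrime := RingHom.ker_isPrime ψ
  obtain ⟨Q, -, hQ, hQP⟩ := Ideal.exists_ideal_over_prime_of_isIntegral (RingHom.ker ψ)
    (⊥ : Ideal B) hψ
  have : Q.LiesOver (RingHom.ker ψ) := ⟨hQP.symm⟩
  algebraize [RingHom.kerLift ψ]
  have : Module.IsTorsionFree (A ⧸ RingHom.ker ψ) ℂ :=
    Module.isTorsionFree_iff_algebraMap_injective.2 (RingHom.kerLift_injective ψ)
  have : Module.IsTorsionFree (A ⧸ RingHom.ker ψ) (B ⧸ Q) :=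
    Module.isTorsionFree_iff_algebraMap_injective.2
      (FaithfulSMul.algebraMap_injective (A ⧸ RingHom.ker ψ) (B ⧸ Q))
  let φ : (B ⧸ Q) →ₐ[A ⧸ RingHom.ker ψ] ℂ := IsAlgClosed.lift
  refine ⟨φ.toRingHom.comp (Ideal.Quotient.mk Q), RingHom.ext fun x => ?_⟩
  exact φ.commutes (Ideal.Quotient.mk _ x)

variable {R B : Type*} [CommRing R] [CommRing B] [Algebra R B]

lemma eval_map_minpoly (φ : B →+* ℂ) (b : B) :
    ((minpoly R b).map (φ.comp (algebraMap R B))).eval (φ b) = 0 := by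
  rw [Polynomial.eval_map, ← hom_eval₂, ← aeval_def, minpoly.aeval, map_zero]

lemma hom_aeval (φ : B →+* ℂ) {e : R →+* ℂ} (hφ : φ.comp (algebraMap R B) = e) (b : B) (q : R[X]) :
    φ (aeval b q) = (q.map e).eval (φ b) := by
  rw [aeval_def, hom_eval₂, Polynomial.eval_map, hφ]

variable [IsDomain R] [IsIntegrallyClosed R] [IsDomain B] [Module.Finite R B] [FaithfulSMul R B]

/-- As `R` is integrally closed, the polynomials killing `b` are exactly the multiples of `minpoly R
b`. Evaluation at the root `t` therefore vanishes on the kernel of `R[X] → B`, and lying over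
extends it along this integral map. -/
theorem exists_ringHom_apply_eq {e : R →+* ℂ} {b : B} {t : ℂ}
    (ht : ((minpoly R b).map e).eval t = 0) :
    ∃ φ : B →+* ℂ, φ.comp (algebraMap R B) = e ∧ φ b = t := by
  have hint : (aeval (R := R) b).toRingHom.IsIntegral := by
    intro x
    obtain ⟨p, hp, hpx⟩ := Algebra.IsIntegral.isIntegral (R := R) x
    refine ⟨p.map C, hp.map C, ?_⟩
    rw [eval₂_map]
    convert hpx
    ext r
    simp
  obtain ⟨φ, hφ⟩ := exists_ringHom_comp_eq_of_isIntegral hint (eval₂RingHom e t) fun p hp => by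
    have := (minpoly.isIntegrallyClosed_dvd_iff (Algebra.IsIntegral.isIntegral (R := R) b) p).1 hp
    obtain ⟨q, rfl⟩ := this
    rw [RingHom.mem_ker, map_mul, coe_eval₂RingHom, ← Polynomial.eval_map, ht, zero_mul]
  refine ⟨φ, RingHom.ext fun r => ?_, ?_⟩
  · simpa using congr($hφ (C r))
  · simpa using congr($hφ X)

-- The primitive element theorem for the fraction fields, with denominators cleared. One `D` serves
-- both purposes: it contains a substitute for the discriminant and the denominators of finitely
-- many module generators.
open nonZeroDivisors in
theorem exists_generic_generator [CharZero R] :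
    ∃ (b : B) (D : R), D ≠ 0 ∧
      (∀ e : R →+* ℂ, e D ≠ 0 → ((minpoly R b).map e).Separable) ∧
      ∀ b' : B, ∃ q : R[X], D • b' = aeval b q := by
  let K := FractionRing R
  let L := FractionRing B
  let _ : Algebra K L := FractionRing.liftAlgebra R L
  have : IsScalarTower R K L := FractionRing.isScalarTower_liftAlgebra R L
  have : IsLocalization (Algebra.algebraMapSubmonoid B R⁰) L := inferInstance
  have : FiniteDimensional K L := .of_isLocalization R B R⁰
  have : CharZero K := charZero_of_injective_algebraMap (IsFractionRing.injective R K)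
  have hRK : Function.Injective (algebraMap R K) := IsFractionRing.injective R K
  have hBL : Function.Injective (algebraMap B L) := IsFractionRing.injective B L
  obtain ⟨α, hα⟩ := Field.exists_primitive_element K L
  -- Multiplying the primitive element by a nonzero scalar of `R` moves it into `B` without changing
  -- the field it generates.
  obtain ⟨⟨b, ⟨_, r, hr, rfl⟩⟩, hb⟩ := IsLocalization.surj (Algebra.algebraMapSubmonoid B R⁰) α
  have hr0 : r ≠ 0 := nonZeroDivisors.ne_zero hr
  have hbL : IntermediateField.adjoin K {algebraMap B L b} = ⊤ := by
    rw [← top_le_iff, ← hα, IntermediateField.adjoin_simple_le_iff]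
    have h1 : algebraMap K L (algebraMap R K r) ≠ 0 := by
      simpa using hr0
    have h2 : α = algebraMap B L b * (algebraMap K L (algebraMap R K r))⁻¹ := by
      rw [eq_mul_inv_iff_mul_eq₀ h1, ← hb, ← IsScalarTower.algebraMap_apply,
        ← IsScalarTower.algebraMap_apply]
    rw [h2]
    exact mul_mem (IntermediateField.mem_adjoin_simple_self _ _)
      (inv_mem (IntermediateField.algebraMap_mem _ _))
  have hgen : ∀ b' : B, ∃ s : R, s ≠ 0 ∧ ∃ q : R[X], s • b' = aeval b q := by
    intro b'
    have h1 : algebraMap B L b' ∈ Algebra.adjoin K {algebraMap B L b} := by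
      rw [← IntermediateField.adjoin_simple_toSubalgebra_of_isAlgebraic
        (Algebra.IsAlgebraic.isAlgebraic _), hbL]
      trivial
    rw [Algebra.adjoin_singleton_eq_range_aeval] at h1
    obtain ⟨f, hf⟩ := h1
    obtain ⟨s, hs, hsf⟩ := IsLocalization.integerNormalization_spec R⁰ f
    refine ⟨s, nonZeroDivisors.ne_zero hs, IsLocalization.integerNormalization R⁰ f, hBL ?_⟩
    have hf' : aeval (algebraMap B L b) f = algebraMap B L b' := hf
    rw [← aeval_algebraMap_apply, ← aeval_map_algebraMap K, hsf, ← algebraMap_smul K s f,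
      smul_eq_C_mul, map_mul, aeval_C, hf', Algebra.smul_def, map_mul,
      ← IsScalarTower.algebraMap_apply, ← IsScalarTower.algebraMap_apply]
  classical
  obtain ⟨S, hS⟩ := Module.Finite.fg_top (R := R) (M := B)
  choose s hs q hq using hgen
  -- A Bézout identity between the minimal polynomial and its derivative over `K`, cleared of
  -- denominators. It specialises to separability wherever `Δ` does not vanish.
  have hsep : ∃ Δ : R, Δ ≠ 0 ∧ ∃ U W : R[X],
      U * minpoly R b + W * derivative (minpoly R b) = C Δ := by
    have hp : minpoly K (algebraMap B L b) = (minpoly R b).map (algebraMap R K) :=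
      minpoly.isIntegrallyClosed_eq_field_fractions K L (Algebra.IsIntegral.isIntegral b)
    obtain ⟨u, w, huw⟩ := (minpoly.irreducible
      (Algebra.IsIntegral.isIntegral (R := K) (algebraMap B L b))).separable
    rw [hp, derivative_map] at huw
    obtain ⟨c₁, hc₁, hu⟩ := IsLocalization.integerNormalization_spec R⁰ u
    obtain ⟨c₂, hc₂, hw⟩ := IsLocalization.integerNormalization_spec R⁰ w
    refine ⟨c₁ * c₂, mul_ne_zero (nonZeroDivisors.ne_zero hc₁) (nonZeroDivisors.ne_zero hc₂),
      C c₂ * IsLocalization.integerNormalization R⁰ u,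
      C c₁ * IsLocalization.integerNormalization R⁰ w, map_injective _ hRK ?_⟩
    simp only [Polynomial.map_add, Polynomial.map_mul, hu, hw, map_C, map_mul]
    rw [← algebraMap_smul K c₁ u, ← algebraMap_smul K c₂ w, smul_eq_C_mul, smul_eq_C_mul]
    linear_combination C (algebraMap R K c₁) * C (algebraMap R K c₂) * huw
  obtain ⟨Δ, hΔ, U, W, hUW⟩ := hsep
  refine ⟨b, Δ * ∏ x ∈ S, s x, mul_ne_zero hΔ (Finset.prod_ne_zero_iff.2 fun x _ => hs x), ?_, ?_⟩
  · intro e he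
    rw [map_mul] at he
    have hΔe := left_ne_zero_of_mul he
    refine ⟨C (e Δ)⁻¹ * U.map e, C (e Δ)⁻¹ * W.map e, ?_⟩
    have := congr(Polynomial.map e $hUW)
    simp only [Polynomial.map_add, Polynomial.map_mul, map_C, ← derivative_map] at this
    rw [mul_assoc, mul_assoc, ← mul_add, this, ← C_mul, inv_mul_cancel₀ hΔe, C_1]
  · intro b'
    have hmem : b' ∈ Submodule.span R (S : Set B) := hS ▸ Submodule.mem_top
    have hx : ∀ x ∈ S, ∃ q : R[X], (Δ * ∏ x ∈ S, s x) • x = aeval b q := by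
      intro x hx
      rw [← Finset.mul_prod_erase S s hx]
      refine ⟨C (Δ * ∏ y ∈ S.erase x, s y) * q x, ?_⟩
      rw [map_mul, aeval_C, ← hq, ← Algebra.smul_def, smul_smul]
      ring_nf
    induction hmem using Submodule.span_induction with
    | mem x h => exact hx x h
    | zero => exact ⟨0, by simp⟩
    | add x y _ _ h1 h2 =>
      obtain ⟨q₁, h1⟩ := h1
      obtain ⟨q₂, h2⟩ := h2
      exact ⟨q₁ + q₂, by rw [smul_add, h1, h2, map_add]⟩
    | smul c x _ h1 =>
      obtain ⟨q₁, h1⟩ := h1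
      exact ⟨C c * q₁, by rw [smul_comm, h1, map_mul, aeval_C, Algebra.smul_def]⟩

end FiniteExtension

end

section

/-! ### Limits of algebraic functions along filters of connected sets -/

section ClusterPoints

open Filter Topology

/-- A bounded function with finitely many cluster points converges along a filter with a basis of
connected sets on which the function is continuous. -/
theorem exists_tendsto_of_finite_mapClusterPt {X : Type*} [TopologicalSpace X] {F : Filter X}
    [F.NeBot] {f : X → ℂ} (hconn : ∀ s ∈ F, ∃ s' ∈ F, s' ⊆ s ∧ IsPreconnected s' ∧ ContinuousOn f s')
    {C : ℝ} (hC : ∀ᶠ x in F, ‖f x‖ ≤ C) {K : Set ℂ} (hK : K.Finite)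
    (hcl : ∀ t, MapClusterPt t F f → t ∈ K) : ∃ t, Tendsto f F (𝓝 t) := by
  have hcpt : IsCompact (Metric.closedBall (0 : ℂ) C) := isCompact_closedBall _ _
  have hC' : ∀ᶠ x in F, f x ∈ Metric.closedBall (0 : ℂ) C := by simpa using hC
  obtain ⟨t₁, -, ht₁⟩ := hcpt.exists_mapClusterPt_of_frequently hC'.frequently
  refine ⟨t₁, hcpt.tendsto_nhds_of_unique_mapClusterPt hC' fun t₂ _ ht₂ => ?_⟩
  by_contra hne
  -- A radius between the two cluster points such that the sphere about `t₁` contains no point of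
  -- the finite set `K`. By compactness `f` eventually avoids this sphere.
  obtain ⟨r, ⟨hr0, hr1⟩, hrK⟩ :=
    ((Set.Ioo_infinite (dist_pos.2 hne)).sdiff (hK.image fun k => dist k t₁)).nonempty
  have hsph : ∀ᶠ x in F, dist (f x) t₁ ≠ r := by
    by_contra hcon
    have hfreq : ∃ᶠ x in F, f x ∈ Metric.sphere t₁ r := by
      rw [not_eventually] at hcon
      exact hcon.mono fun x hx => not_not.1 hx
    obtain ⟨k, hk, hkc⟩ := (isCompact_sphere t₁ r).exists_mapClusterPt_of_frequently hfreq
    exact hrK ⟨k, hcl k hkc, hk⟩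
  obtain ⟨s, hsF, hs, hspre, hscont⟩ := hconn _ hsph
  have h1 : ∃ x ∈ s, dist (f x) t₁ < r :=
    ((ht₁.frequently (Metric.ball_mem_nhds t₁ hr0)).and_eventually hsF).exists.imp
      fun x hx => ⟨hx.2, hx.1⟩
  have h2 : ∃ x ∈ s, r < dist (f x) t₁ := by
    have hn : {t | r < dist t t₁} ∈ 𝓝 t₂ :=
      (isOpen_lt continuous_const (by fun_prop)).mem_nhds hr1
    exact ((ht₂.frequently hn).and_eventually hsF).exists.imp fun x hx => ⟨hx.2, hx.1⟩
  -- On a connected set `f` has values on both sides of the sphere, so it must hit it: a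
  -- contradiction.
  obtain ⟨x, hx, hxr⟩ := h1
  obtain ⟨y, hy, hyr⟩ := h2
  obtain ⟨w, hw, hwr⟩ := hspre.intermediate_value hx hy
    (f := fun x => dist (f x) t₁) ((continuous_id.dist continuous_const).comp_continuousOn hscont) ⟨hxr.le, hyr.le⟩
  exact hs hw hwr

open Polynomial

variable {R X : Type*} [CommRing R] {p : R[X]} {F : Filter X} {e : X → R →+* ℂ} {e₀ : R →+* ℂ}
  {f : X → ℂ}

lemma tendsto_eval_map {t : ℂ} (he : ∀ r, Tendsto (fun x => e x r) F (𝓝 (e₀ r)))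
    (hf : Tendsto f F (𝓝 t)) (p : R[X]) :
    Tendsto (fun x => (p.map (e x)).eval (f x)) F (𝓝 ((p.map e₀).eval t)) := by
  simp only [Polynomial.eval_map, eval₂_eq_sum_range]
  exact tendsto_finsetSum _ fun i _ => (he _).mul (hf.pow i)

/-- A cluster point is a limit along a finer ultrafilter, and the equation passes to that limit. -/
theorem eval_eq_zero_of_mapClusterPt (he : ∀ r, Tendsto (fun x => e x r) F (𝓝 (e₀ r)))
    (hroot : ∀ᶠ x in F, (p.map (e x)).eval (f x) = 0) {t : ℂ} (ht : MapClusterPt t F f) :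
    (p.map e₀).eval t = 0 := by
  obtain ⟨U, hU, hUt⟩ := mapClusterPt_iff_ultrafilter.1 ht
  have h1 := tendsto_eval_map (fun r => (he r).mono_left hU) hUt p
  have h2 : (fun x => (p.map (e x)).eval (f x)) =ᶠ[U] fun _ => 0 := hU hroot
  exact tendsto_nhds_unique (h1.congr' h2) tendsto_const_nhds |>.symm ▸ rfl

/-- Cauchy's bound for the roots of a monic polynomial depends only on its coefficients, and these
converge. -/
theorem exists_eventually_norm_root_le (hp : p.Monic)
    (he : ∀ r, Tendsto (fun x => e x r) F (𝓝 (e₀ r)))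
    (hroot : ∀ᶠ x in F, (p.map (e x)).eval (f x) = 0) : ∃ C : ℝ, ∀ᶠ x in F, ‖f x‖ ≤ C := by
  refine ⟨∑ i ∈ Finset.range p.natDegree, (‖e₀ (p.coeff i)‖ + 1) + 1, ?_⟩
  have hb : ∀ᶠ x in F, ∀ i ∈ Finset.range p.natDegree,
      ‖e x (p.coeff i)‖ ≤ ‖e₀ (p.coeff i)‖ + 1 := by
    rw [Filter.eventually_all_finset]
    intro i _
    exact (((he (p.coeff i)).norm.eventually_lt_const (lt_add_one _)).mono fun x hx => hx.le)
  filter_upwards [hroot, hb] with x hx hbx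
  have hmon := hp.map (e x)
  have h1 := (IsRoot.def.2 hx).norm_lt_cauchyBound hmon.ne_zero
  have h2 : cauchyBound (p.map (e x)) ≤
      ∑ i ∈ Finset.range p.natDegree, ‖(p.map (e x)).coeff i‖₊ + 1 := by
    rw [cauchyBound, hmon.leadingCoeff, nnnorm_one, div_one, hp.natDegree_map]
    gcongr
    exact Finset.sup_le fun i hi =>
      Finset.single_le_sum (f := fun i => ‖(p.map (e x)).coeff i‖₊) (fun _ _ => zero_le) hi
  have h3 : ‖f x‖ ≤ ∑ i ∈ Finset.range p.natDegree, ‖(p.map (e x)).coeff i‖ + 1 := by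
    have := h1.le.trans h2
    rw [← NNReal.coe_le_coe] at this
    simpa using this
  refine h3.trans ?_
  gcongr with i hi
  simpa using hbx i hi

end ClusterPoints

/-! ### Sectors -/

section SectorGeometry

open Filter Topology Complex Function

variable {n : ℕ} (l : Fin n) (N : Set (Fin n → ℂ)) (ρ a b : ℝ)

/-- The points of the cylinder over `N`, punctured along `u l = 0`, whose coordinate `u l` has
absolute value less than `ρ` and an argument between `a` and `b`. -/
def sectorSet : Set (Fin n → ℂ) :=
  {u | update u l 0 ∈ N ∧ 0 < ‖u l‖ ∧ ‖u l‖ < ρ ∧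
    ∃ t : ℝ, a < t ∧ t < b ∧ u l = ‖u l‖ * exp (t * I)}

/-- The logarithmic model of `sectorSet`. -/
def logSectorSet : Set (Fin n → ℂ) :=
  {v | update v l 0 ∈ N ∧ (v l).re < Real.log ρ ∧ a < (v l).im ∧ (v l).im < b}

/-- Exponentiation of the `l`-th coordinate. -/
def expCoord (v : Fin n → ℂ) : Fin n → ℂ := update v l (exp (v l))

/-- A branch on the sector with arguments between `a` and `b` of the logarithm of the `l`-th
coordinate. -/
def logCoord (u : Fin n → ℂ) : Fin n → ℂ :=
  update u l (log (u l * exp (-(((a + b) / 2 : ℝ) * I))) + ((a + b) / 2 : ℝ) * I)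

lemma continuous_expCoord : Continuous (expCoord l) :=
  continuous_id.update l (by fun_prop)

variable {l N ρ a b}

lemma convex_logSectorSet (hN : Convex ℝ N) : Convex ℝ (logSectorSet l N ρ a b) := by
  intro x hx y hy s t hs ht hst
  obtain ⟨hx1, hx2, hx3, hx4⟩ := hx
  obtain ⟨hy1, hy2, hy3, hy4⟩ := hy
  have hupd : update (s • x + t • y) l 0 = s • update x l 0 + t • update y l 0 := by
    ext i
    by_cases hi : i = l
    · subst hi; simp
    · simp [hi]
  refine ⟨by rw [hupd]; exact hN hx1 hy1 hs ht hst, ?_, ?_, ?_⟩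
  · have := convex_Iio (Real.log ρ) hx2 hy2 hs ht hst
    simpa using this
  · have := convex_Ioi a hx3 hy3 hs ht hst
    simpa using this
  · have := convex_Iio b hx4 hy4 hs ht hst
    simpa using this

lemma expCoord_mem (hρ : 0 < ρ) {v : Fin n → ℂ} (hv : v ∈ logSectorSet l N ρ a b) :
    expCoord l v ∈ sectorSet l N ρ a b := by
  obtain ⟨h1, h2, h3, h4⟩ := hv
  refine ⟨by simpa [expCoord] using h1, by simp [expCoord], ?_, (v l).im, h3, h4, ?_⟩
  · simpa [expCoord, norm_exp] using (Real.lt_log_iff_exp_lt hρ).1 h2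
  · simp only [expCoord, update_self, norm_exp]
    rw [ofReal_exp, ← exp_add, re_add_im]

lemma expCoord_logCoord {u : Fin n → ℂ} (hu : u l ≠ 0) : expCoord l (logCoord l a b u) = u := by
  have h : u l * exp (-(((a + b) / 2 : ℝ) * I)) ≠ 0 := mul_ne_zero hu (exp_ne_zero _)
  simp only [expCoord, logCoord, update_self, update_idem]
  rw [exp_add, exp_log h, mul_assoc, ← exp_add, neg_add_cancel, exp_zero, mul_one, update_eq_self]

/-- Rotation by the mean of `a` and `b` centres the sector on the positive real axis. Width at most
`2π` then leaves room for the principal branch of the argument. -/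
lemma arg_rotate (hab : b ≤ a + 2 * Real.pi) {w : ℂ} (hw : 0 < ‖w‖) {t : ℝ} (ha : a < t) (hb : t < b)
    (ht : w = ‖w‖ * exp (t * I)) :
    arg (w * exp (-(((a + b) / 2 : ℝ) * I))) = t - (a + b) / 2 ∧
      |t - (a + b) / 2| < Real.pi := by
  have hlt : |t - (a + b) / 2| < Real.pi := by rw [abs_lt]; constructor <;> linarith
  refine ⟨?_, hlt⟩
  have : w * exp (-(((a + b) / 2 : ℝ) * I)) = ‖w‖ * exp ((t - (a + b) / 2 : ℝ) * I) := by
    conv_lhs => rw [ht]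
    rw [mul_assoc, ← exp_add]
    push_cast
    ring_nf
  rw [this, arg_real_mul _ hw, arg_exp_mul_I, toIocMod_eq_self]
  rw [abs_lt] at hlt
  exact ⟨hlt.1, by linarith [hlt.2]⟩

lemma logCoord_mem (hab : b ≤ a + 2 * Real.pi) {u : Fin n → ℂ}
    (hu : u ∈ sectorSet l N ρ a b) : logCoord l a b u ∈ logSectorSet l N ρ a b := by
  obtain ⟨h1, h2, h3, t, h4, h5, h6⟩ := hu
  have harg := (arg_rotate hab h2 h4 h5 h6).1
  refine ⟨by simpa [logCoord] using h1, ?_, ?_, ?_⟩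
  · simp only [logCoord, update_self, add_re, log_re, norm_mul]
    have : ‖exp (-(((a + b) / 2 : ℝ) * I))‖ = 1 := by
      rw [← neg_mul, ← ofReal_neg, norm_exp_ofReal_mul_I]
    rw [this, mul_one, re_ofReal_mul, I_re, mul_zero, add_zero]
    exact Real.log_lt_log h2 h3
  all_goals
    simp only [logCoord, update_self, add_im, log_im, harg, im_ofReal_mul, I_im]
    linarith

lemma continuousOn_logCoord (hab : b ≤ a + 2 * Real.pi) :
    ContinuousOn (logCoord l a b) (sectorSet l N ρ a b) := by
  refine fun u hu => ContinuousAt.continuousWithinAt (ContinuousAt.update continuousAt_id l ?_)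
  obtain ⟨h1, h2, h3, t, h4, h5, h6⟩ := hu
  obtain ⟨harg, hlt⟩ := arg_rotate hab h2 h4 h5 h6
  have hsl : u l * exp (-(((a + b) / 2 : ℝ) * I)) ∈ slitPlane := by
    rw [mem_slitPlane_iff_arg, harg]
    refine ⟨(abs_lt.1 hlt).2.ne, mul_ne_zero (norm_pos_iff.1 h2) (exp_ne_zero _)⟩
  have hc : ContinuousAt (fun u : Fin n → ℂ => u l * exp (-(((a + b) / 2 : ℝ) * I))) u :=
    (continuous_apply l).continuousAt.mul continuousAt_const
  exact (hc.clog hsl).add continuousAt_const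

lemma isPreconnected_sectorSet (hN : Convex ℝ N) (hρ : 0 < ρ) (hab : b ≤ a + 2 * Real.pi) :
    IsPreconnected (sectorSet l N ρ a b) := by
  have : sectorSet l N ρ a b = expCoord l '' logSectorSet l N ρ a b := by
    refine Set.Subset.antisymm (fun u hu => ⟨_, logCoord_mem hab hu, ?_⟩) ?_
    · exact expCoord_logCoord (norm_pos_iff.1 hu.2.1)
    · rintro _ ⟨v, hv, rfl⟩
      exact expCoord_mem hρ hv
  rw [this]
  exact (convex_logSectorSet hN).isPreconnected.image _ (continuous_expCoord l).continuousOn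

/-- In the `l`-th coordinate the sector is the image of an open set under `exp`, which is an open
map. -/
lemma isOpen_sectorSet (hN : IsOpen N) (hρ : 0 < ρ) (hab : b ≤ a + 2 * Real.pi) :
    IsOpen (sectorSet l N ρ a b) := by
  have : sectorSet l N ρ a b = {u | update u l 0 ∈ N} ∩ {u | u l ∈ exp ''
      ({w | w.re < Real.log ρ} ∩ {w | a < w.im} ∩ {w | w.im < b})} := by
    ext u
    constructor
    · intro hu
      obtain ⟨h1, h2, h3, h4⟩ := logCoord_mem hab hu
      refine ⟨hu.1, ⟨logCoord l a b u l, ⟨⟨h2, h3⟩, h4⟩, ?_⟩⟩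
      have := congrFun (expCoord_logCoord (a := a) (b := b) (norm_pos_iff.1 hu.2.1)) l
      simpa [expCoord] using this
    · rintro ⟨h1, w, ⟨⟨h2, h3⟩, h4⟩, hw⟩
      have := expCoord_mem hρ (v := update u l w) (l := l) (N := N) (a := a) (b := b) (ρ := ρ)
        ⟨by simpa using h1, by simpa using h2, by simpa using h3, by simpa using h4⟩
      simpa [expCoord, hw] using this
  rw [this]
  refine (hN.preimage (continuous_id.update l continuous_const)).inter
    ((isOpenMap_exp _ (IsOpen.inter (IsOpen.inter ?_ ?_) ?_)).preimage (continuous_apply l))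
  · exact isOpen_lt continuous_re continuous_const
  · exact isOpen_lt continuous_const continuous_im
  · exact isOpen_lt continuous_im continuous_const

lemma exists_mem_sectorSet (hρ : 0 < ρ) (hab : a < b) {z : Fin n → ℂ} (hz : update z l 0 ∈ N) :
    ∃ w : ℂ, update z l w ∈ sectorSet l N ρ a b := by
  refine ⟨(ρ / 2 : ℝ) * exp (((a + b) / 2 : ℝ) * I), by simpa using hz, ?_⟩
  have hn : ‖((ρ / 2 : ℝ) : ℂ) * exp (((a + b) / 2 : ℝ) * I)‖ = ρ / 2 := by
    rw [norm_mul, norm_exp_ofReal_mul_I, mul_one, norm_real, Real.norm_of_nonneg (by linarith)]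
  simp only [update_self, hn]
  exact ⟨by linarith, by linarith, (a + b) / 2, by linarith, by linarith, rfl⟩

/-- In the sup norm a ball about a point with `z l = 0` is a product, so it cuts the sector in a
smaller sector. Hence the trace filter of the sector at such a point has a basis of connected sets.
-/
lemma ball_inter_sectorSet {z : Fin n → ℂ} (hz : z l = 0) {δ : ℝ} (hδ : 0 < δ) :
    Metric.ball z δ ∩ sectorSet l N ρ a b = sectorSet l (N ∩ Metric.ball z δ) (min ρ δ) a b := by
  have key (u : Fin n → ℂ) : u ∈ Metric.ball z δ ↔ update u l 0 ∈ Metric.ball z δ ∧ ‖u l‖ < δ := by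
    simp only [Metric.mem_ball, dist_pi_lt_iff hδ]
    constructor
    · intro h
      refine ⟨fun i => ?_, by simpa [hz] using h l⟩
      by_cases hi : i = l
      · subst hi; simpa [hz] using hδ
      · simpa [hi] using h i
    · rintro ⟨h1, h2⟩ i
      by_cases hi : i = l
      · subst hi; simpa [hz] using h2
      · simpa [hi] using h1 i
  ext u
  rw [Set.mem_inter_iff, key]
  simp only [sectorSet, Set.mem_inter_iff, Set.mem_ofPred_eq, lt_min_iff]
  tauto

lemma exists_preconnected_mem_nhdsWithin (hN : Convex ℝ N) (hρ : 0 < ρ)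
    (hab : b ≤ a + 2 * Real.pi) {z : Fin n → ℂ} (hz : z l = 0) {s : Set (Fin n → ℂ)}
    (hs : s ∈ 𝓝[sectorSet l N ρ a b] z) :
    ∃ s' ∈ 𝓝[sectorSet l N ρ a b] z, s' ⊆ s ∧ IsPreconnected s' ∧ s' ⊆ sectorSet l N ρ a b := by
  obtain ⟨δ, hδ, hsub⟩ := Metric.mem_nhdsWithin_iff.1 hs
  refine ⟨_, inter_mem (mem_nhdsWithin_of_mem_nhds (Metric.ball_mem_nhds z hδ)) self_mem_nhdsWithin, hsub, ?_, Set.inter_subset_right⟩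
  rw [ball_inter_sectorSet hz hδ]
  exact isPreconnected_sectorSet (hN.inter (convex_ball z δ)) (lt_min hρ hδ) hab

lemma mem_closure_sectorSet (hρ : 0 < ρ) (hab : a < b) {z : Fin n → ℂ} (hz : z l = 0)
    (hzN : z ∈ N) : z ∈ closure (sectorSet l N ρ a b) := by
  rw [Metric.mem_closure_iff]
  intro δ hδ
  have hz' : update z l 0 = z := by rw [← hz, update_eq_self]
  obtain ⟨w, hw⟩ := exists_mem_sectorSet (N := N ∩ Metric.ball z δ) (lt_min hρ hδ) hab
    (z := z) (l := l) (by rw [hz']; exact ⟨hzN, Metric.mem_ball_self hδ⟩)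
  rw [← ball_inter_sectorSet hz hδ] at hw
  exact ⟨_, hw.2, by rw [dist_comm]; exact hw.1⟩

/-- An analytic family of separable polynomials over a sector has globally defined distinct
continuous root functions. -/
theorem IsAnalyticFamily.exists_continuousOn_roots {P : (Fin n → ℂ) → Polynomial ℂ} {m : ℕ}
    (h : IsAnalyticFamily P m (sectorSet l N ρ a b)) (hN : IsOpen N) (hNc : Convex ℝ N)
    (hρ : 0 < ρ) (hab : b ≤ a + 2 * Real.pi) (hne : (sectorSet l N ρ a b).Nonempty) :
    ∃ r : Fin m → (Fin n → ℂ) → ℂ, (∀ i, ContinuousOn (r i) (sectorSet l N ρ a b)) ∧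
      (∀ i, ∀ u ∈ sectorSet l N ρ a b, (P u).eval (r i u) = 0) ∧
      ∀ u ∈ sectorSet l N ρ a b, Injective fun i => r i u := by
  have hopen : IsOpen (logSectorSet l N ρ a b) := by
    refine (hN.preimage (continuous_id.update l continuous_const)).inter
      (IsOpen.inter ?_ (IsOpen.inter ?_ ?_))
    · exact isOpen_lt (continuous_re.comp (continuous_apply l)) continuous_const
    · exact isOpen_lt continuous_const (continuous_im.comp (continuous_apply l))
    · exact isOpen_lt (continuous_im.comp (continuous_apply l)) continuous_const
  obtain ⟨u₀, hu₀⟩ := hne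
  have : ContractibleSpace (logSectorSet l N ρ a b) :=
    (convex_logSectorSet hNc).contractibleSpace ⟨_, logCoord_mem hab hu₀⟩
  have : LocallyPathConnectedSpace (logSectorSet l N ρ a b) := hopen.locallyPathConnectedSpace
  -- The roots are found over the contractible logarithmic model, pulled back by `expCoord`, and
  -- carried to the sector by `logCoord`.
  obtain ⟨r, hr, hinj⟩ := h.exists_continuous_roots
    (A := logSectorSet l N ρ a b)
    ⟨fun v => expCoord l v, (continuous_expCoord l).comp continuous_subtype_val⟩
    fun v => expCoord_mem hρ v.2
  classical
  let r' (i : Fin m) (u : Fin n → ℂ) : ℂ :=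
    if hu : logCoord l a b u ∈ logSectorSet l N ρ a b then r i ⟨_, hu⟩ else 0
  have hr' (i) (u) (hu : u ∈ sectorSet l N ρ a b) : r' i u = r i ⟨_, logCoord_mem hab hu⟩ :=
    dif_pos (logCoord_mem hab hu)
  refine ⟨r', fun i => ?_, fun i u hu => ?_, fun u hu i j hij => ?_⟩
  · rw [continuousOn_iff_continuous_domRestrict]
    have : (sectorSet l N ρ a b).domRestrict (r' i) = r i ∘ fun u : sectorSet l N ρ a b =>
        (⟨_, logCoord_mem hab u.2⟩ : logSectorSet l N ρ a b) := funext fun u => hr' i u u.2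
    rw [this]
    exact (r i).continuous.comp
      ((continuousOn_iff_continuous_domRestrict.1 (continuousOn_logCoord hab)).subtype_mk _)
  · have := hr i ⟨_, logCoord_mem hab hu⟩
    simp only [ContinuousMap.coe_mk, expCoord_logCoord (norm_pos_iff.1 hu.2.1)] at this
    rwa [hr' i u hu]
  · refine hinj ⟨_, logCoord_mem hab hu⟩ ?_
    simp only [hr' _ u hu] at hij
    exact hij

end SectorGeometry

end

section

/-! ### Branches of a finite extension over a sector -/

section Branches

open Filter Topology Polynomial

lemma pow_card_le_norm_prod (s : Multiset ℂ) {δ : ℝ} (hδ : 0 ≤ δ) (h : ∀ t ∈ s, δ ≤ ‖t‖) :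
    δ ^ s.card ≤ ‖s.prod‖ := by
  induction s using Multiset.induction with
  | empty => simp
  | cons t s ih =>
    rw [Multiset.card_cons, Multiset.prod_cons, norm_mul, pow_succ']
    exact mul_le_mul (h t (Multiset.mem_cons_self t s))
      (ih fun x hx => h x (Multiset.mem_cons_of_mem hx)) (by positivity) (norm_nonneg _)

variable {R B : Type*} [CommRing R] [CommRing B] [Algebra R B]

/-- Otherwise prime avoidance puts `ker φ` inside one `ker (ψ i)`. Every `b` differs from the
constant `κ (φ b)` by an element of `ker φ`, so `ψ i` would equal `φ`. -/
lemma exists_apply_eq_zero_of_forall_ne {ι : Type*} [Finite ι] {e : R →+* ℂ} {κ : ℂ → R}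
    (hκ : ∀ x, e (κ x) = x) {φ : B →+* ℂ} (hφ : φ.comp (algebraMap R B) = e) {ψ : ι → B →+* ℂ}
    (hψ : ∀ i, (ψ i).comp (algebraMap R B) = e) (hne : ∀ i, ψ i ≠ φ) :
    ∃ b, φ b = 0 ∧ ∀ i, ψ i b ≠ 0 := by
  rcases isEmpty_or_nonempty ι with h | h
  · exact ⟨0, map_zero φ, fun i => h.elim i⟩
  have _ := Fintype.ofFinite ι
  by_contra! hcon
  have hsub : (RingHom.ker φ : Set B) ⊆ ⋃ i ∈ (Finset.univ : Finset ι), (RingHom.ker (ψ i) : Set B) := by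
    intro b hb
    obtain ⟨i, hi⟩ := hcon b hb
    exact Set.mem_biUnion (Finset.mem_coe.2 (Finset.mem_univ i)) hi
  obtain ⟨i, -, hi⟩ := (Ideal.subset_union_prime (s := (Finset.univ : Finset ι))
    (f := fun i => RingHom.ker (ψ i)) (hp := fun i _ _ _ => RingHom.ker_isPrime (ψ i))
    (a := Classical.arbitrary _) (b := Classical.arbitrary _)).1 hsub
  refine hne i (RingHom.ext fun b => ?_)
  have hc (χ : B →+* ℂ) (hχ : χ.comp (algebraMap R B) = e) :
      χ (b - algebraMap R B (κ (φ b))) = χ b - φ b := by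
    rw [map_sub]
    congr 1
    rw [← RingHom.comp_apply, hχ, hκ]
  have h1 : b - algebraMap R B (κ (φ b)) ∈ RingHom.ker φ := by
    rw [RingHom.mem_ker, hc φ hφ, sub_self]
  have h2 := hi h1
  rw [RingHom.mem_ker, hc _ (hψ i)] at h2
  exact sub_eq_zero.1 h2

lemma roots_exhausted {p : ℂ[X]} (hp : p ≠ 0) {m : ℕ} (hm : p.natDegree = m) {r : Fin m → ℂ}
    (hr : Function.Injective r) (hroot : ∀ i, p.eval (r i) = 0) {t : ℂ} (ht : p.eval t = 0) :
    ∃ i, r i = t := by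
  classical
  have himg : Finset.univ.image r = p.roots.toFinset := by
    refine Finset.eq_of_subset_of_card_le ?_ ?_
    · intro t ht
      obtain ⟨i, -, rfl⟩ := Finset.mem_image.1 ht
      simpa [hp] using hroot i
    · rw [Finset.card_image_of_injective _ hr, Finset.card_univ, Fintype.card_fin, ← hm]
      exact (Multiset.toFinset_card_le _).trans (card_roots' p)
  have : t ∈ p.roots.toFinset := by simpa [hp] using ht
  rw [← himg] at this
  obtain ⟨i, -, hi⟩ := Finset.mem_image.1 this
  exact ⟨i, hi⟩

variable [IsDomain R] [IsIntegrallyClosed R] [IsDomain B] [Module.Finite R B] [FaithfulSMul R B]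
variable {n : ℕ} {l : Fin n} {N : Set (Fin n → ℂ)} {ρ a a' : ℝ}

/-- Let `B` be a finite extension of `R`, generated generically by `b` and unramified away from
`u l = 0`. Then the complex points of `B` over a sector form `m` branches, which extend
continuously to `u l = 0`. -/
theorem exists_branches (hN : IsOpen N) (hNc : Convex ℝ N) (hρ : 0 < ρ) (haa' : a < a')
    (ha' : a' ≤ a + 2 * Real.pi) (hNne : ∃ z ∈ N, z l = 0)
    {ev : (Fin n → ℂ) → R →+* ℂ} {κ : ℂ → R} {T : Set (Fin n → ℂ)}
    (hT : T = sectorSet l N ρ a a' ∪ {u | u l = 0 ∧ u ∈ N})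
    (hκ : ∀ u ∈ T, ∀ x, ev u (κ x) = x)
    (hev : ∀ r, ∀ u ∈ T, AnalyticAt ℂ (fun u => ev u r) u)
    {b : B} {D : R} (hD : ∀ u ∈ sectorSet l N ρ a a', ev u D ≠ 0)
    (hsep : ∀ e : R →+* ℂ, e D ≠ 0 → ((minpoly R b).map e).Separable)
    (hgen : ∀ b' : B, ∃ q : R[X], D • b' = aeval b q) :
    ∃ β : Fin (minpoly R b).natDegree → (Fin n → ℂ) → B →+* ℂ,
      (∀ i, ∀ u ∈ T, (β i u).comp (algebraMap R B) = ev u) ∧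
      (∀ u ∈ sectorSet l N ρ a a', Function.Injective fun i => β i u) ∧
      (∀ u ∈ T, ∀ φ : B →+* ℂ, φ.comp (algebraMap R B) = ev u → ∃ i, β i u = φ) ∧
      (∀ i b', ContinuousOn (fun u => β i u b') T) ∧
      ∀ i b', ∀ u ∈ sectorSet l N ρ a a', AnalyticAt ℂ (fun u => β i u b') u := by
  set S := sectorSet l N ρ a a' with hSdef
  set m := (minpoly R b).natDegree
  have hSo : IsOpen S := isOpen_sectorSet hN hρ ha'
  have hST : S ⊆ T := hT ▸ Set.subset_union_left
  have hmon (b' : B) : (minpoly R b').Monic := minpoly.monic (Algebra.IsIntegral.isIntegral b')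
  have hTcl : T ⊆ closure S := by
    rw [hT]
    refine Set.union_subset subset_closure fun z hz => ?_
    exact mem_closure_sectorSet hρ haa' hz.1 hz.2
  have hSne : S.Nonempty := by
    obtain ⟨z, hzN, hz⟩ := hNne
    obtain ⟨w, hw⟩ := exists_mem_sectorSet (N := N) hρ haa' (z := z) (l := l)
      (by rwa [← hz, Function.update_eq_self])
    exact ⟨_, hw⟩
  have hfam : IsAnalyticFamily (fun u => (minpoly R b).map (ev u)) m S :=
    { isOpen := hSo
      monic u _ := (hmon b).map _
      natDegree u _ := (hmon b).natDegree_map _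
      separable u hu := hsep _ (hD u hu)
      analyticAt i u hu := by simpa only [coeff_map] using hev _ u (hST hu) }
  obtain ⟨r, hrc, hr, hrinj⟩ := hfam.exists_continuousOn_roots hN hNc hρ ha' hSne
  have hra (i) (u) (hu : u ∈ S) : AnalyticAt ℂ (r i) u :=
    hfam.analyticAt_of_continuousAt hu ((hrc i).continuousAt (hSo.mem_nhds hu))
      (Filter.mem_of_superset (hSo.mem_nhds hu) fun v hv => hr i v hv)
  choose q hq using hgen
  -- Where `D` does not vanish, a homomorphism over `ev u` is determined by its value at `b`,
  -- through `D • b' = q(b)`.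
  have hval {u} (hu : u ∈ S) {φ : B →+* ℂ} (hφ : φ.comp (algebraMap R B) = ev u) (b' : B) :
      φ b' = ((q b').map (ev u)).eval (φ b) / ev u D := by
    rw [eq_div_iff (hD u hu), ← hom_aeval φ hφ, ← hq, Algebra.smul_def, map_mul, mul_comm]
    congr 1
    exact congr($hφ D).symm
  let f (i : Fin m) (b' : B) (u : Fin n → ℂ) : ℂ := ((q b').map (ev u)).eval (r i u) / ev u D
  have hfa (i b' u) (hu : u ∈ S) : AnalyticAt ℂ (f i b') u := by
    refine AnalyticAt.div ?_ (hev D u (hST hu)) (hD u hu)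
    simp only [Polynomial.eval_map, eval₂_eq_sum_range]
    exact Finset.analyticAt_fun_sum _ fun j _ => (hev _ u (hST hu)).mul ((hra i u hu).pow j)
  obtain ⟨u₀, hu₀⟩ := hSne
  -- Provides the default value that the choice of `φ` and `β` needs outside their domains.
  have _ : Nonempty (B →+* ℂ) := by
    obtain ⟨t, ht⟩ := IsAlgClosed.exists_root ((minpoly R b).map (ev u₀)) (by
      rw [(hmon b).degree_map]
      exact (minpoly.degree_pos (Algebra.IsIntegral.isIntegral b)).ne')
    exact ⟨(exists_ringHom_apply_eq ht).choose⟩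
  have hφ : ∀ i, ∀ u ∈ S, ∃ φ : B →+* ℂ, φ.comp (algebraMap R B) = ev u ∧ φ b = r i u ∧
      ∀ b', φ b' = f i b' u := by
    intro i u hu
    obtain ⟨φ, h1, h2⟩ := exists_ringHom_apply_eq (hr i u hu)
    exact ⟨φ, h1, h2, fun b' => by rw [hval hu h1, h2]⟩
  choose! φ hφe hφb hφf using hφ
  have hevt (z) (hz : z ∈ T) (x : R) : Tendsto (fun u => ev u x) (𝓝[S] z) (𝓝 (ev z x)) :=
    (hev x z hz).continuousAt.mono_left nhdsWithin_le_nhds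
  have hneb (z) (hz : z ∈ T) : (𝓝[S] z).NeBot := mem_closure_iff_nhdsWithin_neBot.1 (hTcl hz)
  have hlim : ∀ i b', ∀ z ∈ T, ∃ t, Tendsto (f i b') (𝓝[S] z) (𝓝 t) := by
    intro i b' z hz
    have hzT := hz
    rw [hT] at hz
    rcases hz with hz | hz
    · exact ⟨_, (hfa i b' z hz).continuousAt.mono_left nhdsWithin_le_nhds⟩
    · have _ := hneb z hzT
      -- Along a branch `b'` satisfies its own minimal polynomial, which is monic with coefficients
      -- continuous at `z`. This bounds it and confines its cluster points to the roots of the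
      -- polynomial at `z`.
      have hroot : ∀ᶠ u in 𝓝[S] z, ((minpoly R b').map (ev u)).eval (f i b' u) = 0 := by
        filter_upwards [self_mem_nhdsWithin] with u hu
        rw [← hφf i u hu, ← hφe i u hu]
        exact eval_map_minpoly _ _
      obtain ⟨C, hC⟩ := exists_eventually_norm_root_le (hmon b') (hevt z hzT) hroot
      refine exists_tendsto_of_finite_mapClusterPt (fun s hs => ?_) hC
        (((minpoly R b').map (ev z)).roots.toFinset.finite_toSet) fun t ht => ?_
      · obtain ⟨s', hs', hss', hpre, hsub⟩ := exists_preconnected_mem_nhdsWithin hNc hρ ha' hz.1 hs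
        exact ⟨s', hs', hss', hpre, fun u hu =>
          (hfa i b' u (hsub hu)).continuousAt.continuousWithinAt⟩
      · simpa [((hmon b').map (ev z)).ne_zero] using
          eval_eq_zero_of_mapClusterPt (hevt z hzT) hroot ht
  let g (i : Fin m) (b' : B) : (Fin n → ℂ) → ℂ := extendFrom S (f i b')
  have hg (i b' z) (hz : z ∈ T) : Tendsto (f i b') (𝓝[S] z) (𝓝 (g i b' z)) :=
    tendsto_extendFrom (hlim i b' z hz)
  have hgS (i b' u) (hu : u ∈ S) : g i b' u = f i b' u := by
    have _ := hneb u (hST hu)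
    exact tendsto_nhds_unique (hg i b' u (hST hu))
      ((hfa i b' u hu).continuousAt.mono_left nhdsWithin_le_nhds)
  -- Uniqueness of limits: any identity satisfied by the homomorphisms `φ i u` on `S` passes to `g`
  -- on all of `T`.
  have hgu {i : Fin m} {z} (hz : z ∈ T) {b' : B} {h : (Fin n → ℂ) → ℂ} {t : ℂ}
      (h1 : ∀ u ∈ S, φ i u b' = h u) (h2 : Tendsto h (𝓝[S] z) (𝓝 t)) : g i b' z = t := by
    have _ := hneb z hz
    refine tendsto_nhds_unique (hg i b' z hz) (h2.congr' ?_)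
    filter_upwards [self_mem_nhdsWithin] with u hu
    rw [← hφf i u hu, h1 u hu]
  have hgφ : ∀ i, ∀ z ∈ T, ∃ χ : B →+* ℂ, ∀ b', χ b' = g i b' z := by
    intro i z hz
    exact ⟨{ toFun b' := g i b' z
             map_one' := hgu hz (h := fun _ => 1) (by simp) tendsto_const_nhds
             map_zero' := hgu hz (h := fun _ => 0) (by simp) tendsto_const_nhds
             map_mul' x y := hgu hz (h := fun u => f i x u * f i y u)
               (fun u hu => by rw [map_mul, hφf i u hu, hφf i u hu])
               ((hg i x z hz).mul (hg i y z hz))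
             map_add' x y := hgu hz (h := fun u => f i x u + f i y u)
               (fun u hu => by rw [map_add, hφf i u hu, hφf i u hu])
               ((hg i x z hz).add (hg i y z hz)) }, fun b' => rfl⟩
  choose! β hβ using hgφ
  have hβS (i u) (hu : u ∈ S) : β i u = φ i u := RingHom.ext fun b' => by
    rw [hβ i u (hST hu), hgS i b' u hu, hφf i u hu]
  have hβe (i z) (hz : z ∈ T) : (β i z).comp (algebraMap R B) = ev z := by
    refine RingHom.ext fun x => ?_
    rw [RingHom.comp_apply, hβ i z hz]
    exact hgu hz (h := fun u => ev u x) (fun u hu => congr($(hφe i u hu) x)) (hevt z hz x)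
  have hexS : ∀ u ∈ S, ∀ χ : B →+* ℂ, χ.comp (algebraMap R B) = ev u → ∃ i, β i u = χ := by
    intro u hu χ hχ
    obtain ⟨i, hi⟩ := roots_exhausted ((hmon b).map (ev u)).ne_zero ((hmon b).natDegree_map _)
      (hrinj u hu) (fun i => hr i u hu) (t := χ b) (by rw [← hχ]; exact eval_map_minpoly χ b)
    refine ⟨i, RingHom.ext fun b' => ?_⟩
    rw [hβS i u hu, hφf i u hu, hval hu hχ, ← hi]
  refine ⟨β, hβe, fun u hu i j hij => hrinj u hu ?_, fun z hz χ hχ => ?_, fun i b' => ?_,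
    fun i b' u hu => ?_⟩
  · have : β i u = β j u := hij
    rw [hβS i u hu, hβS j u hu] at this
    simp only [← hφb _ u hu, this]
  · by_contra! hcon
    -- If `χ` is none of the limits, some `b'` vanishes at `χ` but at no `β i z`; by continuity its
    -- values on all branches near `z` have norm above a fixed `δ`.
    obtain ⟨b', hb', hne⟩ := exists_apply_eq_zero_of_forall_ne (hκ z hz) hχ
      (fun i => hβe i z hz) hcon
    have _ := hneb z hz
    obtain ⟨δ, hδ, hδne⟩ : ∃ δ > 0, ∀ i, δ < ‖β i z b'‖ := by
      rcases isEmpty_or_nonempty (Fin m) with h | h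
      · exact ⟨1, one_pos, fun i => h.elim i⟩
      · obtain ⟨i, hi⟩ := Finite.exists_min fun i => ‖β i z b'‖
        have hpos : 0 < ‖β i z b'‖ := norm_pos_iff.2 (hne i)
        exact ⟨‖β i z b'‖ / 2, half_pos hpos, fun j => (half_lt_self hpos).trans_le (hi j)⟩
    have hev1 : ∀ᶠ u in 𝓝[S] z, ∀ i, δ < ‖f i b' u‖ := eventually_all.2 fun i => by
      have := (hg i b' z hz).norm
      rw [← hβ i z hz] at this
      exact this.eventually_const_lt (hδne i)
    -- Since `χ b' = 0` is a root at `z`, the constant coefficient tends to zero. Near `z`, however,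
    -- it is up to sign a product of roots, each being the value of `b'` on some branch and so of
    -- norm at least `δ`.
    have h0 : ev z ((minpoly R b').coeff 0) = 0 := by
      have := eval_map_minpoly (R := R) χ b'
      rw [hχ, hb', ← coeff_zero_eq_eval_zero, coeff_map] at this
      exact this
    have hev2 : ∀ᶠ u in 𝓝[S] z,
        ‖ev u ((minpoly R b').coeff 0)‖ < δ ^ (minpoly R b').natDegree := by
      have := (hevt z hz ((minpoly R b').coeff 0)).norm
      rw [h0, norm_zero] at this
      exact this.eventually_lt_const (by positivity)
    obtain ⟨u, ⟨hu1, hu2⟩, hu⟩ := ((hev1.and hev2).and self_mem_nhdsWithin).exists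
    have hpm := (hmon b').map (ev u)
    have hprod := (IsAlgClosed.splits ((minpoly R b').map (ev u))).coeff_zero_eq_prod_roots_of_monic hpm
    have hcard := (IsAlgClosed.splits ((minpoly R b').map (ev u))).natDegree_eq_card_roots
    rw [(hmon b').natDegree_map] at hcard
    rw [coeff_map] at hprod
    rw [hprod, hcard, norm_mul, norm_pow, norm_neg, norm_one, one_pow, one_mul] at hu2
    refine absurd (pow_card_le_norm_prod _ hδ.le fun t ht => ?_) hu2.not_ge
    obtain ⟨χ', hχ', hχt⟩ := exists_ringHom_apply_eq (R := R) (b := b') (e := ev u) (t := t)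
      (by simpa [hpm.ne_zero] using ht)
    obtain ⟨i, hi⟩ := hexS u hu χ' hχ'
    rw [← hχt, ← hi, hβ i u (hST hu), hgS i b' u hu]
    exact (hu1 i).le
  · exact (continuousOn_extendFrom hTcl (hlim i b')).congr fun z hz => hβ i z hz b'
  · refine (hfa i b' u hu).congr ?_
    filter_upwards [hSo.mem_nhds hu] with v hv
    rw [hβ i v (hST hv), hgS i b' v hv]

end Branches

end

/-! ### Complex points and values of regular functions -/

section

namespace CPoints

variable {X Y : Scheme.{0}} {s : X ⟶ Spec (.of ℂ)} {t : Y ⟶ Spec (.of ℂ)}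

/-- Evaluation of regular functions at a complex point, as a ring homomorphism. -/
def valueHom (x : CPoints s) {U : X.Opens} (h : x.pt ∈ U) : Γ(X, U) →+* ℂ :=
  (x.1.appLE U ⊤ (x.top_le_preimage h) ≫ (Scheme.ΓSpecIso (.of ℂ)).hom).hom

lemma valueHom_apply (x : CPoints s) {U : X.Opens} (h : x.pt ∈ U) (f : Γ(X, U)) :
    x.valueHom h f = x.value h f := rfl

/-- The map on complex points induced by a morphism of schemes over `ℂ`. -/
def map (f : X ⟶ Y) (hf : f ≫ t = s) (x : CPoints s) : CPoints t :=
  ⟨x.1 ≫ f, by rw [Category.assoc, hf, x.2]⟩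

lemma pt_map (f : X ⟶ Y) (hf : f ≫ t = s) (x : CPoints s) : (x.map f hf).pt = f x.pt :=
  Scheme.Hom.comp_apply x.1 f _

lemma valueHom_map (f : X ⟶ Y) (hf : f ≫ t = s) (x : CPoints s) {W : Y.Opens} {U : X.Opens}
    (e : U ≤ f ⁻¹ᵁ W) (h : x.pt ∈ U) (h' : (x.map f hf).pt ∈ W) :
    (x.map f hf).valueHom h' = (x.valueHom h).comp (f.appLE W U e).hom := by
  have := Scheme.Hom.appLE_comp_appLE x.1 f W U ⊤ e (x.top_le_preimage h)
  simp only [valueHom]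
  rw [← CommRingCat.hom_comp, ← Category.assoc, this]
  rfl

lemma valueHom_res (x : CPoints s) {U U' : X.Opens} (e : U' ≤ U) (h : x.pt ∈ U) (h' : x.pt ∈ U')
    (r : Γ(X, U)) : x.valueHom h' (X.presheaf.map (homOfLE e).op r) = x.valueHom h r := by
  have := Scheme.Hom.map_appLE x.1 (x.top_le_preimage h') (homOfLE e).op
  simp only [valueHom]
  rw [← CommRingCat.comp_apply, ← Category.assoc, this]

lemma closedPoint_mem_basicOpen (r : ℂ) : IsLocalRing.closedPoint ℂ ∈
    (Spec (.of ℂ)).basicOpen ((Scheme.ΓSpecIso (.of ℂ)).inv r) ↔ r ≠ 0 := by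
  have h : PrimeSpectrum.basicOpen r =
    (Spec (.of ℂ)).basicOpen ((Scheme.ΓSpecIso (.of ℂ)).inv r) :=
    (basicOpen_eq_of_affine (R := .of ℂ) r).symm
  refine (iff_of_eq (congrArg (IsLocalRing.closedPoint ℂ ∈ ·) h.symm)).trans ?_
  change ¬ (r ∈ IsLocalRing.maximalIdeal ℂ) ↔ _
  simp

lemma mem_basicOpen_iff (x : CPoints s) {U : X.Opens} (h : x.pt ∈ U) (r : Γ(X, U)) :
    x.pt ∈ X.basicOpen r ↔ x.valueHom h r ≠ 0 := by
  have h1 := Scheme.basicOpen_appLE x.1 ⊤ U (x.top_le_preimage h) r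
  have h2 : x.pt ∈ X.basicOpen r ↔ IsLocalRing.closedPoint ℂ ∈
      (Spec (.of ℂ)).basicOpen (x.1.appLE U ⊤ (x.top_le_preimage h) r) := by
    rw [h1]; exact ⟨fun h => ⟨trivial, h⟩, fun h => h.2⟩
  have h3 : x.1.appLE U ⊤ (x.top_le_preimage h) r =
      (Scheme.ΓSpecIso (.of ℂ)).inv (x.valueHom h r) :=
    ((Scheme.ΓSpecIso (.of ℂ)).hom_inv_id_apply _).symm
  rw [h2, h3]
  exact closedPoint_mem_basicOpen _

lemma SpecMap_valueHom_fromSpec (x : CPoints s) {U : X.Opens} (hU : IsAffineOpen U)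
    (h : x.pt ∈ U) : Spec.map (CommRingCat.ofHom (x.valueHom h)) ≫ hU.fromSpec = x.1 := by
  have h1 := IsAffineOpen.SpecMap_appLE_fromSpec x.1 hU (isAffineOpen_top (Spec (.of ℂ)))
    (x.top_le_preimage h)
  have h2 : CommRingCat.ofHom (x.valueHom h) = x.1.appLE U ⊤ (x.top_le_preimage h) ≫
    (Scheme.ΓSpecIso (.of ℂ)).hom := rfl
  have h3 : Spec.map (Scheme.ΓSpecIso (.of ℂ)).hom ≫ (Spec (.of ℂ)).isoSpec.inv = 𝟙 _ := by
    rw [← Scheme.isoSpec_Spec_hom]; exact Iso.hom_inv_id _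
  rw [h2, Spec.map_comp, Category.assoc, h1, IsAffineOpen.fromSpec_top, ← Category.assoc, h3,
    Category.id_comp]

lemma eq_of_valueHom_eq {x y : CPoints s} {U : X.Opens} (hU : IsAffineOpen U) (hx : x.pt ∈ U)
    (hy : y.pt ∈ U) (h : x.valueHom hx = y.valueHom hy) : x = y :=
  Subtype.ext (by
    rw [← x.SpecMap_valueHom_fromSpec hU hx, ← y.SpecMap_valueHom_fromSpec hU hy, h])

/-- A homomorphism from the coordinate ring of an affine open to `ℂ`, lying over the evaluation
homomorphism of a complex point of the base, is evaluation at a complex point. -/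
lemma exists_map_eq_valueHom_eq (f : X ⟶ Y) (hf : f ≫ t = s) {W : Y.Opens} {U : X.Opens}
    (hU : IsAffineOpen U) (hW : IsAffineOpen W) (e : U ≤ f ⁻¹ᵁ W) (y : CPoints t) (hy : y.pt ∈ W)
    (φ : Γ(X, U) →+* ℂ) (hφ : φ.comp (f.appLE W U e).hom = y.valueHom hy) :
    ∃ (x : CPoints s) (h : x.pt ∈ U), x.map f hf = y ∧ x.valueHom h = φ := by
  have h1 : (Spec.map (CommRingCat.ofHom φ) ≫ hU.fromSpec) ≫ f = y.1 := by
    rw [Category.assoc, ← IsAffineOpen.SpecMap_appLE_fromSpec f hW hU e, ← Category.assoc,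
      ← Spec.map_comp, ← y.SpecMap_valueHom_fromSpec hW hy, ← hφ]
    rfl
  let x : CPoints s := ⟨Spec.map (CommRingCat.ofHom φ) ≫ hU.fromSpec, by
    rw [← hf, ← Category.assoc, h1, y.2]⟩
  have h : x.pt ∈ U := by
    have : x.pt = hU.fromSpec (Spec.map (CommRingCat.ofHom φ) (IsLocalRing.closedPoint ℂ)) :=
      Scheme.Hom.comp_apply _ _ _
    rw [this]
    have := Set.mem_range_self (f := hU.fromSpec)
      (Spec.map (CommRingCat.ofHom φ) (IsLocalRing.closedPoint ℂ))
    rwa [hU.range_fromSpec] at this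
  refine ⟨x, h, Subtype.ext h1, ?_⟩
  have h2 : Spec.map (CommRingCat.ofHom (x.valueHom h)) = Spec.map (CommRingCat.ofHom φ) := by
    rw [← cancel_mono hU.fromSpec, x.SpecMap_valueHom_fromSpec hU h]
  exact congrArg CommRingCat.Hom.hom (Spec.map_injective h2)

/-- A regular function pulled back along a morphism `f` is locally a quotient of two regular
functions on a given affine open. -/
lemma exists_value_map_eq_div (f : X ⟶ Y) (hf : f ≫ t = s) {U : X.Opens} (hU : IsAffineOpen U)
    (x₀ : CPoints s) (hx₀ : x₀.pt ∈ U) {W : Y.Opens} (h₀ : (x₀.map f hf).pt ∈ W) (r : Γ(Y, W)) :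
    ∃ b b' : Γ(X, U), x₀.valueHom hx₀ b ≠ 0 ∧ ∀ (x : CPoints s) (h : x.pt ∈ U),
      x.valueHom h b ≠ 0 → ∃ h' : (x.map f hf).pt ∈ W,
        (x.map f hf).value h' r = x.valueHom h b' / x.valueHom h b := by
  have h₁ : x₀.pt ∈ f ⁻¹ᵁ W := by rw [pt_map] at h₀; exact h₀
  obtain ⟨b, hb, hxb⟩ := hU.exists_basicOpen_le (V := f ⁻¹ᵁ W) ⟨x₀.pt, h₁⟩ hx₀
  have hloc := hU.isLocalization_basicOpen b
  obtain ⟨k, b', hb'⟩ := IsLocalization.Away.surj b (f.appLE W (X.basicOpen b) hb r)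
  -- The extra factor `b` ensures, even for `k = 0`, that a nonzero denominator places the point in
  -- the basic open set of `b`.
  refine ⟨b ^ (k + 1), b' * b, ?_, fun x h hx => ?_⟩
  · rw [map_pow]
    exact pow_ne_zero _ ((x₀.mem_basicOpen_iff hx₀ b).1 hxb)
  · have hx' : x.valueHom h b ≠ 0 := fun h0 => hx (by rw [map_pow, h0, zero_pow (by omega)])
    have hxm := (x.mem_basicOpen_iff h b).2 hx'
    have h' : (x.map f hf).pt ∈ W := by rw [pt_map]; exact hb hxm
    refine ⟨h', ?_⟩
    rw [← valueHom_apply, x.valueHom_map f hf hb hxm h', eq_div_iff hx, map_pow, map_mul]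
    have h3 := congrArg (x.valueHom hxm) hb'
    have h4 : ∀ g, x.valueHom hxm (algebraMap _ _ g) = x.valueHom h g :=
      x.valueHom_res (X.basicOpen_le b) h hxm
    rw [map_mul, map_pow, h4, h4] at h3
    rw [← h3, pow_succ, ← mul_assoc]
    rfl

end CPoints

end

/-! ### Values of degree zero fractions at points of projective space -/

section

open HomogeneousLocalization

variable {n : ℕ}

/-- Evaluation of degree zero fractions at a point of `ℂⁿ⁺¹` where the denominator is nonzero. -/
def awayEval (F : MvPolynomial (Fin (n + 1)) ℂ) (x : Fin (n + 1) → ℂ)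
    (hx : MvPolynomial.eval x F ≠ 0) : Away (grading n) F →+* ℂ :=
  (IsLocalization.Away.lift (S := Localization.Away F) F (g := MvPolynomial.eval x)
    (isUnit_iff_ne_zero.2 hx)).comp (algebraMap _ _)

lemma awayEval_mk {F : MvPolynomial (Fin (n + 1)) ℂ} {x : Fin (n + 1) → ℂ}
    (hx : MvPolynomial.eval x F ≠ 0) {m k : ℕ} (hF : F ∈ grading n m)
    (G : MvPolynomial (Fin (n + 1)) ℂ) (hG : G ∈ grading n (k • m)) :
    awayEval F x hx (Away.mk (grading n) hF k G hG) =
      MvPolynomial.eval x G / MvPolynomial.eval x F ^ k := by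
  rw [awayEval, RingHom.comp_apply, HomogeneousLocalization.algebraMap_apply, Away.val_mk,
    Localization.mk_eq_mk', IsLocalization.Away.lift, IsLocalization.lift_mk'_spec, map_pow,
    mul_div_cancel₀ _ (pow_ne_zero _ hx)]

lemma isoOfEq_inv_toSpecΓ_basicOpenIsoSpecAway (X : Scheme.{0}) {L : Type} [CommRing L]
    (y : Γ(X, ⊤)) (h : X ⟶ Spec (.of L)) (g : Γ(X, ⊤) →+* L)
    (hg : h ≫ Spec.map (CommRingCat.ofHom g) = X.toSpecΓ) (g' : Localization.Away y →+* L)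
    (hg' : g'.comp (algebraMap _ _) = g) :
    (X.isoOfEq (X.toSpecΓ_preimage_basicOpen y)).inv ≫ X.toSpecΓ ∣_ _ ≫
      (basicOpenIsoSpecAway y).hom = (X.basicOpen y).ι ≫ h ≫ Spec.map (CommRingCat.ofHom g') := by
  have : Mono (Spec.map (CommRingCat.ofHom (algebraMap Γ(X, ⊤) (Localization.Away y)))) :=
    inferInstance
  rw [← cancel_mono (Spec.map (CommRingCat.ofHom (algebraMap Γ(X, ⊤) (Localization.Away y))))]
  simp only [Category.assoc, basicOpenIsoSpecAway_hom_SpecMap]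
  rw [← Spec.map_comp, ← CommRingCat.ofHom_comp, hg', hg]
  refine (congrArg ((X.isoOfEq (X.toSpecΓ_preimage_basicOpen y)).inv ≫ ·)
    (morphismRestrict_ι X.toSpecΓ (PrimeSpectrum.basicOpen y))).trans ?_
  rw [← Category.assoc]
  exact congrArg (· ≫ X.toSpecΓ) (Scheme.isoOfEq_inv_ι X (X.toSpecΓ_preimage_basicOpen y))

/-- Evaluation at `x` factors through the localization at `F`, so the point with homogeneous
coordinates `x` factors through the affine chart of `F`. All later computations of values at
`homogPt` rest on this. -/
lemma ι_homogPt {F : MvPolynomial (Fin (n + 1)) ℂ} {m : ℕ} (hm : 0 < m) (hF : F ∈ grading n m)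
    {x : Fin (n + 1) → ℂ} (hx0 : x ≠ 0) (hx : MvPolynomial.eval x F ≠ 0) :
    (homogPt x hx0).1 = Spec.map (CommRingCat.ofHom (awayEval F x hx)) ≫
      Proj.awayι (grading n) F hF hm := by
  have h1 := Proj.fromOfGlobalSections_resLE (grading n) (evalSections x)
    (irrelevant_map_evalSections hx0) hm hF
  have h2 := congrArg (· ≫ (Proj.basicOpen (grading n) F).ι) h1
  simp only [Scheme.Hom.resLE_comp_ι, Proj.toBasicOpenOfGlobalSections, Category.assoc,
    Proj.basicOpenIsoSpec_inv_ι] at h2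
  -- As `F` does not vanish at `x`, the inclusion of this basic open set is an isomorphism and may
  -- be cancelled.
  have htop : (Spec (.of ℂ)).basicOpen (evalSections x F) = ⊤ := by
    refine eq_top_iff.2 fun q _ => ?_
    rw [Subsingleton.elim q (IsLocalRing.closedPoint ℂ)]
    exact (CPoints.closedPoint_mem_basicOpen _).2 hx
  have hiso : IsIso ((Spec (.of ℂ)).basicOpen (evalSections x F)).ι := by
    rw [htop]; exact (Scheme.topIso (Spec (.of ℂ))).isIso_hom
  let g : Γ(Spec (.of ℂ), ⊤) →+* ℂ := (Scheme.ΓSpecIso (.of ℂ)).hom.hom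
  have hgx : g (evalSections x F) = MvPolynomial.eval x F :=
    (Scheme.ΓSpecIso (.of ℂ)).inv_hom_id_apply _
  let g' : Localization.Away (evalSections x F) →+* ℂ :=
    IsLocalization.Away.lift (evalSections x F) (g := g)
      (isUnit_iff_ne_zero.2 (by rw [hgx]; exact hx))
  have h3 := isoOfEq_inv_toSpecΓ_basicOpenIsoSpecAway (Spec (.of ℂ)) (evalSections x F)
    (𝟙 _) g ((Category.id_comp _).trans (SpecMap_ΓSpecIso_hom (.of ℂ))) g'
    (IsLocalization.Away.lift_comp ..)
  rw [← cancel_epi ((Spec (.of ℂ)).basicOpen (evalSections x F)).ι]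
  refine h2.trans ?_
  let e : Localization.Away F →+* Localization.Away (evalSections x F) :=
    IsLocalization.map (M := .powers F) (T := .powers (evalSections x F))
      (Localization.Away (evalSections x F)) (evalSections x)
      (by rw [← Submonoid.map_le_iff_le_comap, Submonoid.map_powers])
  have h5 : (g'.comp e).comp (algebraMap (Away (grading n) F) _) = awayEval F x hx := by
    rw [awayEval]
    congr 1
    refine IsLocalization.ringHom_ext (Submonoid.powers F) (RingHom.ext fun G => ?_)
    simp only [RingHom.comp_apply, e, g', IsLocalization.map_eq, IsLocalization.Away.lift_eq]
    exact (Scheme.ΓSpecIso (.of ℂ)).inv_hom_id_apply _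
  have h4 := congrArg (· ≫ Spec.map (CommRingCat.ofHom (e.comp
    (algebraMap (Away (grading n) F) (Localization.Away F)))) ≫
      Proj.awayι (grading n) F hF hm) h3
  simp only [Category.assoc, Category.id_comp] at h4
  refine h4.trans ?_
  rw [← h5, RingHom.comp_assoc, CommRingCat.ofHom_comp _ g', Spec.map_comp, Category.assoc]
lemma homogPt_mem_basicOpen_iff {F : MvPolynomial (Fin (n + 1)) ℂ} {m : ℕ} (hm : 0 < m)
    (hF : F ∈ grading n m) {x : Fin (n + 1) → ℂ} (hx0 : x ≠ 0) :
    (homogPt x hx0).pt ∈ Proj.basicOpen (grading n) F ↔ MvPolynomial.eval x F ≠ 0 := by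
  have h := Proj.fromOfGlobalSections_preimage_basicOpen (grading n) (evalSections x)
    (irrelevant_map_evalSections hx0) hm hF
  refine Iff.trans ?_ (CPoints.closedPoint_mem_basicOpen _)
  exact iff_of_eq (congrArg (IsLocalRing.closedPoint ℂ ∈ ·) h)

lemma SpecMap_awayToSection_awayι {F : MvPolynomial (Fin (n + 1)) ℂ} {m : ℕ} (hm : 0 < m)
    (hF : F ∈ grading n m) :
    Spec.map (Proj.awayToSection (grading n) F) ≫ Proj.awayι (grading n) F hF hm =
      (Proj.isAffineOpen_basicOpen (grading n) F hF hm).fromSpec := by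
  have hU := Proj.isAffineOpen_basicOpen (grading n) F hF hm
  rw [← cancel_epi hU.isoSpec.hom, IsAffineOpen.isoSpec_hom, IsAffineOpen.toSpecΓ_fromSpec,
    ← Category.assoc]
  change Proj.basicOpenToSpec (grading n) F ≫ _ = _
  rw [← Proj.basicOpenIsoSpec_hom (grading n) F hF hm, ← Proj.basicOpenIsoSpec_inv_ι,
    Iso.hom_inv_id_assoc]

lemma valueHom_homogPt {F : MvPolynomial (Fin (n + 1)) ℂ} {m : ℕ} (hm : 0 < m)
    (hF : F ∈ grading n m) {x : Fin (n + 1) → ℂ} (hx0 : x ≠ 0) (hx : MvPolynomial.eval x F ≠ 0)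
    (h : (homogPt x hx0).pt ∈ Proj.basicOpen (grading n) F) :
    ((homogPt x hx0).valueHom h).comp (Proj.awayToSection (grading n) F).hom =
      awayEval F x hx := by
  have h1 := (homogPt x hx0).SpecMap_valueHom_fromSpec
    (Proj.isAffineOpen_basicOpen (grading n) F hF hm) h
  rw [ι_homogPt hm hF hx0 hx, ← SpecMap_awayToSection_awayι hm hF, ← Category.assoc, ← Spec.map_comp,
    cancel_mono] at h1
  exact congrArg CommRingCat.Hom.hom (Spec.map_injective h1)

/-- Some homogeneous component of a basic function is nonzero at `p`. Multiplying it by a component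
of positive degree, also nonzero at `p` because `p` does not contain the irrelevant ideal, makes the
degree positive. -/
lemma exists_basicOpen_le (U : (P n).Opens) {p : P n} (hp : p ∈ U) :
    ∃ (G : MvPolynomial (Fin (n + 1)) ℂ) (m : ℕ), 0 < m ∧ G ∈ grading n m ∧
      p ∈ Proj.basicOpen (grading n) G ∧ Proj.basicOpen (grading n) G ≤ U := by
  obtain ⟨_, ⟨_, ⟨G, rfl⟩, rfl⟩, hpG, hGU⟩ :=
    (Proj.isBasis_basicOpen (grading n)).exists_subset_of_mem_open hp U.isOpen
  obtain ⟨G', hG', hpG'⟩ := SetLike.not_le_iff_exists.1 p.not_irrelevant_le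
  have hcomp : ∀ f : MvPolynomial (Fin (n + 1)) ℂ, p ∈ Proj.basicOpen (grading n) f →
      ∃ i, p ∈ Proj.basicOpen (grading n) (GradedRing.proj (grading n) i f) := fun f hf => by
    rw [Proj.basicOpen_eq_iSup_proj] at hf
    exact TopologicalSpace.Opens.mem_iSup.1 hf
  obtain ⟨i, hi⟩ := hcomp G hpG
  obtain ⟨j, hj⟩ := hcomp G' hpG'
  have hj0 : 0 < j := by
    refine Nat.pos_of_ne_zero fun h0 => ?_
    subst h0
    rw [HomogeneousIdeal.mem_irrelevant_iff] at hG'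
    rw [hG'] at hj
    simp at hj
  refine ⟨GradedRing.proj (grading n) i G * GradedRing.proj (grading n) j G', i + j, by omega,
    SetLike.mul_mem_graded (SetLike.coe_mem _) (SetLike.coe_mem _), ?_, ?_⟩
  · rw [Proj.basicOpen_mul]
    exact ⟨hi, hj⟩
  · rw [Proj.basicOpen_mul]
    refine inf_le_left.trans (le_trans ?_ hGU)
    rw [Proj.basicOpen_eq_iSup_proj (grading n) G]
    exact le_iSup (fun i => Proj.basicOpen (grading n) (GradedRing.proj (grading n) i G)) i

end

/-! ### Algebra of the affine charts of projective space -/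

section

open HomogeneousLocalization

variable {n : ℕ}

instance : IsScalarTower ℂ (grading n 0) (MvPolynomial (Fin (n + 1)) ℂ) :=
  ⟨fun c s p => smul_assoc c (s : MvPolynomial (Fin (n + 1)) ℂ) p⟩

instance : Algebra.FiniteType (grading n 0) (MvPolynomial (Fin (n + 1)) ℂ) :=
  Algebra.FiniteType.of_restrictScalars_finiteType ℂ (grading n 0) _

lemma algebraMap_grading_zero_surjective :
    Function.Surjective (algebraMap ℂ (grading n 0)) := fun p => by
  have hp : (p : MvPolynomial (Fin (n + 1)) ℂ).IsHomogeneous 0 := p.2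
  have h := MvPolynomial.totalDegree_eq_zero_iff_eq_C.1
    (Nat.le_zero.1 hp.totalDegree_le)
  exact ⟨_, Subtype.ext h.symm⟩

instance : IsNoetherianRing (grading n 0) :=
  isNoetherianRing_of_surjective ℂ _ _ algebraMap_grading_zero_surjective

instance : LocallyOfFiniteType (projStr n) := by
  have : LocallyOfFiniteType
      (Spec.map (CommRingCat.ofHom (algebraMap ℂ (grading n 0)))) := by
    rw [HasRingHomProperty.Spec_iff (P := @LocallyOfFiniteType)]
    exact RingHom.FiniteType.of_surjective _ algebraMap_grading_zero_surjective
  unfold projStr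
  infer_instance

lemma isNoetherianRing_away {F : MvPolynomial (Fin (n + 1)) ℂ} {m : ℕ} (hF : F ∈ grading n m) :
    IsNoetherianRing (Away (grading n) F) :=
  have := Away.finiteType (𝒜 := grading n) F m hF
  Algebra.FiniteType.isNoetherianRing (grading n 0) _

lemma isDomain_localization_away {F : MvPolynomial (Fin (n + 1)) ℂ} (hF0 : F ≠ 0) :
    IsDomain (Localization.Away F) :=
  IsLocalization.isDomain_localization (powers_le_nonZeroDivisors_of_noZeroDivisors hF0)

lemma isDomain_away {F : MvPolynomial (Fin (n + 1)) ℂ} (hF0 : F ≠ 0) :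
    IsDomain (Away (grading n) F) :=
  have := isDomain_localization_away hF0
  (HomogeneousLocalization.val_injective _).isDomain
    (algebraMap (Away (grading n) F) (Localization.Away F))

lemma away_mk_eq_iff {F : MvPolynomial (Fin (n + 1)) ℂ} (hF0 : F ≠ 0) {m : ℕ}
    (hF : F ∈ grading n m) {i j : ℕ} {a b : MvPolynomial (Fin (n + 1)) ℂ}
    (ha : a ∈ grading n (i • m)) (hb : b ∈ grading n (j • m)) :
    Away.mk (grading n) hF i a ha = Away.mk (grading n) hF j b hb ↔ a * F ^ j = b * F ^ i := by
  rw [← (HomogeneousLocalization.val_injective _).eq_iff, Away.val_mk, Away.val_mk,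
    Localization.mk_eq_mk_iff, Localization.r_iff_exists]
  constructor
  · rintro ⟨⟨_, k, rfl⟩, h⟩
    have := mul_left_cancel₀ (pow_ne_zero k hF0) h
    simp only at this
    linear_combination this
  · intro h
    exact ⟨1, by simp only [OneMemClass.coe_one, one_mul]; linear_combination h⟩

lemma away_mk_mul {F : MvPolynomial (Fin (n + 1)) ℂ} {m : ℕ}
    (hF : F ∈ grading n m) {i j : ℕ} {a b : MvPolynomial (Fin (n + 1)) ℂ}
    (ha : a ∈ grading n (i • m)) (hb : b ∈ grading n (j • m)) :
    Away.mk (grading n) hF i a ha * Away.mk (grading n) hF j b hb =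
      Away.mk (grading n) hF (i + j) (a * b)
        (by rw [add_smul]; exact SetLike.mul_mem_graded ha hb) := by
  refine HomogeneousLocalization.val_injective _ ?_
  rw [val_mul, Away.val_mk, Away.val_mk, Away.val_mk, Localization.mk_mul]
  congr 1
  exact Subtype.ext (pow_add F i j).symm

lemma away_mk_eq_zero_iff {F : MvPolynomial (Fin (n + 1)) ℂ} (hF0 : F ≠ 0) {m : ℕ}
    (hF : F ∈ grading n m) {i : ℕ} {a : MvPolynomial (Fin (n + 1)) ℂ}
    (ha : a ∈ grading n (i • m)) : Away.mk (grading n) hF i a ha = 0 ↔ a = 0 := by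
  have h0 : Away.mk (grading n) hF i 0 (zero_mem _) = 0 := by
    refine HomogeneousLocalization.val_injective _ ?_
    rw [val_zero, Away.val_mk, Localization.mk_zero]
  rw [← h0, away_mk_eq_iff hF0]
  simp [hF0]

lemma exists_homogeneous_of_mul_eq {a b c : MvPolynomial (Fin (n + 1)) ℂ} {i j : ℕ}
    (ha : a ∈ grading n i) (hb : b ∈ grading n (i + j)) (h : b = a * c) :
    ∃ c' ∈ grading n j, b = a * c' := by
  refine ⟨DirectSum.decompose (grading n) c j, SetLike.coe_mem _, ?_⟩
  rw [← DirectSum.coe_decompose_mul_add_of_left_mem (grading n) ha, ← h,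
    DirectSum.decompose_of_mem_same (grading n) hb]

/-- The localization of the polynomial ring is integrally closed, so an integral fraction of degree
zero elements lies in it. Its numerator can then be replaced by the homogeneous component of the
right degree. -/
lemma isIntegrallyClosed_away {F : MvPolynomial (Fin (n + 1)) ℂ} (hF0 : F ≠ 0) {m : ℕ}
    (hF : F ∈ grading n m) : IsIntegrallyClosed (Away (grading n) F) := by
  have := isDomain_away hF0
  have := isDomain_localization_away hF0
  have : IsIntegrallyClosed (Localization.Away F) := isIntegrallyClosed_of_isLocalization
    (Localization.Away F) (.powers F) (powers_le_nonZeroDivisors_of_noZeroDivisors hF0)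
  have hinj : Function.Injective (algebraMap (Away (grading n) F) (Localization.Away F)) :=
    HomogeneousLocalization.val_injective _
  have hinjS : Function.Injective
      (algebraMap (MvPolynomial (Fin (n + 1)) ℂ) (Localization.Away F)) :=
    IsLocalization.injective _ (powers_le_nonZeroDivisors_of_noZeroDivisors hF0)
  rw [isIntegrallyClosed_iff (FractionRing (Away (grading n) F))]
  intro x hx
  let φ : FractionRing (Away (grading n) F) →+* FractionRing (Localization.Away F) :=
    IsFractionRing.map hinj
  have hφ : ∀ r, φ (algebraMap _ _ r) =
      algebraMap (Localization.Away F) _ (algebraMap _ (Localization.Away F) r) := fun r =>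
    IsLocalization.map_eq _ r
  obtain ⟨r, s, hs, rfl⟩ := IsFractionRing.div_surjective (A := Away (grading n) F) x
  have hs0 : s ≠ 0 := nonZeroDivisors.ne_zero hs
  have hint : IsIntegral (Localization.Away F) (φ (algebraMap _ _ r / algebraMap _ _ s)) := by
    obtain ⟨p, hp, hpx⟩ := hx
    refine ⟨p.map (algebraMap _ _), hp.map _, ?_⟩
    have h1 := congrArg φ hpx
    rw [Polynomial.hom_eval₂, map_zero] at h1
    have h2 : (algebraMap (Localization.Away F) (FractionRing (Localization.Away F))).comp
        (algebraMap (Away (grading n) F) (Localization.Away F)) = φ.comp (algebraMap _ _) :=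
      RingHom.ext fun r => (hφ r).symm
    rw [Polynomial.eval₂_map, h2]
    exact h1
  obtain ⟨c, hc⟩ := IsIntegrallyClosed.isIntegral_iff.1 hint
  rw [map_div₀, hφ, hφ] at hc
  have hs1 : algebraMap (Localization.Away F) (FractionRing (Localization.Away F))
      (algebraMap _ (Localization.Away F) s) ≠ 0 := by
    rwa [Ne, map_eq_zero_iff _ (IsFractionRing.injective _ _), map_eq_zero_iff _ hinj]
  rw [eq_div_iff hs1, ← map_mul] at hc
  replace hc := IsFractionRing.injective (Localization.Away F) _ hc
  obtain ⟨i, a, ha, rfl⟩ := Away.mk_surjective (grading n) hF r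
  obtain ⟨j, b, hb, rfl⟩ := Away.mk_surjective (grading n) hF s
  obtain ⟨k, H, hH⟩ := IsLocalization.Away.surj F c
  have h2 : a * F ^ (j + k) = b * F ^ i * H := by
    apply hinjS
    simp only [HomogeneousLocalization.algebraMap_apply, Away.val_mk, Localization.mk_eq_mk'] at hc
    have e1 := IsLocalization.mk'_spec (Localization.Away F) a
      (⟨F ^ i, i, rfl⟩ : Submonoid.powers F)
    have e2 := IsLocalization.mk'_spec (Localization.Away F) b
      (⟨F ^ j, j, rfl⟩ : Submonoid.powers F)
    simp only [map_mul, map_pow] at e1 e2 ⊢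
    rw [← hH, pow_add, ← e1, ← hc, ← e2]
    ring
  obtain ⟨H', hH'm, hH'⟩ := exists_homogeneous_of_mul_eq (i := (j + i) • m) (j := k • m)
    (by rw [add_smul]; exact SetLike.mul_mem_graded hb (SetLike.pow_mem_graded i hF))
    (by
      have := SetLike.mul_mem_graded ha (SetLike.pow_mem_graded (j + k) hF)
      rwa [← add_smul, show i + (j + k) = j + i + k by ring, add_smul] at this) h2
  refine ⟨Away.mk (grading n) hF k H' hH'm, ?_⟩
  rw [eq_div_iff (by rwa [Ne, map_eq_zero_iff _ (IsFractionRing.injective _ _)]), ← map_mul,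
    away_mk_mul, (IsFractionRing.injective (Away (grading n) F) _).eq_iff, away_mk_eq_iff hF0,
    show a * F ^ (k + j) = a * F ^ (j + k) by ring, hH']
  ring

/-- Constants, as degree zero fractions. -/
def awayConst (F : MvPolynomial (Fin (n + 1)) ℂ) : ℂ →+* Away (grading n) F :=
  (algebraMap (grading n 0) _).comp (algebraMap ℂ (grading n 0))

lemma awayEval_awayConst {F : MvPolynomial (Fin (n + 1)) ℂ} {x : Fin (n + 1) → ℂ}
    (hx : MvPolynomial.eval x F ≠ 0) (z : ℂ) : awayEval F x hx (awayConst F z) = z := by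
  rw [awayEval, RingHom.comp_apply, awayConst, RingHom.comp_apply,
    ← IsScalarTower.algebraMap_apply, IsScalarTower.algebraMap_apply (grading n 0)
      (MvPolynomial (Fin (n + 1)) ℂ) (Localization.Away F), IsLocalization.Away.lift_eq]
  exact MvPolynomial.eval_C z

lemma charZero_away {F : MvPolynomial (Fin (n + 1)) ℂ} (hF0 : F ≠ 0) :
    CharZero (Away (grading n) F) :=
  have := isDomain_away hF0
  charZero_of_injective_ringHom (awayConst F).injective

end

/-! ### The generic point of the hyperplane at infinity -/

section

/-- Over a principal height one prime of a Noetherian domain, a torsion-free algebraic algebra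
of finite type has only finitely many primes. -/
lemma finite_primesOver_span_singleton {R B : Type} [CommRing R] [IsDomain R]
    [IsNoetherianRing R] [CommRing B] [IsDomain B] [Algebra R B] [FaithfulSMul R B]
    [Algebra.FiniteType R B] [Algebra.IsAlgebraic R B] {t : R} (ht : Prime t) :
    {q : PrimeSpectrum B | q.asIdeal.comap (algebraMap R B) = Ideal.span {t}}.Finite := by
  have hp : (Ideal.span {t}).IsPrime := (Ideal.span_singleton_prime ht.ne_zero).2 ht
  let p : PrimeSpectrum R := ⟨Ideal.span {t}, hp⟩
  -- Divide an algebraic equation by the highest power of `t`. It remains an equation because `B` is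
  -- a torsion-free domain, and it is now nonzero modulo `t`.
  have hprim : ∀ b : B, ∃ P : Polynomial R, Polynomial.aeval b P = 0 ∧ ¬ Polynomial.C t ∣ P := by
    intro b
    obtain ⟨P, hP0, hP⟩ := Algebra.IsAlgebraic.isAlgebraic (R := R) b
    have hfin : FiniteMultiplicity (Polynomial.C t) P :=
      FiniteMultiplicity.of_not_isUnit
        (fun h => ht.not_isUnit (Polynomial.isUnit_C.1 h)) hP0
    obtain ⟨P', hPP', hdvd⟩ := hfin.exists_eq_pow_mul_and_not_dvd
    refine ⟨P', ?_, hdvd⟩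
    rw [hPP', map_mul, map_pow, Polynomial.aeval_C, mul_eq_zero] at hP
    refine hP.resolve_left (pow_ne_zero _ ?_)
    rw [Ne, map_eq_zero_iff _ (FaithfulSMul.algebraMap_injective R B)]
    exact ht.ne_zero
  have hint1 : ∀ b : B, IsIntegral p.asIdeal.ResidueField
      ((1 : p.asIdeal.ResidueField) ⊗ₜ[R] b : p.asIdeal.Fiber B) := by
    intro b
    obtain ⟨P, hP, hdvd⟩ := hprim b
    rw [← isAlgebraic_iff_isIntegral]
    refine ⟨P.map (algebraMap R _), fun h0 => hdvd ?_, ?_⟩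
    · rw [Polynomial.C_dvd_iff_dvd_coeff]
      intro i
      have h1 := congrArg (fun Q => Polynomial.coeff Q i) h0
      simp only [Polynomial.coeff_map, Polynomial.coeff_zero] at h1
      rw [Ideal.algebraMap_residueField_eq_zero] at h1
      exact Ideal.mem_span_singleton.1 h1
    · rw [Polynomial.aeval_map_algebraMap]
      have := Polynomial.aeval_algHom_apply
        (Algebra.TensorProduct.includeRight : B →ₐ[R] p.asIdeal.Fiber B) b P
      rw [Algebra.TensorProduct.includeRight_apply] at this
      rw [this, hP, map_zero]
  have hint : Algebra.IsIntegral p.asIdeal.ResidueField (p.asIdeal.Fiber B) := by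
    refine ⟨fun x => ?_⟩
    induction x using TensorProduct.induction_on with
    | zero => exact isIntegral_zero
    | add x y hx hy => exact hx.add hy
    | tmul a b =>
      have : (a ⊗ₜ[R] b : p.asIdeal.Fiber B) = a • ((1 : p.asIdeal.ResidueField) ⊗ₜ[R] b) := by
        rw [TensorProduct.smul_tmul', smul_eq_mul, mul_one]
      rw [this]
      exact (hint1 b).smul a
  -- The fibre is of finite type and integral over the residue field, hence a finite-dimensional
  -- algebra, which has finitely many primes.
  have hfin : Module.Finite p.asIdeal.ResidueField (p.asIdeal.Fiber B) :=
    Algebra.IsIntegral.finite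
  have : IsArtinianRing (p.asIdeal.Fiber B) := IsArtinianRing.of_finite p.asIdeal.ResidueField _
  have : Finite (PrimeSpectrum (p.asIdeal.Fiber B)) := inferInstance
  have := Finite.of_equiv _ (PrimeSpectrum.preimageEquivFiber R B p).symm
  refine Set.Finite.subset (Set.toFinite (PrimeSpectrum.comap (algebraMap R B) ⁻¹' {p}))
    fun q hq => PrimeSpectrum.ext hq

open HomogeneousLocalization

variable {n : ℕ}

lemma X_mem_grading (i : Fin (n + 1)) : MvPolynomial.X i ∈ grading n 1 :=
  MvPolynomial.isHomogeneous_X ℂ i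

/-- The function `X₀ / X_l` on the chart `X_l ≠ 0`. -/
def coordZero (l : Fin n) : Away (grading n) (MvPolynomial.X l.succ) :=
  Away.mk (grading n) (X_mem_grading l.succ) 1 (MvPolynomial.X 0)
    (by rw [one_smul]; exact X_mem_grading 0)

lemma X_zero_dvd_X_succ_pow_mul {l : Fin n} {k : ℕ} {a : MvPolynomial (Fin (n + 1)) ℂ}
    (h : MvPolynomial.X 0 ∣ a * MvPolynomial.X l.succ ^ k) : MvPolynomial.X 0 ∣ a := by
  have hp : Prime (MvPolynomial.X 0 : MvPolynomial (Fin (n + 1)) ℂ) := MvPolynomial.X_prime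
  refine (hp.dvd_or_dvd h).resolve_right fun h => ?_
  have := MvPolynomial.X_dvd_X.1 (hp.dvd_of_dvd_pow h)
  exact absurd this.symm (Fin.succ_ne_zero l)

/-- Powers of `X_l` introduced by denominators cancel, since `X₀` is a prime that does not divide
`X_l`. -/
lemma coordZero_dvd_iff (l : Fin n) {k : ℕ} {a : MvPolynomial (Fin (n + 1)) ℂ}
    (ha : a ∈ grading n (k • 1)) :
    coordZero l ∣ Away.mk (grading n) (X_mem_grading l.succ) k a ha ↔
      MvPolynomial.X 0 ∣ a := by
  have hX0 : (MvPolynomial.X l.succ : MvPolynomial (Fin (n + 1)) ℂ) ≠ 0 := MvPolynomial.X_ne_zero _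
  constructor
  · rintro ⟨r, hr⟩
    obtain ⟨j, b, hb, rfl⟩ := Away.mk_surjective (grading n) (X_mem_grading l.succ) r
    rw [coordZero, away_mk_mul, away_mk_eq_iff hX0] at hr
    refine X_zero_dvd_X_succ_pow_mul (l := l) (k := 1 + j) ?_
    rw [hr, mul_assoc]
    exact dvd_mul_right _ _
  · rintro ⟨b, hb⟩
    obtain ⟨c, hc, hac⟩ := exists_homogeneous_of_mul_eq (i := 1) (j := k)
      (a := MvPolynomial.X 0) (b := a * MvPolynomial.X l.succ) (c := b * MvPolynomial.X l.succ)
      (X_mem_grading 0) (by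
        rw [add_comm 1 k]
        refine SetLike.mul_mem_graded ?_ (X_mem_grading l.succ)
        rwa [smul_eq_mul, mul_one] at ha) (by rw [hb]; ring)
    refine ⟨Away.mk (grading n) (X_mem_grading l.succ) k c
      (by rwa [smul_eq_mul, mul_one]), ?_⟩
    rw [coordZero, away_mk_mul, away_mk_eq_iff hX0, ← hac]
    ring

lemma prime_coordZero (l : Fin n) : Prime (coordZero l) := by
  have hX0 : (MvPolynomial.X l.succ : MvPolynomial (Fin (n + 1)) ℂ) ≠ 0 := MvPolynomial.X_ne_zero _
  have hp : Prime (MvPolynomial.X 0 : MvPolynomial (Fin (n + 1)) ℂ) := MvPolynomial.X_prime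
  refine ⟨?_, fun h => ?_, fun r s h => ?_⟩
  · rw [coordZero, Ne, away_mk_eq_zero_iff hX0]
    exact MvPolynomial.X_ne_zero _
  · have h1 := h.dvd (a := Away.mk (grading n) (X_mem_grading l.succ) 0 1
      (by rw [zero_smul]; exact SetLike.GradedOne.one_mem))
    rw [coordZero_dvd_iff] at h1
    exact hp.not_isUnit (isUnit_of_dvd_one h1)
  · obtain ⟨i, a, ha, rfl⟩ := Away.mk_surjective (grading n) (X_mem_grading l.succ) r
    obtain ⟨j, b, hb, rfl⟩ := Away.mk_surjective (grading n) (X_mem_grading l.succ) s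
    rw [away_mk_mul, coordZero_dvd_iff] at h
    rw [coordZero_dvd_iff, coordZero_dvd_iff]
    exact hp.dvd_or_dvd h

/-- The generic point of the hyperplane at infinity, constructed in the chart `X_l ≠ 0`. -/
def genericAtInfinity (l : Fin n) : P n :=
  Proj.awayι (grading n) (MvPolynomial.X l.succ) (X_mem_grading l.succ) Nat.one_pos
    (⟨Ideal.span {coordZero l}, (Ideal.span_singleton_prime (prime_coordZero l).ne_zero).2
      (prime_coordZero l)⟩ : PrimeSpectrum _)

/-- Translates neighbourhoods of the generic point of `H` into hypersurfaces that do not contain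
`H`. -/
lemma genericAtInfinity_mem_basicOpen_iff (l : Fin n) {G : MvPolynomial (Fin (n + 1)) ℂ} {m : ℕ}
    (hm : 0 < m) (hG : G ∈ grading n m) :
    genericAtInfinity l ∈ Proj.basicOpen (grading n) G ↔ ¬ MvPolynomial.X 0 ∣ G := by
  have hp : Prime (MvPolynomial.X 0 : MvPolynomial (Fin (n + 1)) ℂ) := MvPolynomial.X_prime
  have h := Proj.awayι_preimage_basicOpen (𝒜 := grading n)
    (X_mem_grading l.succ) Nat.one_pos hG hm
  have h1 : genericAtInfinity l ∈ Proj.basicOpen (grading n) G ↔ ¬ coordZero l ∣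
      Away.isLocalizationElem (X_mem_grading l.succ) hG := by
    rw [← Ideal.mem_span_singleton]
    exact iff_of_eq (congrArg ((⟨Ideal.span {coordZero l},
      (Ideal.span_singleton_prime (prime_coordZero l).ne_zero).2
        (prime_coordZero l)⟩ : PrimeSpectrum _) ∈ ·) h)
  rw [h1, coordZero_dvd_iff, pow_one]

lemma genericAtInfinity_mem_chart (l : Fin n) :
    genericAtInfinity l ∈ Proj.basicOpen (grading n) (MvPolynomial.X l.succ) := by
  rw [genericAtInfinity_mem_basicOpen_iff l Nat.one_pos (X_mem_grading l.succ),
    MvPolynomial.X_dvd_X]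
  exact (Fin.succ_ne_zero l).symm

lemma genericAtInfinity_mem_basicOpen_section_iff (l : Fin n)
    (r : Away (grading n) (MvPolynomial.X l.succ)) :
    genericAtInfinity l ∈ (P n).basicOpen (Proj.awayToSection (grading n) _ r) ↔
      r ∉ Ideal.span {coordZero l} := by
  have hU := Proj.isAffineOpen_basicOpen (grading n) (MvPolynomial.X l.succ)
    (X_mem_grading l.succ) Nat.one_pos
  have h1 := hU.fromSpec_preimage_basicOpen (Proj.awayToSection (grading n) _ r)
  rw [← SpecMap_awayToSection_awayι Nat.one_pos (X_mem_grading l.succ)] at h1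
  have : IsIso (Proj.awayToSection (grading n) (MvPolynomial.X l.succ : MvPolynomial (Fin (n + 1)) ℂ)) := by
    rw [← Proj.basicOpenIsoAway_hom (grading n) _
      (X_mem_grading l.succ) Nat.one_pos]
    infer_instance
  obtain ⟨q, hq⟩ := (Spec.map (Proj.awayToSection (grading n)
    (MvPolynomial.X l.succ : MvPolynomial (Fin (n + 1)) ℂ))).surjective
      (⟨Ideal.span {coordZero l}, (Ideal.span_singleton_prime (prime_coordZero l).ne_zero).2
      (prime_coordZero l)⟩ : PrimeSpectrum _)
  have h2 : genericAtInfinity l = (Spec.map (Proj.awayToSection (grading n) _) ≫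
      Proj.awayι (grading n) (MvPolynomial.X l.succ) (X_mem_grading l.succ)
      Nat.one_pos) q := by
    rw [Scheme.Hom.comp_apply, hq]
    rfl
  rw [h2]
  refine (iff_of_eq (congrArg (q ∈ ·) h1)).trans ?_
  have h3 : Ideal.comap (Proj.awayToSection (grading n)
    (MvPolynomial.X l.succ : MvPolynomial (Fin (n + 1)) ℂ)).hom q.asIdeal = Ideal.span {coordZero l} :=
    congrArg PrimeSpectrum.asIdeal hq
  rw [← h3]
  rfl

end

/-! ### Reduced subschemes of the product and their complex points -/

section

/-- The reduced induced structure: the vanishing ideal sheaf is locally radical, and the subscheme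
is homeomorphic to the irreducible set `V`. -/
lemma exists_isIntegral_isClosedImmersion_range_eq {Y : Scheme.{0}} {V : Set Y} (hV : IsClosed V)
    (hirr : IsIrreducible V) : ∃ (X : Scheme.{0}) (i : X ⟶ Y), IsIntegral X ∧
      IsClosedImmersion i ∧ Set.range i = V := by
  let I := Scheme.IdealSheafData.vanishingIdeal ⟨V, hV⟩
  have hr : Set.range I.subschemeι = V := by
    rw [Scheme.IdealSheafData.range_subschemeι]
    exact Scheme.IdealSheafData.coe_support_vanishingIdeal ..
  have : IsReduced I.subscheme := by
    have (U : Y.affineOpens) : IsReduced (I.subschemeCover.openCover.X U) := by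
      have hrad : (I.ideal U).IsRadical := PrimeSpectrum.isRadical_vanishingIdeal _
      have : _root_.IsReduced (Γ(Y, U) ⧸ I.ideal U) :=
        (Ideal.isRadical_iff_quotient_reduced _).1 hrad
      exact inferInstanceAs (IsReduced (Spec (.of (Γ(Y, U) ⧸ I.ideal U))))
    exact @IsReduced.of_openCover _ I.subschemeCover.openCover this
  have : IrreducibleSpace I.subscheme := by
    have h1 := I.subschemeι.isClosedEmbedding.isEmbedding.toHomeomorph
    rw [hr] at h1
    exact h1.irreducibleSpace_iff.2 (Subtype.irreducibleSpace hirr)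
  exact ⟨I.subscheme, I.subschemeι, isIntegral_of_irreducibleSpace_of_isReduced _, inferInstance, hr⟩

section Product

variable {n : ℕ} {A : Scheme.{0}} {a : A ⟶ Spec (.of ℂ)} {X : Scheme.{0}}
  (i : X ⟶ pullback (projStr n) a)

/-- The structure morphism of a subscheme of `ℙⁿ × A`. -/
abbrev subStr : X ⟶ Spec (.of ℂ) := (i ≫ pullback.fst (projStr n) a) ≫ projStr n

lemma snd_comp_eq_subStr : (i ≫ pullback.snd (projStr n) a) ≫ a = subStr i := by
  simp only [Category.assoc, subStr, pullback.condition]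

/-- The first projection on complex points of a subscheme of `ℙⁿ × A`. -/
def fstPt (x : CPoints (subStr i)) : CPoints (projStr n) :=
  x.map (i ≫ pullback.fst (projStr n) a) rfl

/-- The second projection on complex points of a subscheme of `ℙⁿ × A`. -/
def sndPt (x : CPoints (subStr i)) : CPoints a :=
  x.map (i ≫ pullback.snd (projStr n) a) (snd_comp_eq_subStr i)

lemma lift_fstPt_sndPt (x : CPoints (subStr i)) :
    pullback.lift (fstPt i x).1 (sndPt i x).1 ((fstPt i x).2.trans (sndPt i x).2.symm) =
      x.1 ≫ i := by
  refine pullback.hom_ext ?_ ?_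
  · rw [pullback.lift_fst]; simp [fstPt, CPoints.map]
  · rw [pullback.lift_snd]; simp [sndPt, CPoints.map]

lemma prodPt_fstPt_sndPt (x : CPoints (subStr i)) :
    prodPt (fstPt i x) (sndPt i x) = i x.pt := by
  rw [prodPt, lift_fstPt_sndPt]
  exact Scheme.Hom.comp_apply _ _ _

lemma eq_of_fstPt_eq_of_sndPt_eq [IsClosedImmersion i] {x y : CPoints (subStr i)} (h1 : fstPt i x = fstPt i y)
    (h2 : sndPt i x = sndPt i y) : x = y := by
  refine Subtype.ext ?_
  rw [← cancel_mono i, ← lift_fstPt_sndPt, ← lift_fstPt_sndPt]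
  simp only [h1, h2]

/-- A complex point of the product is closed, so the point of `X` below it is closed. Over `ℂ` a
closed point of a scheme locally of finite type is a complex point. -/
lemma exists_fstPt_eq_sndPt_eq [IsClosedImmersion i] [LocallyOfFiniteType a]
    {z : CPoints (projStr n)} {w : CPoints a}
    (h : prodPt z w ∈ Set.range i) : ∃ x, fstPt i x = z ∧ sndPt i x = w := by
  obtain ⟨x₀, hx₀⟩ := h
  let sY : pullback (projStr n) a ⟶ Spec (.of ℂ) := pullback.fst (projStr n) a ≫ projStr n
  let y : Spec (.of ℂ) ⟶ pullback (projStr n) a := pullback.lift z.1 w.1 (z.2.trans w.2.symm)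
  have hy : y ≫ sY = 𝟙 _ := by
    rw [← Category.assoc, pullback.lift_fst, z.2]
  have hyc : IsClosed {prodPt z w} := (pointEquivClosedPoint sY ⟨y, hy⟩).2
  have hxc : IsClosed {x₀} := by
    have : {x₀} = i ⁻¹' {prodPt z w} := by
      ext x
      rw [Set.mem_preimage, Set.mem_singleton_iff, Set.mem_singleton_iff, ← hx₀]
      exact ⟨fun h => h ▸ rfl, fun h => i.isClosedEmbedding.injective h⟩
    rw [this]
    exact hyc.preimage i.continuous
  let x : CPoints (subStr i) := ⟨pointOfClosedPoint (subStr i) x₀ hxc, pointOfClosedPoint_comp ..⟩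
  have hx : x.1 ≫ i = y := by
    refine ext_of_apply_closedPoint_eq sY ?_ hy ?_
    · rw [Category.assoc, ← Category.assoc i]; exact x.2
    · refine (Scheme.Hom.comp_apply x.1 i _).trans ?_
      have : x.1 (IsLocalRing.closedPoint ℂ) = x₀ := pointOfClosedPoint_apply ..
      rw [this, hx₀]
      rfl
  refine ⟨x, Subtype.ext ?_, Subtype.ext ?_⟩
  · change x.1 ≫ i ≫ _ = _
    rw [← Category.assoc, hx, pullback.lift_fst]
  · change x.1 ≫ i ≫ _ = _
    rw [← Category.assoc, hx, pullback.lift_snd]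

end Product

end

/-! ### Finiteness over open subsets of projective space -/

section

/-- Finiteness over `V` restricts to `W` by base change; on an affine `W` it becomes finiteness of a
ring map. -/
lemma isAffineOpen_and_finite_of_isFinite_morphismRestrict {X Y : Scheme.{0}} (f : X ⟶ Y)
    {V W : Y.Opens} (hWV : W ≤ V) (hW : IsAffineOpen W) [IsFinite (f ∣_ V)] :
    IsAffineOpen (f ⁻¹ᵁ W) ∧ (f.app W).hom.Finite := by
  have h1 := isPullback_morphismRestrict f W
  have h2 := isPullback_morphismRestrict f V
  have h3 : IsPullback (X.homOfLE (show f ⁻¹ᵁ W ≤ f ⁻¹ᵁ V from fun x hx => hWV hx)) (f ∣_ W)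
      (f ∣_ V) (Y.homOfLE hWV) := by
    refine IsPullback.of_right ?_ ?_ h2.flip
    · simpa using h1.flip
    · rw [← cancel_mono V.ι]
      simp
  have h4 : IsFinite (f ∣_ W) := MorphismProperty.of_isPullback h3 inferInstance
  have : IsAffine W := hW
  refine ⟨isAffine_of_isAffineHom (f ∣_ W), ?_⟩
  have h5 : (f ∣_ W).appTop = W.topIso.hom ≫ f.app W ≫ (f ⁻¹ᵁ W).topIso.inv := by
    rw [← Scheme.Hom.resLE_eq_morphismRestrict, ← Scheme.Hom.appLE_eq_app]
    exact Scheme.Hom.resLE_app_top ..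
  have h6 : (f ∣_ W).appTop.hom.Finite := (f ∣_ W).finite_app ⊤ (isAffineOpen_top _)
  have h7 : f.app W = W.topIso.inv ≫ (f ∣_ W).appTop ≫ (f ⁻¹ᵁ W).topIso.hom := by
    rw [h5]
    simp only [Category.assoc, Iso.inv_hom_id, Iso.inv_hom_id_assoc, Category.comp_id]
  rw [h7, CommRingCat.hom_comp, CommRingCat.hom_comp]
  refine RingHom.Finite.comp (RingHom.Finite.comp (RingHom.Finite.of_surjective _ ?_) h6)
    (RingHom.Finite.of_surjective _ ?_)
  · exact (ConcreteCategory.bijective_of_isIso (f ⁻¹ᵁ W).topIso.hom).2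
  · exact (ConcreteCategory.bijective_of_isIso W.topIso.inv).2

/-- In a Jacobson space a closed set is the closure of its closed points, and a finite set of closed
points is already closed. -/
lemma finite_preimage_of_finite_closedPoints {X Y : Scheme.{0}} [JacobsonSpace X] (f : X ⟶ Y) {y : Y}
    (hy : IsClosed {y}) (h : {x | f x = y ∧ IsClosed {x}}.Finite) : (f ⁻¹' {y}).Finite := by
  have h1 := closure_inter_closedPoints (X := X) (hy.preimage f.continuous)
  have h2 : (f ⁻¹' {y}) ∩ closedPoints X = {x | f x = y ∧ IsClosed {x}} := rfl
  rw [h2] at h1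
  have h3 : IsClosed {x | f x = y ∧ IsClosed {x}} := by
    have h4 := h.isClosed_biUnion (f := fun x => ({x} : Set X)) fun x hx => hx.2
    rwa [Set.biUnion_of_singleton] at h4
  rw [h3.closure_eq] at h1
  rwa [← h1]

section Away

open HomogeneousLocalization

variable {n : ℕ} {X : Scheme.{0}} (f : X ⟶ P n)

/-- Pullback of degree zero fractions to functions on an open subset of a scheme over `ℙⁿ`. -/
def pullAway (F : MvPolynomial (Fin (n + 1)) ℂ) (U : X.Opens)
    (e : U ≤ f ⁻¹ᵁ Proj.basicOpen (grading n) F) : Away (grading n) F →+* Γ(X, U) :=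
  (Proj.awayToSection (grading n) F ≫ f.appLE _ U e).hom

lemma exists_eval_ne_zero {F : MvPolynomial (Fin (n + 1)) ℂ} (hF0 : F ≠ 0) :
    ∃ x : Fin (n + 1) → ℂ, MvPolynomial.eval x F ≠ 0 := by
  by_contra! h
  exact hF0 (MvPolynomial.funext fun x => by rw [h x, map_zero])

lemma ne_zero_of_eval_ne_zero {F : MvPolynomial (Fin (n + 1)) ℂ} {m : ℕ} (hm : 0 < m)
    (hF : F ∈ grading n m) {x : Fin (n + 1) → ℂ} (h : MvPolynomial.eval x F ≠ 0) : x ≠ 0 := by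
  rintro rfl
  refine h ?_
  rw [MvPolynomial.eval_zero, MvPolynomial.constantCoeff_eq]
  exact hF.coeff_eq_zero (by simpa using hm.ne)

/-- A nonzero fraction is nonzero at some complex point of the chart. By surjectivity of `f` its
nonvanishing locus has nonempty preimage, which meets `U` since `X` is irreducible; so its pullback
to `U` is not zero. -/
lemma pullAway_injective [IsIntegral X] (hf : Function.Surjective f)
    {F : MvPolynomial (Fin (n + 1)) ℂ} (hF0 : F ≠ 0) {m : ℕ} (hm : 0 < m) (hF : F ∈ grading n m)
    {U : X.Opens} [Nonempty U] (e : U ≤ f ⁻¹ᵁ Proj.basicOpen (grading n) F) :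
    Function.Injective (pullAway f F U e) := by
  rw [injective_iff_map_eq_zero]
  intro r hr
  obtain ⟨k, G, hG, rfl⟩ := Away.mk_surjective (grading n) hF r
  rw [away_mk_eq_zero_iff hF0]
  by_contra hG0
  obtain ⟨x, hx⟩ := exists_eval_ne_zero (mul_ne_zero hG0 hF0)
  rw [map_mul] at hx
  have hxF := right_ne_zero_of_mul hx
  have hx0 := ne_zero_of_eval_ne_zero hm hF hxF
  have hmem := (homogPt_mem_basicOpen_iff hm hF hx0).2 hxF
  have hval := congrArg (fun φ => φ (Away.mk (grading n) hF k G hG))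
    (valueHom_homogPt hm hF hx0 hxF hmem)
  rw [awayEval_mk, RingHom.comp_apply] at hval
  have hmem2 := (CPoints.mem_basicOpen_iff _ hmem (Proj.awayToSection (grading n) F
    (Away.mk (grading n) hF k G hG))).2 (by
      erw [hval]
      exact div_ne_zero (left_ne_zero_of_mul hx) (pow_ne_zero _ hxF))
  obtain ⟨y, hy⟩ := hf (homogPt x hx0).pt
  have h1 := Scheme.basicOpen_appLE f U _ e (Proj.awayToSection (grading n) F
    (Away.mk (grading n) hF k G hG))
  have h2 : f.appLE _ U e (Proj.awayToSection (grading n) F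
    (Away.mk (grading n) hF k G hG)) = 0 := hr
  rw [h2, Scheme.basicOpen_zero] at h1
  obtain ⟨u⟩ := ‹Nonempty U›
  obtain ⟨v, -, hv⟩ := (PreirreducibleSpace.isPreirreducible_univ (X := X)) U
    (f ⁻¹ᵁ (P n).basicOpen (Proj.awayToSection (grading n) F (Away.mk (grading n) hF k G hG)))
    U.isOpen (TopologicalSpace.Opens.isOpen _) ⟨u.1, trivial, u.2⟩ ⟨y, trivial, by
      have h3 := hmem2
      rw [← hy] at h3
      exact h3⟩
  have : v ∈ (⊥ : X.Opens) := h1 ▸ hv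
  exact this

lemma awayMap_comp_pullAway {F G : MvPolynomial (Fin (n + 1)) ℂ} {m : ℕ} (hG : G ∈ grading n m)
    {U : X.Opens} (e : U ≤ f ⁻¹ᵁ Proj.basicOpen (grading n) F)
    (e' : U ≤ f ⁻¹ᵁ Proj.basicOpen (grading n) (F * G)) :
    (pullAway f (F * G) U e').comp (awayMap (grading n) hG rfl) = pullAway f F U e := by
  have h := Proj.awayMap_awayToSection (grading n) (f := F) hG rfl
  have h2 := congrArg (· ≫ f.appLE _ U e') h
  simp only [Category.assoc, Scheme.Hom.map_appLE] at h2
  exact congrArg CommRingCat.Hom.hom h2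

lemma res_comp_pullAway {F : MvPolynomial (Fin (n + 1)) ℂ} {U U' : X.Opens}
    (e : U ≤ f ⁻¹ᵁ Proj.basicOpen (grading n) F) (h : U' ≤ U) :
    (X.presheaf.map (homOfLE h).op).hom.comp (pullAway f F U e) =
      pullAway f F U' (h.trans e) := by
  have := Scheme.Hom.appLE_map f e (homOfLE h).op
  rw [pullAway, ← CommRingCat.hom_comp, Category.assoc, this]
  rfl

lemma germToFunctionField_res [IsIntegral X] {U U' : X.Opens} [Nonempty U] [Nonempty U'] (h : U' ≤ U)
    (b : Γ(X, U)) : X.germToFunctionField U' (X.presheaf.map (homOfLE h).op b) =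
      X.germToFunctionField U b := by
  rw [← CommRingCat.comp_apply]
  congr 2
  exact X.presheaf.germ_res ..

end Away

section Fiber

variable {n : ℕ} {A : Scheme.{0}} {a : A ⟶ Spec (.of ℂ)} {X : Scheme.{0}}
  (i : X ⟶ pullback (projStr n) a) [IsClosedImmersion i] [LocallyOfFiniteType a]

/-- Closed points of `X` are complex points, and over a fixed `z` these are determined by their
projection to `A`. -/
lemma finite_preimage_fst (z : CPoints (projStr n))
    (h : {w : CPoints a | prodPt z w ∈ Set.range i}.Finite) :
    ((i ≫ pullback.fst (projStr n) a) ⁻¹' {z.pt}).Finite := by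
  have hsX : LocallyOfFiniteType (subStr i) := inferInstance
  have : JacobsonSpace X := LocallyOfFiniteType.jacobsonSpace (subStr i)
  refine finite_preimage_of_finite_closedPoints _ (pointEquivClosedPoint (projStr n) z).2 ?_
  have hfin : {x : CPoints (subStr i) | fstPt i x = z}.Finite := by
    refine Set.Finite.of_finite_image (f := sndPt i) (h.subset ?_) ?_
    · rintro _ ⟨x, rfl, rfl⟩
      exact ⟨_, (prodPt_fstPt_sndPt i x).symm⟩
    · intro x hx y hy hxy
      exact eq_of_fstPt_eq_of_sndPt_eq i (hx.trans hy.symm) hxy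
  refine (hfin.image CPoints.pt).subset ?_
  rintro x ⟨hx, hxc⟩
  let x' : CPoints (subStr i) := ⟨pointOfClosedPoint (subStr i) x hxc, pointOfClosedPoint_comp ..⟩
  have hx' : x'.pt = x := pointOfClosedPoint_apply ..
  refine ⟨x', ?_, hx'⟩
  refine Subtype.ext (ext_of_apply_closedPoint_eq (projStr n) (fstPt i x').2 z.2 ?_)
  change (fstPt i x').pt = z.pt
  rw [fstPt, CPoints.pt_map, hx', hx]

end Fiber

end

/-! ### Algebraicity of functions over a generically finite morphism -/

section

lemma isAlgebraic_of_isFractionRing_tower (R₀ R₁ B' B K : Type) [CommRing R₀] [CommRing R₁] [CommRing B']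
    [CommRing B] [Field K] [IsDomain R₀] [IsDomain R₁] [Algebra R₀ R₁] [Algebra R₁ B'] [Algebra B' K]
    [Algebra R₀ B] [Algebra B K] [Algebra R₀ K] [Algebra R₁ K] [IsScalarTower R₀ R₁ K]
    [IsScalarTower R₁ B' K] [IsScalarTower R₀ B K] [IsFractionRing B' K] [Module.Finite R₁ B']
    (M : Submonoid R₀) [IsLocalization M R₁] [FaithfulSMul R₁ B']
    (hB : Function.Injective (algebraMap B K)) : Algebra.IsAlgebraic R₀ B := by
  have hB' : Function.Injective (algebraMap B' K) := IsFractionRing.injective _ _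
  have : IsDomain B' := hB'.isDomain (algebraMap B' K)
  have : FaithfulSMul R₁ K := by
    rw [faithfulSMul_iff_algebraMap_injective, IsScalarTower.algebraMap_eq R₁ B' K]
    exact hB'.comp (FaithfulSMul.algebraMap_injective R₁ B')
  have h1 : Algebra.IsAlgebraic R₁ K :=
    (IsFractionRing.isAlgebraic_iff' R₁ B' K).1 inferInstance
  have h2 : Algebra.IsAlgebraic R₀ R₁ := IsLocalization.isAlgebraic R₁ M
  have h3 : Algebra.IsAlgebraic R₀ K := Algebra.IsAlgebraic.trans R₀ R₁ K
  exact ⟨fun b => (isAlgebraic_algebraMap_iff hB).1 (h3.isAlgebraic (algebraMap B K b))⟩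

open HomogeneousLocalization

variable {n : ℕ} {X : Scheme.{0}} (f : X ⟶ P n)

lemma nonempty_preimage_basicOpen (hf : Function.Surjective f) {F : MvPolynomial (Fin (n + 1)) ℂ}
    (hF0 : F ≠ 0) {m : ℕ} (hm : 0 < m) (hF : F ∈ grading n m) :
    Nonempty (f ⁻¹ᵁ Proj.basicOpen (grading n) F) := by
  obtain ⟨x, hx⟩ := exists_eval_ne_zero hF0
  have hx0 := ne_zero_of_eval_ne_zero hm hF hx
  obtain ⟨y, hy⟩ := hf (homogPt x hx0).pt
  have h := (homogPt_mem_basicOpen_iff hm hF hx0).2 hx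
  rw [← hy] at h
  exact ⟨⟨y, h⟩⟩

lemma bijective_awayToSection {F : MvPolynomial (Fin (n + 1)) ℂ} {m : ℕ} (hm : 0 < m)
    (hF : F ∈ grading n m) : Function.Bijective (Proj.awayToSection (grading n) F) := by
  have : IsIso (Proj.awayToSection (grading n) F) := by
    rw [← Proj.basicOpenIsoAway_hom (grading n) F hF hm]
    infer_instance
  exact ConcreteCategory.bijective_of_isIso _

lemma finite_pullAway {F : MvPolynomial (Fin (n + 1)) ℂ} {m : ℕ} (hm : 0 < m)
    (hF : F ∈ grading n m) (h : (f.app (Proj.basicOpen (grading n) F)).hom.Finite) :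
    (pullAway f F (f ⁻¹ᵁ Proj.basicOpen (grading n) F) le_rfl).Finite := by
  rw [pullAway, Scheme.Hom.appLE_eq_app, CommRingCat.hom_comp]
  exact h.comp (RingHom.Finite.of_surjective _ (bijective_awayToSection hm hF).2)

/-- If `f : X ⟶ ℙⁿ` is surjective and finite over some non-empty open set, then all functions on
affine charts of `X` are algebraic over the functions on the corresponding chart of `ℙⁿ`. -/
lemma isAlgebraic_pullAway [IsIntegral X] (hf : Function.Surjective f)
    {F G : MvPolynomial (Fin (n + 1)) ℂ} (hF0 : F ≠ 0) (hG0 : G ≠ 0) {m k : ℕ} (hm : 0 < m)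
    (hk : 0 < k) (hF : F ∈ grading n m) (hG : G ∈ grading n k) {V : (P n).Opens}
    (hGV : Proj.basicOpen (grading n) G ≤ V) [IsFinite (f ∣_ V)] {U : X.Opens} [Nonempty U]
    (e : U ≤ f ⁻¹ᵁ Proj.basicOpen (grading n) F) :
    letI := (pullAway f F U e).toAlgebra
    Algebra.IsAlgebraic (Away (grading n) F) Γ(X, U) := by
  have hFG : F * G ∈ grading n (m + k) := SetLike.mul_mem_graded hF hG
  have hFG0 := mul_ne_zero hF0 hG0
  have hle : Proj.basicOpen (grading n) (F * G) ≤ V :=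
    (Proj.basicOpen_mono _ _ _ (dvd_mul_left G F)).trans hGV
  obtain ⟨haff, hfin⟩ := isAffineOpen_and_finite_of_isFinite_morphismRestrict f hle
    (Proj.isAffineOpen_basicOpen _ _ hFG (by omega))
  -- Functions on `U'` are finite over the chart of `F * G` and have the function field of `X` as
  -- fraction field; functions on `U` embed in the same field.
  let U' := f ⁻¹ᵁ Proj.basicOpen (grading n) (F * G)
  have hU' : Nonempty U' := nonempty_preimage_basicOpen f hf hFG0 (by omega) hFG
  have hFrac := functionField_isFractionRing_of_isAffineOpen X U' haff
  have := isDomain_away hF0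
  have := isDomain_away hFG0
  let := (pullAway f F U e).toAlgebra
  let := (awayMap (grading n) hG (rfl : F * G = F * G)).toAlgebra
  let := (pullAway f (F * G) U' le_rfl).toAlgebra
  let algK : Algebra (Away (grading n) (F * G)) X.functionField :=
    ((X.germToFunctionField U').hom.comp (pullAway f (F * G) U' le_rfl)).toAlgebra
  let algK0 : Algebra (Away (grading n) F) X.functionField :=
    ((X.germToFunctionField U).hom.comp (pullAway f F U e)).toAlgebra
  have : IsScalarTower (Away (grading n) (F * G)) Γ(X, U') X.functionField :=
    IsScalarTower.of_algebraMap_eq fun _ => rfl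
  have : IsScalarTower (Away (grading n) F) Γ(X, U) X.functionField :=
    IsScalarTower.of_algebraMap_eq fun _ => rfl
  have : IsScalarTower (Away (grading n) F) (Away (grading n) (F * G)) X.functionField := by
    refine IsScalarTower.of_algebraMap_eq fun r => ?_
    have u := Classical.arbitrary U
    have u' := hU'.some
    -- The two maps to the function field are compared on `U ⊓ U'`, which is nonempty by
    -- irreducibility.
    obtain ⟨v, -, hv⟩ := (PreirreducibleSpace.isPreirreducible_univ (X := X)) U U'
      U.isOpen U'.isOpen ⟨u.1, trivial, u.2⟩ ⟨u'.1, trivial, u'.2⟩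
    have hne : Nonempty (U ⊓ U' : X.Opens) := ⟨⟨v, hv⟩⟩
    have e1 : (X.presheaf.map (homOfLE (inf_le_left : U ⊓ U' ≤ U)).op) (pullAway f F U e r) =
        pullAway f F (U ⊓ U') (inf_le_left.trans e) r :=
      RingHom.congr_fun (res_comp_pullAway f e (inf_le_left : U ⊓ U' ≤ U)) r
    have e2 : (X.presheaf.map (homOfLE (inf_le_right : U ⊓ U' ≤ U')).op)
        (pullAway f (F * G) U' le_rfl (awayMap (grading n) hG rfl r)) =
        pullAway f (F * G) (U ⊓ U') inf_le_right (awayMap (grading n) hG rfl r) :=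
      RingHom.congr_fun (res_comp_pullAway f le_rfl (inf_le_right : U ⊓ U' ≤ U'))
        (awayMap (grading n) hG rfl r)
    have e3 : pullAway f (F * G) (U ⊓ U') inf_le_right (awayMap (grading n) hG rfl r) =
        pullAway f F (U ⊓ U') (inf_le_left.trans e) r :=
      RingHom.congr_fun (awayMap_comp_pullAway f hG (inf_le_left.trans e) inf_le_right) r
    change X.germToFunctionField U (pullAway f F U e r) = X.germToFunctionField U'
      (pullAway f (F * G) U' le_rfl (awayMap (grading n) hG rfl r))
    rw [← germToFunctionField_res (inf_le_left : U ⊓ U' ≤ U),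
      ← germToFunctionField_res (inf_le_right : U ⊓ U' ≤ U'), e1, e2, e3]
  have : Module.Finite (Away (grading n) (F * G)) Γ(X, U') :=
    finite_pullAway f (by omega) hFG hfin
  have : FaithfulSMul (Away (grading n) (F * G)) Γ(X, U') := by
    rw [faithfulSMul_iff_algebraMap_injective]
    exact pullAway_injective f hf hFG0 (by omega) hFG le_rfl
  have := Away.isLocalization_mul hF hG (rfl : F * G = F * G) hm.ne'
  exact isAlgebraic_of_isFractionRing_tower (Away (grading n) F) (Away (grading n) (F * G))
    Γ(X, U') Γ(X, U) X.functionField (Submonoid.powers (Away.isLocalizationElem hF hG))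
    (germ_injective_of_isIntegral _ _ _)

end

/-! ### Finiteness near the hyperplane at infinity -/

section

open HomogeneousLocalization

variable {n : ℕ} {X : Scheme.{0}} (f : X ⟶ P n)

/-- If `f : X ⟶ ℙⁿ` is surjective, of finite type and generically finite, then its fibre over the
generic point of the hyperplane at infinity is finite. -/
lemma finite_preimage_genericAtInfinity [IsIntegral X] [LocallyOfFiniteType f] [QuasiCompact f]
    (hf : Function.Surjective f) {G : MvPolynomial (Fin (n + 1)) ℂ} (hG0 : G ≠ 0) {k : ℕ}
    (hk : 0 < k) (hG : G ∈ grading n k) {V : (P n).Opens}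
    (hGV : Proj.basicOpen (grading n) G ≤ V) [IsFinite (f ∣_ V)] (l : Fin n) :
    (f ⁻¹' {genericAtInfinity l}).Finite := by
  let F : MvPolynomial (Fin (n + 1)) ℂ := MvPolynomial.X l.succ
  have hF0 : F ≠ 0 := MvPolynomial.X_ne_zero _
  have hF : F ∈ grading n 1 := X_mem_grading l.succ
  have haff := Proj.isAffineOpen_basicOpen (grading n) F hF Nat.one_pos
  have := isDomain_away hF0
  have := isNoetherianRing_away hF
  -- On an affine piece, points over the generic point of `H` correspond to primes over the ideal of
  -- `X₀/X_l`; quasi-compactness then reduces to finitely many pieces.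
  have hloc : ∀ U : X.Opens, IsAffineOpen U → Nonempty U →
      U ≤ f ⁻¹ᵁ Proj.basicOpen (grading n) F →
      {x | x ∈ U ∧ f x = genericAtInfinity l}.Finite := by
    intro U hU hne e
    let := (pullAway f F U e).toAlgebra
    have : FaithfulSMul (Away (grading n) F) Γ(X, U) := by
      rw [faithfulSMul_iff_algebraMap_injective]
      exact pullAway_injective f hf hF0 Nat.one_pos hF e
    have : Algebra.FiniteType (Away (grading n) F) Γ(X, U) :=
      (f.finiteType_appLE haff hU e).comp
        (RingHom.FiniteType.of_surjective _ (bijective_awayToSection Nat.one_pos hF).2)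
    have : Algebra.IsAlgebraic (Away (grading n) F) Γ(X, U) :=
      isAlgebraic_pullAway f hf hF0 hG0 Nat.one_pos hk hF hG hGV e
    have hfin := finite_primesOver_span_singleton (B := Γ(X, U)) (prime_coordZero l)
    refine (hfin.image hU.fromSpec).subset ?_
    rintro x ⟨hxU, hx⟩
    obtain ⟨q, rfl⟩ : x ∈ Set.range hU.fromSpec := by rw [hU.range_fromSpec]; exact hxU
    refine ⟨q, Ideal.ext fun r => ?_, rfl⟩
    have h1 : q ∈ PrimeSpectrum.basicOpen (pullAway f F U e r) ↔
        hU.fromSpec q ∈ X.basicOpen (pullAway f F U e r) :=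
      iff_of_eq (congrArg (q ∈ ·) (hU.fromSpec_preimage_basicOpen (pullAway f F U e r)).symm)
    have h2 : X.basicOpen (pullAway f F U e r) =
        U ⊓ f ⁻¹ᵁ (P n).basicOpen (Proj.awayToSection (grading n) F r) :=
      Scheme.basicOpen_appLE f U _ e _
    have h3 := genericAtInfinity_mem_basicOpen_section_iff l r
    rw [← hx] at h3
    have h4 : q ∈ PrimeSpectrum.basicOpen (pullAway f F U e r) ↔ r ∉ Ideal.span {coordZero l} := by
      rw [h1, h2, ← h3]
      exact ⟨fun h => h.2, fun h => ⟨hxU, h⟩⟩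
    exact not_iff_not.1 h4
  have hcomp : IsCompact ((f ⁻¹ᵁ Proj.basicOpen (grading n) F : X.Opens) : Set X) :=
    f.isCompact_preimage haff.isCompact
  have hres : (((f ⁻¹ᵁ Proj.basicOpen (grading n) F : X.Opens) : Set X) ∩
      f ⁻¹' {genericAtInfinity l}).Finite := by
    refine hcomp.induction_on (p := fun S => (S ∩ f ⁻¹' {genericAtInfinity l}).Finite) ?_ ?_ ?_ ?_
    · simp
    · exact fun s t hst ht => ht.subset (Set.inter_subset_inter_left _ hst)
    · intro s t hs ht
      rw [Set.union_inter_distrib_right]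
      exact hs.union ht
    · intro x hx
      obtain ⟨U, hU, hxU, hUe⟩ := exists_isAffineOpen_mem_and_subset hx
      refine ⟨U, mem_nhdsWithin_of_mem_nhds (U.isOpen.mem_nhds hxU), ?_⟩
      exact hloc U hU ⟨⟨x, hxU⟩⟩ hUe
  refine hres.subset fun x hx => ⟨?_, hx⟩
  have h := genericAtInfinity_mem_chart l
  rw [← (show f x = _ from hx)] at h
  exact h

/-- A surjective generically finite proper morphism to `ℙⁿ` is finite over the complement of a
hypersurface that does not contain the hyperplane at infinity. -/
lemma exists_finite_basicOpen [IsIntegral X] [IsProper f] (hf : Function.Surjective f)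
    {z : CPoints (projStr n)} (hz : (f ⁻¹' {z.pt}).Finite) (l : Fin n) :
    ∃ (F : MvPolynomial (Fin (n + 1)) ℂ) (m : ℕ), 0 < m ∧ F ∈ grading n m ∧
      ¬ MvPolynomial.X 0 ∣ F ∧ IsAffineOpen (f ⁻¹ᵁ Proj.basicOpen (grading n) F) ∧
      (pullAway f F (f ⁻¹ᵁ Proj.basicOpen (grading n) F) le_rfl).Finite := by
  obtain ⟨V, hzV, hV⟩ := exists_isFinite_morphismRestrict_of_finite_preimage_singleton f _ hz
  obtain ⟨G, k, hk, hG, hzG, hGV⟩ := exists_basicOpen_le V hzV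
  have hG0 : G ≠ 0 := by
    rintro rfl
    rw [Proj.basicOpen_zero] at hzG
    exact hzG
  -- Finiteness near `z` gives algebraicity, hence a finite fibre at the generic point of `H`, where
  -- the same finiteness criterion is applied again.
  have hfin := finite_preimage_genericAtInfinity f hf hG0 hk hG hGV l
  obtain ⟨V', hV', hfV'⟩ := exists_isFinite_morphismRestrict_of_finite_preimage_singleton f _ hfin
  obtain ⟨F, m, hm, hF, hlF, hFV'⟩ := exists_basicOpen_le V' hV'
  obtain ⟨h1, h2⟩ := isAffineOpen_and_finite_of_isFinite_morphismRestrict f hFV'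
    (Proj.isAffineOpen_basicOpen _ _ hF hm)
  exact ⟨F, m, hm, hF, (genericAtInfinity_mem_basicOpen_iff l hm hF).1 hlF, h1,
    finite_pullAway f hm hF h2⟩

end

/-! ### Counting the points of an unramified fibre -/

section

section Count

open Polynomial

variable {R B : Type*} [CommRing R] [IsDomain R] [IsIntegrallyClosed R] [CommRing B] [IsDomain B]
  [Algebra R B] [Module.Finite R B] [FaithfulSMul R B]

/-- The number of extensions to `B` of a homomorphism `R →+* ℂ` at which the extension is
unramified. -/
lemma encard_ringHom_extensions {b : B} {D : R} {e : R →+* ℂ} (he : e D ≠ 0)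
    (hsep : ((minpoly R b).map e).Separable) (hgen : ∀ b' : B, ∃ q : R[X], D • b' = aeval b q) :
    {φ : B →+* ℂ | φ.comp (algebraMap R B) = e}.encard = (minpoly R b).natDegree := by
  classical
  have hmon : (minpoly R b).Monic := minpoly.monic (Algebra.IsIntegral.isIntegral b)
  have hne : (minpoly R b).map e ≠ 0 := (hmon.map e).ne_zero
  have hinj : Set.InjOn (fun φ : B →+* ℂ => φ b) {φ | φ.comp (algebraMap R B) = e} := by
    intro φ hφ ψ hψ h
    refine RingHom.ext fun b' => ?_
    obtain ⟨q, hq⟩ := hgen b'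
    have hval : ∀ χ : B →+* ℂ, χ.comp (algebraMap R B) = e → e D * χ b' = (q.map e).eval (χ b) := by
      intro χ hχ
      rw [← hom_aeval χ hχ, ← hq, Algebra.smul_def, map_mul, ← hχ, RingHom.comp_apply]
    refine mul_left_cancel₀ he ?_
    rw [hval φ hφ, hval ψ hψ]
    exact congrArg (fun t => (q.map e).eval t) h
  have himg : (fun φ : B →+* ℂ => φ b) '' {φ | φ.comp (algebraMap R B) = e} =
      (((minpoly R b).map e).roots.toFinset : Set ℂ) := by
    ext t
    rw [Finset.mem_coe, Multiset.mem_toFinset, Polynomial.mem_roots hne, IsRoot.def]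
    constructor
    · rintro ⟨φ, rfl, rfl⟩
      exact eval_map_minpoly φ b
    · intro ht
      obtain ⟨φ, hφ, hφb⟩ := exists_ringHom_apply_eq ht
      exact ⟨φ, hφ, hφb⟩
  rw [← hinj.encard_image, himg, Set.encard_coe_eq_coe_finsetCard,
    Multiset.toFinset_card_of_nodup (nodup_roots hsep), ← hmon.natDegree_map e,
    (splits_iff_card_roots.1 (IsAlgClosed.splits _))]

end Count

/-! ### Coordinates on the charts of projective space -/

section Coordinates

open HomogeneousLocalization

variable {n : ℕ}

lemma awayEval_smul {F : MvPolynomial (Fin (n + 1)) ℂ} {m : ℕ} (hF : F ∈ grading n m)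
    {x : Fin (n + 1) → ℂ} (hx : MvPolynomial.eval x F ≠ 0) {s : ℂ}
    (hs : s ≠ 0) (hsx : MvPolynomial.eval (s • x) F ≠ 0) :
    awayEval F (s • x) hsx = awayEval F x hx := by
  refine RingHom.ext fun r => ?_
  obtain ⟨k, G, hG, rfl⟩ := Away.mk_surjective (grading n) hF r
  have h : ∀ {j : ℕ} {H : MvPolynomial (Fin (n + 1)) ℂ}, H ∈ grading n j →
      MvPolynomial.eval (s • x) H = s ^ j * MvPolynomial.eval x H := by
    intro j H hH
    rw [MvPolynomial.eval_eq', MvPolynomial.eval_eq', Finset.mul_sum]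
    refine Finset.sum_congr rfl fun d hd => ?_
    have hdj : d.degree = j := by
      by_contra hne
      exact MvPolynomial.mem_support_iff.1 hd (MvPolynomial.IsHomogeneous.coeff_eq_zero hH hne)
    simp only [Pi.smul_apply, smul_eq_mul, mul_pow, Finset.prod_mul_distrib,
      Finset.prod_pow_eq_pow_sum]
    rw [← hdj, Finsupp.degree_eq_sum]
    ring
  rw [awayEval_mk, awayEval_mk, h hF, h hG, mul_pow, ← pow_mul, smul_eq_mul, mul_comm m k,
    mul_div_mul_left _ _ (pow_ne_zero _ hs)]

lemma homogPt_smul {x : Fin (n + 1) → ℂ} (hx : x ≠ 0) {s : ℂ} (hs : s ≠ 0) (hsx : s • x ≠ 0) :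
    homogPt (s • x) hsx = homogPt x hx := by
  obtain ⟨j, hj⟩ := Function.ne_iff.1 hx
  have h1 : MvPolynomial.eval x (MvPolynomial.X j) ≠ 0 := by rwa [MvPolynomial.eval_X]
  have h2 : MvPolynomial.eval (s • x) (MvPolynomial.X j) ≠ 0 := by
    rw [MvPolynomial.eval_X, Pi.smul_apply, smul_eq_mul]
    exact mul_ne_zero hs hj
  refine Subtype.ext ?_
  rw [ι_homogPt Nat.one_pos (X_mem_grading j) hsx h2, ι_homogPt Nat.one_pos (X_mem_grading j) hx h1,
    awayEval_smul (X_mem_grading j) h1 hs]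

/-- The vector of homogeneous coordinates `x₀ = u_l`, `x_l = 1` and `x_i = u_i` for `i ≠ l`. -/
def chartVec (l : Fin n) (u : Fin n → ℂ) : Fin (n + 1) → ℂ :=
  Fin.cons (u l) (Function.update u l 1)

lemma chartVec_ne_zero (l : Fin n) (u : Fin n → ℂ) : chartVec l u ≠ 0 :=
  cons_ne_zero_of_eq_one _ (Function.update_self ..)

/-- The point of the chart `X_l ≠ 0` with the given coordinates. -/
def chartPt (l : Fin n) (u : Fin n → ℂ) : CPoints (projStr n) :=
  homogPt (chartVec l u) (chartVec_ne_zero l u)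

/-- The regular function `X_j / X_l` on the chart `X_l ≠ 0`. -/
def coordFun (l : Fin n) (j : Fin (n + 1)) :
    Γ(P n, Proj.basicOpen (grading n) (MvPolynomial.X l.succ)) :=
  Proj.awayToSection (grading n) (MvPolynomial.X l.succ)
    (Away.mk (grading n) (X_mem_grading l.succ) 1 (MvPolynomial.X j)
      (by rw [one_smul]; exact X_mem_grading j))

lemma homogPt_mem_chart_iff (l : Fin n) {x : Fin (n + 1) → ℂ} (hx : x ≠ 0) :
    (homogPt x hx).pt ∈ Proj.basicOpen (grading n) (MvPolynomial.X l.succ) ↔ x l.succ ≠ 0 := by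
  rw [homogPt_mem_basicOpen_iff Nat.one_pos (X_mem_grading _), MvPolynomial.eval_X]

lemma chartPt_mem_chart (l : Fin n) (u : Fin n → ℂ) :
    (chartPt l u).pt ∈ Proj.basicOpen (grading n) (MvPolynomial.X l.succ) := by
  rw [chartPt, homogPt_mem_chart_iff]
  simp [chartVec]

lemma value_coordFun (l : Fin n) (j : Fin (n + 1)) {x : Fin (n + 1) → ℂ} (hx : x ≠ 0)
    (h : (homogPt x hx).pt ∈ Proj.basicOpen (grading n) (MvPolynomial.X l.succ)) :
    (homogPt x hx).value h (coordFun l j) = x j / x l.succ := by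
  have hl : MvPolynomial.eval x (MvPolynomial.X l.succ) ≠ 0 := by
    rw [MvPolynomial.eval_X]; exact (homogPt_mem_chart_iff l hx).1 h
  have h1 := RingHom.congr_fun (valueHom_homogPt Nat.one_pos (X_mem_grading l.succ) hx hl h)
    (Away.mk (grading n) (X_mem_grading l.succ) 1 (MvPolynomial.X j)
      (by rw [one_smul]; exact X_mem_grading j))
  rw [awayEval_mk, MvPolynomial.eval_X, MvPolynomial.eval_X, pow_one] at h1
  exact h1

open Classical in
/-- The affine coordinates on the chart `X_l ≠ 0`, the `l`-th one being `X₀ / X_l`. -/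
def chartCoord (l : Fin n) (p : CPoints (projStr n)) : Fin n → ℂ :=
  if h : p.pt ∈ Proj.basicOpen (grading n) (MvPolynomial.X l.succ) then
    fun i => p.value h (coordFun l (if i = l then 0 else i.succ))
  else 0

lemma chartCoord_chartPt (l : Fin n) (u : Fin n → ℂ) : chartCoord l (chartPt l u) = u := by
  funext i
  rw [chartCoord, dif_pos (chartPt_mem_chart l u)]
  refine (value_coordFun l _ (chartVec_ne_zero l u) _).trans ?_
  by_cases hi : i = l
  · subst hi; simp [chartVec]
  · simp [chartVec, hi]

lemma isOpen_setOf_pt_mem {X : Scheme.{0}} {s : X ⟶ Spec (.of ℂ)} (U : X.Opens) :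
    IsOpen {x : CPoints s | x.pt ∈ U} := by
  refine TopologicalSpace.isOpen_generateFrom_of_mem ⟨U, 0, Set.univ, isOpen_univ, ?_⟩
  ext x
  exact ⟨fun h => ⟨h, trivial⟩, fun ⟨h, _⟩ => h⟩

lemma continuousOn_chartCoord (l : Fin n) : ContinuousOn (chartCoord l)
    {p | p.pt ∈ Proj.basicOpen (grading n) (MvPolynomial.X l.succ)} := by
  rw [continuousOn_pi]
  intro i
  rw [continuousOn_open_iff (isOpen_setOf_pt_mem _)]
  intro W hW
  refine TopologicalSpace.isOpen_generateFrom_of_mem ⟨_, coordFun l (if i = l then 0 else i.succ),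
    W, hW, ?_⟩
  ext p
  constructor
  · rintro ⟨h, hp⟩
    change p.pt ∈ Proj.basicOpen (grading n) (MvPolynomial.X l.succ) at h
    refine ⟨h, ?_⟩
    rwa [Set.mem_preimage, chartCoord, dif_pos h] at hp
  · rintro ⟨h, hp⟩
    refine ⟨h, ?_⟩
    rwa [Set.mem_preimage, chartCoord, dif_pos h]

lemma affinePt_eq_chartPt (l : Fin n) {z : Fin n → ℂ} (hz : z l ≠ 0) :
    affinePt z = chartPt l (Function.update (fun i => z i / z l) l (1 / z l)) := by
  rw [affinePt, ← homogPt_smul (cons_one_ne_zero z) (one_div_ne_zero hz)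
    (smul_ne_zero (one_div_ne_zero hz) (cons_one_ne_zero z)), chartPt]
  congr 1
  funext j
  refine Fin.cases ?_ (fun i => ?_) j
  · simp [chartVec]
  · by_cases hi : i = l
    · subst hi; simp [chartVec, hz]
    · simp [chartVec, hi, div_eq_inv_mul]

lemma homogPt_cons_eq_chartPt (l : Fin n) (x₀ : ℂ) {x : Fin n → ℂ} (h : x l = 1) :
    homogPt (Fin.cons x₀ x) (cons_ne_zero_of_eq_one x₀ h) =
      chartPt l (Function.update x l x₀) := by
  rw [chartPt]
  congr 1
  rw [chartVec, Function.update_self, Function.update_idem, ← h, Function.update_eq_self]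

end Coordinates

end

/-! ### Continuity and analyticity tested on an affine open set -/

section

section Values

open Filter Topology

variable {X Y : Scheme.{0}} {s : X ⟶ Spec (.of ℂ)} {t : Y ⟶ Spec (.of ℂ)}

/-- Pulled back to `X`, a regular function on `Y` is locally a quotient of functions on the affine
open `U`, so it is enough to control the latter. -/
lemma continuous_map_of_continuous_valueHom {S : Type*} [TopologicalSpace S] (f : X ⟶ Y)
    (hf : f ≫ t = s) {U : X.Opens} (hU : IsAffineOpen U) {ψ : S → CPoints s}
    (hψ : ∀ x, (ψ x).pt ∈ U) (hc : ∀ b, Continuous fun x => (ψ x).valueHom (hψ x) b) :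
    Continuous fun x => (ψ x).map f hf := by
  refine continuous_generateFrom_iff.2 ?_
  rintro _ ⟨W, r, O, hO, rfl⟩
  rw [isOpen_iff_mem_nhds]
  rintro x₀ ⟨h₀, hx₀⟩
  obtain ⟨b, b', hb, hval⟩ := CPoints.exists_value_map_eq_div f hf hU (ψ x₀) (hψ x₀) h₀ r
  obtain ⟨h₁, hv⟩ := hval (ψ x₀) (hψ x₀) hb
  rw [hv] at hx₀
  have hcont : ContinuousAt
      (fun x => (ψ x).valueHom (hψ x) b' / (ψ x).valueHom (hψ x) b) x₀ :=
    (hc b').continuousAt.div (hc b).continuousAt hb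
  filter_upwards [hcont.preimage_mem_nhds (hO.mem_nhds hx₀),
    (hc b).continuousAt.eventually_ne hb] with x h1 h2
  obtain ⟨h, hv⟩ := hval (ψ x) (hψ x) h2
  exact ⟨h, by rw [hv]; exact h1⟩

lemma isComplexAnalytic_map_of_analyticAt_valueHom {n : ℕ} {S : Set (Fin n → ℂ)} (f : X ⟶ Y)
    (hf : f ≫ t = s) {U : X.Opens} (hU : IsAffineOpen U) {ψ : S → CPoints s}
    (hψ : ∀ x, (ψ x).pt ∈ U) {g : Γ(X, U) → (Fin n → ℂ) → ℂ}
    (hg : ∀ b, ∀ z ∈ S, AnalyticAt ℂ (g b) z)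
    (hψg : ∀ b (z : S), (ψ z).valueHom (hψ z) b = g b z) :
    IsComplexAnalytic fun x => (ψ x).map f hf := by
  intro W r z₀ h₀
  obtain ⟨b, b', hb, hval⟩ := CPoints.exists_value_map_eq_div f hf hU (ψ z₀) (hψ z₀) h₀ r
  rw [hψg] at hb
  refine ⟨fun z => g b' z / g b z, (hg b' z₀ z₀.2).div (hg b z₀ z₀.2) hb, ?_⟩
  have hc : ContinuousAt (fun z : S => g b z) z₀ :=
    (hg b z₀ z₀.2).continuousAt.comp continuous_subtype_val.continuousAt
  filter_upwards [hc.eventually_ne hb] with z hz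
  obtain ⟨h, hv⟩ := hval (ψ z) (hψ z) (by rwa [hψg])
  exact ⟨h, by rw [hv, hψg, hψg]⟩

end Values

/-! ### Sector domains in chart coordinates -/

section SectorDomain

open Function Complex

variable {n : ℕ} (l : Fin n) (c : Fin n → ℂ) (ε θ η : ℝ)

/-- The conditions on the coordinates of a polydisc other than the `l`-th one. -/
def sectorBase : Set (Fin n → ℂ) := {u | ∀ i, i ≠ l → ‖u i - c i‖ < ε}

/-- The sector domain `D*_(θ,η)` in the coordinates of the chart `X_l ≠ 0`. -/
def chartDomain : Set (Fin n → ℂ) :=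
  sectorSet l (sectorBase l c ε) ε (-η) (-θ) ∪ {u | u l = 0 ∧ u ∈ sectorBase l c ε}

lemma sectorBase_eq : sectorBase l c ε =
    Set.pi {i | i ≠ l} fun i => Metric.ball (c i) ε := by
  ext u
  simp [sectorBase, Set.mem_pi, dist_eq_norm]

lemma isOpen_sectorBase : IsOpen (sectorBase l c ε) := by
  rw [sectorBase_eq]
  exact isOpen_set_pi (Set.toFinite _) fun i _ => Metric.isOpen_ball

lemma convex_sectorBase : Convex ℝ (sectorBase l c ε) := by
  rw [sectorBase_eq]
  exact convex_pi fun i _ => convex_ball _ _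

variable {l c ε θ η}

lemma norm_sub_lt_of_mem_chartDomain {u : Fin n → ℂ} (hε : 0 < ε) (hu : u ∈ chartDomain l c ε θ η) :
    ‖u l‖ < ε ∧ ∀ i, i ≠ l → ‖u i - c i‖ < ε := by
  rcases hu with hu | hu
  · refine ⟨hu.2.2.1, fun i hi => ?_⟩
    have := hu.1 i hi
    rwa [update_of_ne hi] at this
  · exact ⟨by rw [hu.1, norm_zero]; exact hε, hu.2⟩

/-- The coordinates in the chart `X_l ≠ 0` of a point of `ℂⁿ`. -/
def affineChartCoord (l : Fin n) (z : Fin n → ℂ) : Fin n → ℂ :=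
  update (fun i => z i / z l) l (1 / z l)

/-- The `l`-th chart coordinate is `1 / z l`, so arguments change sign and the sector `(θ, η)`
becomes `(-η, -θ)`. -/
lemma inv_eq_norm_mul_exp {w : ℂ} {t : ℝ} (h : w = ‖w‖ * exp (t * I)) :
    1 / w = ‖1 / w‖ * exp ((-t : ℝ) * I) := by
  conv_lhs => rw [h]
  rw [norm_div, norm_one, one_div, mul_inv, ← exp_neg]
  push_cast
  rw [neg_mul, one_div]

lemma ne_zero_of_mem_finitePart (hε : 0 < ε) {z : Fin n → ℂ} (hz : z ∈ finitePart l c ε) :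
    z l ≠ 0 := norm_pos_iff.1 ((inv_pos.2 hε).trans hz.1)

lemma affineChartCoord_mem_sectorSet (hε : 0 < ε) {z : Fin n → ℂ} (hz : z ∈ sectorDomain l c ε θ η) :
    affineChartCoord l z ∈ sectorSet l (sectorBase l c ε) ε (-η) (-θ) := by
  obtain ⟨hzf, t, ht1, ht2, ht⟩ := hz
  have hz0 := ne_zero_of_mem_finitePart hε hzf
  have hl : affineChartCoord l z l = 1 / z l := update_self ..
  refine ⟨fun i hi => ?_, ?_, ?_, -t, by linarith, by linarith, ?_⟩
  · rw [update_of_ne hi, affineChartCoord, update_of_ne hi]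
    exact hzf.2 i
  · rw [hl]; exact norm_pos_iff.2 (one_div_ne_zero hz0)
  · rw [hl, norm_div, norm_one, one_div]
    exact inv_lt_of_inv_lt₀ hε hzf.1
  · rw [hl]; exact inv_eq_norm_mul_exp ht

lemma exists_affinePt_eq_chartPt (hε : 0 < ε) (hc : c l = 1) {u : Fin n → ℂ}
    (hu : u ∈ sectorSet l (sectorBase l c ε) ε (-η) (-θ)) :
    ∃ z ∈ sectorDomain l c ε θ η, affinePt z = chartPt l u := by
  obtain ⟨hb, h0, hlt, t, ht1, ht2, ht⟩ := hu
  have hu0 := norm_pos_iff.1 h0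
  let z : Fin n → ℂ := fun i => update u l 1 i / u l
  have hzl : z l = 1 / u l := by simp [z]
  have hzi : ∀ i, z i / z l = update u l 1 i := fun i => by
    rw [hzl]; simp only [z]; field_simp
  refine ⟨z, ⟨⟨?_, fun i => ?_⟩, -t, by linarith, by linarith, ?_⟩, ?_⟩
  · rw [hzl, norm_div, norm_one, one_div]
    exact inv_strictAnti₀ h0 hlt
  · rw [hzi]
    by_cases hi : i = l
    · subst hi; simpa [hc] using hε
    · rw [update_of_ne hi]
      have := hb i hi
      rwa [update_of_ne hi] at this
  · rw [hzl]; exact inv_eq_norm_mul_exp ht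
  · rw [affinePt_eq_chartPt l (by rw [hzl]; exact one_div_ne_zero hu0)]
    congr 1
    funext i
    by_cases hi : i = l
    · subst hi; simp [hzl]
    · rw [update_of_ne hi, hzi, update_of_ne hi]

lemma exists_eq_chartPt_of_mem_sectorDomainStar (hε : 0 < ε) {p : CPoints (projStr n)}
    (hp : p ∈ sectorDomainStar l c ε θ η) : ∃ u ∈ chartDomain l c ε θ η, p = chartPt l u := by
  rcases hp with ⟨z, hz, rfl⟩ | ⟨⟨x₀, x, h, hx₀, hx, rfl⟩, hnot⟩
  · exact ⟨_, Or.inl (affineChartCoord_mem_sectorSet hε hz),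
      affinePt_eq_chartPt l (ne_zero_of_mem_finitePart hε hz.1)⟩
  -- If `x₀` were nonzero, division by it would produce an affine point of the polydisc.
  · have h0 : x₀ = 0 := by
      by_contra hne
      refine hnot ⟨fun i => x i / x₀, ⟨?_, fun i => ?_⟩, ?_⟩
      · simp only [h]
        rw [norm_div, norm_one, one_div]
        exact inv_strictAnti₀ (norm_pos_iff.2 hne) hx₀
      · simp only [h]
        rw [show x i / x₀ / (1 / x₀) = x i by field_simp]
        exact hx i
      · rw [affinePt_eq_chartPt l (by simp only [h]; exact one_div_ne_zero hne),
          homogPt_cons_eq_chartPt l x₀ h]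
        congr 1
        funext i
        by_cases hi : i = l
        · subst hi; simp [h]
        · rw [update_of_ne hi, update_of_ne hi]
          simp only [h]; field_simp
    subst h0
    refine ⟨update x l 0, Or.inr ⟨update_self .., fun i hi => ?_⟩, homogPt_cons_eq_chartPt l 0 h⟩
    rw [update_of_ne hi]; exact hx i

lemma chartCoord_mem_chartDomain (hε : 0 < ε) {p : CPoints (projStr n)}
    (hp : p ∈ sectorDomainStar l c ε θ η) : chartCoord l p ∈ chartDomain l c ε θ η := by
  obtain ⟨u, hu, rfl⟩ := exists_eq_chartPt_of_mem_sectorDomainStar hε hp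
  rwa [chartCoord_chartPt]

lemma chartPt_chartCoord (hε : 0 < ε) {p : CPoints (projStr n)}
    (hp : p ∈ sectorDomainStar l c ε θ η) : chartPt l (chartCoord l p) = p := by
  obtain ⟨u, hu, rfl⟩ := exists_eq_chartPt_of_mem_sectorDomainStar hε hp
  rw [chartCoord_chartPt]

lemma analyticAt_affineChartCoord {z : Fin n → ℂ} (hz : z l ≠ 0) :
    AnalyticAt ℂ (affineChartCoord l) z := by
  have hp : ∀ i, AnalyticAt ℂ (fun z : Fin n → ℂ => z i) z := fun i =>
    (ContinuousLinearMap.proj (R := ℂ) (φ := fun _ : Fin n => ℂ) i).analyticAt z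
  rw [analyticAt_pi_iff]
  intro i
  by_cases hi : i = l
  · subst hi
    simp only [affineChartCoord, update_self]
    exact analyticAt_const.div (hp i) hz
  · simp only [affineChartCoord, update_of_ne hi]
    exact (hp i).div (hp l) hz

end SectorDomain

end

/-! ### Fibres as sets of ring homomorphisms, and the bad locus at infinity -/

section

open HomogeneousLocalization

lemma CPoints.valueHom_congr {X : Scheme.{0}} {s : X ⟶ Spec (.of ℂ)} {x y : CPoints s} (e : x = y)
    {U : X.Opens} (hx : x.pt ∈ U) (hy : y.pt ∈ U) : x.valueHom hx = y.valueHom hy := by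
  subst e; rfl

section Fiber

variable {n : ℕ} {A : Scheme.{0}} {a : A ⟶ Spec (.of ℂ)} {X : Scheme.{0}}
  (i : X ⟶ pullback (projStr n) a) {F : MvPolynomial (Fin (n + 1)) ℂ} {m : ℕ}

lemma exists_fstPt_eq_valueHom_eq (hm : 0 < m) (hF : F ∈ grading n m)
    (hU : IsAffineOpen ((i ≫ pullback.fst (projStr n) a) ⁻¹ᵁ Proj.basicOpen (grading n) F))
    {x : Fin (n + 1) → ℂ} (hx0 : x ≠ 0) (hx : MvPolynomial.eval x F ≠ 0)
    (φ : Γ(X, (i ≫ pullback.fst (projStr n) a) ⁻¹ᵁ Proj.basicOpen (grading n) F) →+* ℂ)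
    (hφ : φ.comp (pullAway (i ≫ pullback.fst (projStr n) a) F _ le_rfl) = awayEval F x hx) :
    ∃ (y : CPoints (subStr i))
      (h : y.pt ∈ (i ≫ pullback.fst (projStr n) a) ⁻¹ᵁ Proj.basicOpen (grading n) F),
      fstPt i y = homogPt x hx0 ∧ y.valueHom h = φ := by
  have hy := (homogPt_mem_basicOpen_iff hm hF hx0).2 hx
  refine CPoints.exists_map_eq_valueHom_eq (i ≫ pullback.fst (projStr n) a) rfl hU
    (Proj.isAffineOpen_basicOpen (grading n) F hF hm) le_rfl (homogPt x hx0) hy φ ?_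
  refine RingHom.ext fun s => ?_
  obtain ⟨r, rfl⟩ := (bijective_awayToSection hm hF).2 s
  exact (RingHom.congr_fun hφ r).trans
    (RingHom.congr_fun (valueHom_homogPt hm hF hx0 hx hy) r).symm

lemma exists_valueHom_comp_pullAway_eq (hm : 0 < m) (hF : F ∈ grading n m)
    {x : Fin (n + 1) → ℂ} (hx0 : x ≠ 0) (hx : MvPolynomial.eval x F ≠ 0)
    {y : CPoints (subStr i)} (hy : fstPt i y = homogPt x hx0) :
    ∃ h : y.pt ∈ (i ≫ pullback.fst (projStr n) a) ⁻¹ᵁ Proj.basicOpen (grading n) F,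
      (y.valueHom h).comp (pullAway (i ≫ pullback.fst (projStr n) a) F _ le_rfl) =
        awayEval F x hx := by
  have hx' := (homogPt_mem_basicOpen_iff hm hF hx0).2 hx
  have hy' : (fstPt i y).pt ∈ Proj.basicOpen (grading n) F := by rw [hy]; exact hx'
  have h : y.pt ∈ (i ≫ pullback.fst (projStr n) a) ⁻¹ᵁ Proj.basicOpen (grading n) F := by
    have := hy'
    rw [fstPt, CPoints.pt_map] at this
    exact this
  refine ⟨h, RingHom.ext fun r => ?_⟩
  rw [← valueHom_homogPt hm hF hx0 hx hx']
  have h1 := y.valueHom_map (i ≫ pullback.fst (projStr n) a) (t := projStr n) rfl le_rfl h hy'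
  refine (RingHom.congr_fun h1 (Proj.awayToSection (grading n) F r)).symm.trans ?_
  exact RingHom.congr_fun (CPoints.valueHom_congr hy hy' hx') _

/-- Points of the fibre are complex points of `X` over `x`. They all lie in the affine preimage of
the chart of `F`, where complex points are ring homomorphisms to `ℂ`. -/
lemma encard_fiber_eq [IsClosedImmersion i] [LocallyOfFiniteType a] (hm : 0 < m)
    (hF : F ∈ grading n m)
    (hU : IsAffineOpen ((i ≫ pullback.fst (projStr n) a) ⁻¹ᵁ Proj.basicOpen (grading n) F))
    {x : Fin (n + 1) → ℂ} (hx0 : x ≠ 0) (hx : MvPolynomial.eval x F ≠ 0) :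
    {w : CPoints a | prodPt (homogPt x hx0) w ∈ Set.range i}.encard =
      {φ | RingHom.comp φ (pullAway (i ≫ pullback.fst (projStr n) a) F _ le_rfl) =
        awayEval F x hx}.encard := by
  have h1 : {w : CPoints a | prodPt (homogPt x hx0) w ∈ Set.range i} =
      sndPt i '' {y | fstPt i y = homogPt x hx0} := by
    ext w
    constructor
    · intro h
      obtain ⟨y, h1, h2⟩ := exists_fstPt_eq_sndPt_eq i h
      exact ⟨y, h1, h2⟩
    · rintro ⟨y, hy, rfl⟩
      change fstPt i y = _ at hy
      refine hy ▸ ?_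
      exact ⟨_, (prodPt_fstPt_sndPt i y).symm⟩
  have hinj : Set.InjOn (sndPt i) {y | fstPt i y = homogPt x hx0} := fun y hy y' hy' h =>
    eq_of_fstPt_eq_of_sndPt_eq i (Eq.trans hy (Eq.symm hy')) h
  rw [h1, hinj.encard_image]
  choose p hp hp1 hp2 using fun φ : {φ | RingHom.comp φ
      (pullAway (i ≫ pullback.fst (projStr n) a) F _ le_rfl) = awayEval F x hx} =>
    exists_fstPt_eq_valueHom_eq i hm hF hU hx0 hx φ.1 φ.2
  refine (Set.encard_congr (Equiv.ofBijective
    (fun φ => (⟨p φ, hp1 φ⟩ : {y | fstPt i y = homogPt x hx0})) ⟨fun φ ψ h => ?_, ?_⟩)).symm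
  · refine Subtype.ext ?_
    rw [← hp2 φ, ← hp2 ψ]
    exact CPoints.valueHom_congr (Subtype.ext_iff.1 h) _ _
  · rintro ⟨y, hy⟩
    obtain ⟨h, hφ⟩ := exists_valueHom_comp_pullAway_eq i hm hF hx0 hx hy
    exact ⟨⟨_, hφ⟩, Subtype.ext (CPoints.eq_of_valueHom_eq hU (hp _) h (hp2 _))⟩

end Fiber

section Numerator

variable {n : ℕ} {F : MvPolynomial (Fin (n + 1)) ℂ} {m : ℕ}

/-- `Q` is the numerator of `D` stripped of its powers of `X₀`. Even if `D` vanishes on `H`, away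
from `H` only the zeros of `Q` have to be avoided. -/
lemma exists_not_X_zero_dvd_awayEval_ne_zero (hF0 : F ≠ 0) (hF : F ∈ grading n m)
    {D : Away (grading n) F} (hD : D ≠ 0) :
    ∃ (Q : MvPolynomial (Fin (n + 1)) ℂ) (k : ℕ), Q ∈ grading n k ∧ ¬ MvPolynomial.X 0 ∣ Q ∧
      ∀ (x : Fin (n + 1) → ℂ) (hx : MvPolynomial.eval x F ≠ 0), x 0 ≠ 0 →
        MvPolynomial.eval x Q ≠ 0 → awayEval F x hx D ≠ 0 := by
  obtain ⟨k, G, hG, rfl⟩ := Away.mk_surjective (grading n) hF D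
  have hG0 : G ≠ 0 := fun h => hD ((away_mk_eq_zero_iff hF0 hF hG).2 h)
  obtain ⟨j, Q, hQ, rfl⟩ := WfDvdMonoid.max_power_factor hG0
    (MvPolynomial.X_prime (R := ℂ) (i := (0 : Fin (n + 1)))).irreducible
  have hX0 : (MvPolynomial.X 0 ^ j : MvPolynomial (Fin (n + 1)) ℂ) ≠ 0 := left_ne_zero_of_mul hG0
  have hXj : (MvPolynomial.X 0 ^ j : MvPolynomial (Fin (n + 1)) ℂ) ∈ grading n j := by
    simpa using SetLike.pow_mem_graded j (X_mem_grading (n := n) 0)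
  have hdeg : j ≤ k • m := by
    have h1 := MvPolynomial.IsHomogeneous.totalDegree hG hG0
    rw [MvPolynomial.totalDegree_mul_of_isDomain hX0 (right_ne_zero_of_mul hG0),
      MvPolynomial.IsHomogeneous.totalDegree hXj hX0] at h1
    omega
  obtain ⟨Q', hQ', h⟩ := exists_homogeneous_of_mul_eq (j := k • m - j) hXj
    (by rwa [Nat.add_sub_of_le hdeg]) rfl
  obtain rfl := mul_left_cancel₀ hX0 h
  refine ⟨Q, _, hQ', hQ, fun x hx hx0 hxQ => ?_⟩
  rw [awayEval_mk]
  refine div_ne_zero ?_ (pow_ne_zero _ hx)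
  rw [map_mul, map_pow, MvPolynomial.eval_X]
  exact mul_ne_zero (pow_ne_zero _ hx0) hxQ

end Numerator

section Hyperplane

variable {n : ℕ}

/-- Every nonempty open subset of `H` contains its generic point, and so does the complement of `Q =
0`. -/
lemma dense_hyperplaneAtInfinity_inter (l : Fin n) {Q : MvPolynomial (Fin (n + 1)) ℂ} {m : ℕ}
    (hm : 0 < m) (hQ : Q ∈ grading n m) (hXQ : ¬ MvPolynomial.X 0 ∣ Q) :
    Dense {p : hyperplaneAtInfinity n | p.1 ∈ Proj.basicOpen (grading n) Q} := by
  rw [dense_iff_inter_open]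
  rintro _ ⟨W, hW, rfl⟩ ⟨p, hp⟩
  obtain ⟨G, k, hk, hG, hpG, hGW⟩ := exists_basicOpen_le ⟨W, hW⟩ hp
  have hXG : ¬ MvPolynomial.X 0 ∣ G := by
    rintro ⟨G', rfl⟩
    rw [Proj.basicOpen_mul] at hpG
    exact p.2 hpG.1
  have hg (P : MvPolynomial (Fin (n + 1)) ℂ) (j : ℕ) (hj : 0 < j) (hP : P ∈ grading n j) :=
    genericAtInfinity_mem_basicOpen_iff l hj hP
  exact ⟨⟨genericAtInfinity l, fun h => (hg _ 1 Nat.one_pos (X_mem_grading 0)).1 h dvd_rfl⟩,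
    hGW ((hg G k hk hG).2 hXG), (hg Q m hm hQ).2 hXQ⟩

lemma exists_pos_eval_chartVec_ne_zero {l : Fin n} {c : Fin n → ℂ} (hc : c l = 1)
    {Q : MvPolynomial (Fin (n + 1)) ℂ} (hQ : MvPolynomial.eval (Fin.cons 0 c) Q ≠ 0) :
    ∃ ε₀ : ℝ, 0 < ε₀ ∧ ∀ ε θ η, 0 < ε → ε ≤ ε₀ → ∀ u ∈ chartDomain l c ε θ η,
      MvPolynomial.eval (chartVec l u) Q ≠ 0 := by
  have hcont : Continuous fun x : Fin (n + 1) → ℂ => MvPolynomial.eval x Q :=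
    MvPolynomial.continuous_eval Q
  obtain ⟨ε₀, hε₀, h⟩ := Metric.eventually_nhds_iff.1 (hcont.continuousAt.eventually_ne hQ)
  refine ⟨ε₀, hε₀, fun ε θ η hε hle u hu => h ?_⟩
  obtain ⟨h1, h2⟩ := norm_sub_lt_of_mem_chartDomain hε hu
  rw [dist_pi_lt_iff hε₀]
  refine Fin.cases ?_ fun j => ?_
  · simpa [chartVec] using h1.trans_le hle
  · by_cases hj : j = l
    · subst hj; simpa [chartVec, hc] using hε₀
    · simpa [chartVec, hj, dist_eq_norm] using (h2 j hj).trans_le hle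

end Hyperplane

end

/-! ### Construction of the sections over a sector -/

section

open HomogeneousLocalization

section Evaluation

variable {n : ℕ}

lemma analyticAt_eval_chartVec (l : Fin n) (G : MvPolynomial (Fin (n + 1)) ℂ) (u : Fin n → ℂ) :
    AnalyticAt ℂ (fun u => MvPolynomial.eval (chartVec l u) G) u := by
  have hp : ∀ i, AnalyticAt ℂ (fun z : Fin n → ℂ => z i) u := fun i =>
    (ContinuousLinearMap.proj (R := ℂ) (φ := fun _ : Fin n => ℂ) i).analyticAt u
  simp only [← MvPolynomial.coe_aeval_eq_eval]
  refine AnalyticAt.aeval_mvPolynomial (fun j => ?_) G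
  refine Fin.cases (by simpa [chartVec] using hp l) (fun i => ?_) j
  by_cases hi : i = l
  · subst hi; simpa [chartVec] using analyticAt_const
  · simpa [chartVec, hi] using hp i

/-- Fractions with denominator `F` form a family of ring homomorphisms that is analytic in the
coordinates of a chart, where `F` is nonzero. -/
lemma exists_analyticAt_awayEval (l : Fin n) {F : MvPolynomial (Fin (n + 1)) ℂ} (hF0 : F ≠ 0)
    {m : ℕ} (hF : F ∈ grading n m) :
    ∃ ev : (Fin n → ℂ) → Away (grading n) F →+* ℂ,
      ∀ u (h : MvPolynomial.eval (chartVec l u) F ≠ 0), ev u = awayEval F (chartVec l u) h ∧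
        ∀ r, AnalyticAt ℂ (fun u => ev u r) u := by
  classical
  obtain ⟨x, hx⟩ := exists_eval_ne_zero hF0
  -- Where `F` vanishes, the evaluation at an arbitrary point `x` with `F(x) ≠ 0` serves as default
  -- value.
  let ev : (Fin n → ℂ) → Away (grading n) F →+* ℂ := fun u =>
    if h : MvPolynomial.eval (chartVec l u) F ≠ 0 then awayEval F (chartVec l u) h
    else awayEval F x hx
  have hev : ∀ u (h : MvPolynomial.eval (chartVec l u) F ≠ 0),
    ev u = awayEval F (chartVec l u) h := fun u h => dif_pos h
  refine ⟨ev, fun u h => ⟨hev u h, fun r => ?_⟩⟩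
  obtain ⟨k, G, hG, rfl⟩ := Away.mk_surjective (grading n) hF r
  have hA := (analyticAt_eval_chartVec l G u).div ((analyticAt_eval_chartVec l F u).pow k)
    (pow_ne_zero k h)
  refine hA.congr ?_
  filter_upwards [(analyticAt_eval_chartVec l F u).continuousAt.eventually_ne h] with v hv
  rw [hev v hv, awayEval_mk]
  rfl

end Evaluation

section Sections

variable {n : ℕ} {A : Scheme.{0}} {a : A ⟶ Spec (.of ℂ)} [LocallyOfFiniteType a] {X : Scheme.{0}}
  (i : X ⟶ pullback (projStr n) a) [IsClosedImmersion i]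
  {F : MvPolynomial (Fin (n + 1)) ℂ} {m : ℕ}
  [IsDomain (Away (grading n) F)] [IsIntegrallyClosed (Away (grading n) F)]
  [IsDomain Γ(X, (i ≫ pullback.fst (projStr n) a) ⁻¹ᵁ Proj.basicOpen (grading n) F)]
  [Algebra (Away (grading n) F)
    Γ(X, (i ≫ pullback.fst (projStr n) a) ⁻¹ᵁ Proj.basicOpen (grading n) F)]
  [Module.Finite (Away (grading n) F)
    Γ(X, (i ≫ pullback.fst (projStr n) a) ⁻¹ᵁ Proj.basicOpen (grading n) F)]
  [FaithfulSMul (Away (grading n) F)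
    Γ(X, (i ≫ pullback.fst (projStr n) a) ⁻¹ᵁ Proj.basicOpen (grading n) F)]

/-- At a point where finitely many nonzero polynomials do not vanish, the fibre has `d` points by
hypothesis and as many as the degree of the minimal polynomial by unramifiedness. -/
lemma natDegree_eq_of_hasDegree (hm : 0 < m) (hF0 : F ≠ 0) (hF : F ∈ grading n m)
    (hU : IsAffineOpen ((i ≫ pullback.fst (projStr n) a) ⁻¹ᵁ Proj.basicOpen (grading n) F))
    (halg : algebraMap (Away (grading n) F)
      Γ(X, (i ≫ pullback.fst (projStr n) a) ⁻¹ᵁ Proj.basicOpen (grading n) F) =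
      pullAway (i ≫ pullback.fst (projStr n) a) F _ le_rfl)
    {b : Γ(X, (i ≫ pullback.fst (projStr n) a) ⁻¹ᵁ Proj.basicOpen (grading n) F)}
    {D : Away (grading n) F} (hD : D ≠ 0)
    (hsep : ∀ e : Away (grading n) F →+* ℂ, e D ≠ 0 →
      ((minpoly (Away (grading n) F) b).map e).Separable)
    (hgen : ∀ b', ∃ q : Polynomial (Away (grading n) F), D • b' = Polynomial.aeval b q)
    {d : ℕ} (hdeg : HasDegree (Set.range i) d) :
    (minpoly (Away (grading n) F) b).natDegree = d := by
  obtain ⟨U, ⟨p, hp⟩, hUd⟩ := hdeg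
  obtain ⟨G, k, hk, hG, hpG, hGU⟩ := exists_basicOpen_le U hp
  have hG0 : G ≠ 0 := by
    rintro rfl
    rw [Proj.basicOpen_zero] at hpG
    exact hpG
  obtain ⟨Q, -, -, hXQ, hQ⟩ := exists_not_X_zero_dvd_awayEval_ne_zero hF0 hF hD
  have hQ0 : Q ≠ 0 := fun h => hXQ (h ▸ dvd_zero _)
  obtain ⟨x, hx⟩ := exists_eval_ne_zero
    (mul_ne_zero (mul_ne_zero (MvPolynomial.X_ne_zero (R := ℂ) (0 : Fin (n + 1))) hQ0)
      (mul_ne_zero hG0 hF0))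
  simp only [map_mul, mul_ne_zero_iff, MvPolynomial.eval_X] at hx
  obtain ⟨⟨hx1, hxQ⟩, hxG, hxF⟩ := hx
  have hx0 := ne_zero_of_eval_ne_zero hm hF hxF
  have h1 := hUd (homogPt x hx0) (hGU ((homogPt_mem_basicOpen_iff hk hG hx0).2 hxG))
  have hDx := hQ x hxF hx1 hxQ
  rw [encard_fiber_eq i hm hF hU hx0 hxF, ← halg,
    encard_ringHom_extensions hDx (hsep _ hDx) hgen] at h1
  exact_mod_cast h1

-- Each homomorphism `β j u` is a complex point of `X` over the chart point `u`; its second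
-- projection is the value of the `j`-th section.
open Function in
theorem exists_sector_sections (hm : 0 < m) (hF0 : F ≠ 0) (hF : F ∈ grading n m)
    (hU : IsAffineOpen ((i ≫ pullback.fst (projStr n) a) ⁻¹ᵁ Proj.basicOpen (grading n) F))
    (halg : algebraMap (Away (grading n) F)
      Γ(X, (i ≫ pullback.fst (projStr n) a) ⁻¹ᵁ Proj.basicOpen (grading n) F) =
      pullAway (i ≫ pullback.fst (projStr n) a) F _ le_rfl)
    {b : Γ(X, (i ≫ pullback.fst (projStr n) a) ⁻¹ᵁ Proj.basicOpen (grading n) F)}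
    {D : Away (grading n) F}
    (hsep : ∀ e : Away (grading n) F →+* ℂ, e D ≠ 0 →
      ((minpoly (Away (grading n) F) b).map e).Separable)
    (hgen : ∀ b', ∃ q : Polynomial (Away (grading n) F), D • b' = Polynomial.aeval b q)
    {l : Fin n} {c : Fin n → ℂ} (hc : c l = 1) {ε θ η : ℝ} (hε : 0 < ε) (hθη : θ < η)
    (hηθ : η ≤ θ + 2 * Real.pi)
    (hFu : ∀ u ∈ chartDomain l c ε θ η, MvPolynomial.eval (chartVec l u) F ≠ 0)
    (hDu : ∀ u ∈ sectorSet l (sectorBase l c ε) ε (-η) (-θ),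
      ∀ h : MvPolynomial.eval (chartVec l u) F ≠ 0, awayEval F (chartVec l u) h D ≠ 0) :
    ∃ α : Fin (minpoly (Away (grading n) F) b).natDegree →
        sectorDomainStar l c ε θ η → CPoints a,
      Function.Injective α ∧ (∀ j, Continuous (α j)) ∧
      (∀ j z, prodPt z.1 (α j z) ∈ Set.range i) ∧
      (∀ (z : sectorDomainStar l c ε θ η) (w : CPoints a),
        prodPt z.1 w ∈ Set.range i → ∃ k, α k z = w) ∧
      (∀ j, IsComplexAnalytic fun z => α j (sectorIncl l c ε θ η z)) := by
  obtain ⟨ev, hev⟩ := exists_analyticAt_awayEval l hF0 hF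
  have hST : sectorSet l (sectorBase l c ε) ε (-η) (-θ) ⊆ chartDomain l c ε θ η :=
    Set.subset_union_left
  have hbase : update c l 0 ∈ sectorBase l c ε := fun j hj => by simpa [hj] using hε
  obtain ⟨β, hβev, hβinj, hβex, hβc, hβa⟩ := exists_branches (isOpen_sectorBase l c ε)
    (convex_sectorBase l c ε) hε (neg_lt_neg hθη) (by linarith)
    ⟨update c l 0, hbase, update_self ..⟩ (κ := awayConst F) (T := chartDomain l c ε θ η) rfl
    (fun u hu x => by rw [(hev u (hFu u hu)).1]; exact awayEval_awayConst _ x)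
    (fun r u hu => (hev u (hFu u hu)).2 r)
    (fun u hu => by rw [(hev u (hFu u (hST hu))).1]; exact hDu u hu _) hsep hgen
  have hmem (z : sectorDomainStar l c ε θ η) := chartCoord_mem_chartDomain hε z.2
  choose ψ hψU hψ1 hψ2 using fun (j) (z : sectorDomainStar l c ε θ η) =>
    exists_fstPt_eq_valueHom_eq i hm hF hU (chartVec_ne_zero l (chartCoord l z.1))
      (hFu _ (hmem z)) (β j (chartCoord l z.1))
      (by rw [← halg, hβev j _ (hmem z)]; exact (hev _ (hFu _ (hmem z))).1)
  have hψfst (j) (z : sectorDomainStar l c ε θ η) : fstPt i (ψ j z) = z.1 :=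
    (hψ1 j z).trans (chartPt_chartCoord hε z.2)
  refine ⟨fun j z => sndPt i (ψ j z), ?_, fun j => ?_, fun j z => ?_, fun z w hw => ?_, fun j => ?_⟩
  · intro j k hjk
    -- The maps are told apart at one point with `u_l ≠ 0`; over `H` the branches may coincide.
    obtain ⟨w, hw⟩ := exists_mem_sectorSet (l := l) (N := sectorBase l c ε) (z := c) hε
      (neg_lt_neg hθη) hbase
    obtain ⟨z, hz, hzu⟩ := exists_affinePt_eq_chartPt hε hc hw
    let z' : sectorDomainStar l c ε θ η := sectorIncl l c ε θ η ⟨z, hz⟩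
    have hz' : chartCoord l z'.1 = update c l w := by
      change chartCoord l (affinePt z) = _
      rw [hzu, chartCoord_chartPt]
    refine hβinj _ hw ?_
    change β j _ = β k _
    rw [← hz', ← hψ2 j z', ← hψ2 k z']
    exact CPoints.valueHom_congr (eq_of_fstPt_eq_of_sndPt_eq i ((hψfst j z').trans
      (hψfst k z').symm) (congrFun hjk z')) _ _
  · refine continuous_map_of_continuous_valueHom (i ≫ pullback.snd (projStr n) a)
      (snd_comp_eq_subStr i) hU (hψU j) fun b' => ?_
    simp only [hψ2]
    refine (hβc j b').comp_continuous ?_ hmem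
    rw [← continuousOn_univ]
    refine (continuousOn_chartCoord l).comp continuous_subtype_val.continuousOn fun z _ => ?_
    change z.1.pt ∈ Proj.basicOpen (grading n) (MvPolynomial.X l.succ)
    rw [← chartPt_chartCoord hε z.2]
    exact chartPt_mem_chart l _
  · have := prodPt_fstPt_sndPt i (ψ j z)
    rw [hψfst] at this
    exact ⟨_, this.symm⟩
  · obtain ⟨y, hy1, rfl⟩ := exists_fstPt_eq_sndPt_eq i hw
    obtain ⟨h, hy⟩ := exists_valueHom_comp_pullAway_eq i hm hF
      (chartVec_ne_zero l (chartCoord l z.1)) (hFu _ (hmem z))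
      (hy1.trans (chartPt_chartCoord hε z.2).symm)
    rw [← halg, ← (hev _ (hFu _ (hmem z))).1] at hy
    obtain ⟨k, hk⟩ := hβex _ (hmem z) _ hy
    exact ⟨k, congrArg (sndPt i)
      (CPoints.eq_of_valueHom_eq hU (hψU k z) h ((hψ2 k z).trans hk))⟩
  · refine isComplexAnalytic_map_of_analyticAt_valueHom (i ≫ pullback.snd (projStr n) a)
      (snd_comp_eq_subStr i) hU (ψ := fun z => ψ j (sectorIncl l c ε θ η z)) (fun z => hψU j _)
      (g := fun b' z => β j (affineChartCoord l z) b') (fun b' z hz => ?_) fun b' z => ?_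
    · exact (hβa j b' _ (affineChartCoord_mem_sectorSet hε hz)).comp
        (analyticAt_affineChartCoord (ne_zero_of_mem_finitePart hε hz.1))
    · rw [hψ2]
      have : chartCoord l (sectorIncl l c ε θ η z).1 = affineChartCoord l z :=
        (congrArg (chartCoord l)
          (affinePt_eq_chartPt l (ne_zero_of_mem_finitePart hε z.2.1))).trans
          (chartCoord_chartPt l _)
      rw [this]

end Sections

end

/-! ### Choice of the dense open set at infinity -/

section

open HomogeneousLocalization

lemma exists_homogPt_pt_mem {n : ℕ} {U : (P n).Opens} (hU : (U : Set (P n)).Nonempty) :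
    ∃ z : CPoints (projStr n), z.pt ∈ U := by
  obtain ⟨p, hp⟩ := hU
  obtain ⟨G, k, hk, hG, hpG, hGU⟩ := exists_basicOpen_le U hp
  have hG0 : G ≠ 0 := by
    rintro rfl
    rw [Proj.basicOpen_zero] at hpG
    exact hpG
  obtain ⟨x, hx⟩ := exists_eval_ne_zero hG0
  have hx0 := ne_zero_of_eval_ne_zero hk hG hx
  exact ⟨homogPt x hx0, hGU ((homogPt_mem_basicOpen_iff hk hG hx0).2 hx)⟩

/-- `C` is the part of `H` where `F * Q ≠ 0`: there `F` keeps the projection finite, and `Q` keeps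
ramification confined to `H`. -/
theorem exists_dense_sector_sections {n d : ℕ} {A X : Scheme.{0}} {a : A ⟶ Spec (.of ℂ)} [IsProper a]
    (i : X ⟶ pullback (projStr n) a) [IsClosedImmersion i] [IsIntegral X]
    (hsurj : Function.Surjective (i ≫ pullback.fst (projStr n) a))
    (hdeg : HasDegree (Set.range i) d) (l₀ : Fin n) :
    ∃ C : Set (hyperplaneAtInfinity n), IsOpen C ∧ Dense C ∧
      ∀ (l : Fin n) (c : Fin n → ℂ) (hc : c l = 1),
        (homogPt (Fin.cons 0 c) (cons_ne_zero_of_eq_one 0 hc)).pt ∈ Subtype.val '' C →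
        ∃ ε₀ : ℝ, 0 < ε₀ ∧ ∀ ε : ℝ, 0 < ε → ε ≤ ε₀ →
          ∀ θ η : ℝ, θ < η → η ≤ θ + 2 * Real.pi →
            ∃ α : Fin d → sectorDomainStar l c ε θ η → CPoints a,
              Function.Injective α ∧ (∀ i, Continuous (α i)) ∧
              (∀ j z, prodPt z.1 (α j z) ∈ Set.range i) ∧
              (∀ (z : sectorDomainStar l c ε θ η) (w : CPoints a),
                prodPt z.1 w ∈ Set.range i → ∃ k, α k z = w) ∧
              (∀ i, IsComplexAnalytic fun z => α i (sectorIncl l c ε θ η z)) := by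
  obtain ⟨z, hz⟩ : ∃ z : CPoints (projStr n), {w : CPoints a | prodPt z w ∈ Set.range i}.Finite := by
    obtain ⟨U, hU, hUd⟩ := hdeg
    obtain ⟨z, hz⟩ := exists_homogPt_pt_mem hU
    exact ⟨z, Set.finite_of_encard_eq_coe (hUd z hz)⟩
  obtain ⟨F, m, hm, hF, hXF, hU, hfin⟩ :=
    exists_finite_basicOpen (i ≫ pullback.fst (projStr n) a) hsurj (finite_preimage_fst i z hz) l₀
  have hF0 : F ≠ 0 := fun h => hXF (h ▸ dvd_zero _)
  have := isDomain_away hF0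
  have := isIntegrallyClosed_away hF0 hF
  have := charZero_away hF0
  have hne := nonempty_preimage_basicOpen _ hsurj hF0 hm hF
  let _ := (pullAway (i ≫ pullback.fst (projStr n) a) F _ le_rfl).toAlgebra
  have : Module.Finite (Away (grading n) F)
    Γ(X, (i ≫ pullback.fst (projStr n) a) ⁻¹ᵁ Proj.basicOpen (grading n) F) := hfin
  have : FaithfulSMul (Away (grading n) F)
      Γ(X, (i ≫ pullback.fst (projStr n) a) ⁻¹ᵁ Proj.basicOpen (grading n) F) :=
    (faithfulSMul_iff_algebraMap_injective _ _).2 (pullAway_injective _ hsurj hF0 hm hF le_rfl)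
  obtain ⟨b, D, hD, hsep, hgen⟩ := exists_generic_generator (R := Away (grading n) F)
    (B := Γ(X, (i ≫ pullback.fst (projStr n) a) ⁻¹ᵁ Proj.basicOpen (grading n) F))
  obtain rfl := natDegree_eq_of_hasDegree i hm hF0 hF hU rfl hD hsep hgen hdeg
  obtain ⟨Q, k, hQ, hXQ, hQD⟩ := exists_not_X_zero_dvd_awayEval_ne_zero hF0 hF hD
  have hFQ : F * Q ∈ grading n (m + k) := SetLike.mul_mem_graded hF hQ
  have hmk : 0 < m + k := by omega
  refine ⟨{p | p.1 ∈ Proj.basicOpen (grading n) (F * Q)},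
    (Proj.basicOpen (grading n) (F * Q)).isOpen.preimage continuous_subtype_val,
    dense_hyperplaneAtInfinity_inter l₀ hmk hFQ fun h =>
      (MvPolynomial.X_prime.dvd_or_dvd h).elim hXF hXQ, ?_⟩
  rintro l c hc ⟨p, hp, hpc⟩
  have hp' : (homogPt (Fin.cons 0 c) (cons_ne_zero_of_eq_one 0 hc)).pt ∈
    Proj.basicOpen (grading n) (F * Q) := hpc ▸ hp
  rw [homogPt_mem_basicOpen_iff hmk hFQ] at hp'
  obtain ⟨ε₀, hε₀, h⟩ := exists_pos_eval_chartVec_ne_zero hc hp'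
  simp only [map_mul, mul_ne_zero_iff] at h
  refine ⟨ε₀, hε₀, fun ε hε hle θ η hθη hηθ => exists_sector_sections i hm hF0 hF hU rfl hsep hgen
    hc hε hθη hηθ (fun u hu => (h ε θ η hε hle u hu).1) fun u hu hu' => ?_⟩
  -- In the open sector `x₀ = u_l` is nonzero, so the power of `X₀` in `D` does no harm.
  refine hQD _ hu' ?_ (h ε θ η hε hle u (Or.inl hu)).2
  simpa [chartVec] using norm_pos_iff.1 hu.2.1

end

end AlgMap

end

open AlgMap in
theorem mainTheorem4 (n d : ℕ)
    -- `A` is a complete complex variety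
    (A : Scheme.{0}) (a : A ⟶ Spec (.of ℂ)) [IsReduced A] [IsProper a]
    -- `V` is a (closed) irreducible subvariety of `ℙⁿ × A` of dimension `n`
    (V : Set ↥(pullback (projStr n) a)) (hV : IsClosed V) (hirr : IsIrreducible V)
    (hdim : topologicalKrullDim V = n)
    -- whose projection to `ℙⁿ` is surjective of degree `d`
    (hsurj : pullback.fst (projStr n) a '' V = Set.univ) (hdeg : HasDegree V d) :
    -- there is a Zariski open dense subset `C` of the hyperplane at infinity such that,
    ∃ C : Set (hyperplaneAtInfinity n), IsOpen C ∧ Dense C ∧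
      -- for all `ℓ ≥ 1` and all `c = [0 : c₁ : ⋯ : cₙ] ∈ C ∩ U_ℓ`, with `c_ℓ = 1`,
      ∀ (l : Fin n) (c : Fin n → ℂ) (hc : c l = 1),
        (homogPt (Fin.cons 0 c) (cons_ne_zero_of_eq_one 0 hc)).pt ∈ Subtype.val '' C →
        -- for all sufficiently small polydiscs at `c` in the chart `U_ℓ`, and all sectors,
        ∃ ε₀ : ℝ, 0 < ε₀ ∧ ∀ ε : ℝ, 0 < ε → ε ≤ ε₀ →
          ∀ θ η : ℝ, θ < η → η ≤ θ + 2 * Real.pi →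
            ∃ α : Fin d → sectorDomainStar l c ε θ η → CPoints a,
              Function.Injective α ∧ (∀ i, Continuous (α i)) ∧
              (∀ i z, prodPt z.1 (α i z) ∈ V) ∧
              (∀ (z : sectorDomainStar l c ε θ η) (w : CPoints a),
                prodPt z.1 w ∈ V → ∃ k, α k z = w) ∧
              (∀ i, IsComplexAnalytic fun z => α i (sectorIncl l c ε θ η z)) := by
  obtain ⟨X, i, hX, hi, rfl⟩ := exists_isIntegral_isClosedImmersion_range_eq hV hirr
  have hsurj' : Function.Surjective (i ≫ pullback.fst (projStr n) a) := by
    intro p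
    obtain ⟨_, ⟨x, rfl⟩, hx⟩ := hsurj.symm ▸ Set.mem_univ p
    exact ⟨x, (Scheme.Hom.comp_apply ..).trans hx⟩
  rcases isEmpty_or_nonempty (Fin n) with hn | ⟨⟨l₀⟩⟩
  -- For `n = 0` there is no chart `U_ℓ` with `ℓ ≥ 1`, and the assertion is vacuous.
  · exact ⟨Set.univ, isOpen_univ, dense_univ, fun l => isEmptyElim l⟩
  exact exists_dense_sector_sections i hsurj' hdeg l₀
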